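/- Let $M$ be a connected smooth manifold (Hausdorff, second countable) of dimension $n$, and let $\nabla$ be a smooth symmetric (torsion-free) connection on $M$ with a parallel Riemannian metric $h$. Assume that $\nabla$ is generic: for every $m\in M$ there are $\xi_1,\xi_2\in T_mM$ such that the curvature transformation $R(\xi_1,\xi_2):T_mM\to T_mM$ has $n$ distinct complex eigenvalues. Metrics are written contravariantly, as sections $\sum g^{ij}X_i\otimes X_j$ of $TM\otimes TM$, that is, as positive definite bilinear forms on the cotangent spaces. An adapted cover of $M$ is a set $\mathcal U$ of connected open sets $U$ covering $M$, together with, for each $U\in\mathcal U$, smooth vector fields $\xi_1,\xi_2$ on $U$ such that $R(\xi_1(u),\xi_2(u))$ has $n$ distinct complex eigenvalues for all $u\in U$, and a smooth $h$-orthonormal frame $(Y_1,\dots,Y_n)$ on $U$ such that $Y_1\pm iY_2,\ Y_3\pm iY_4,\dots$ are (complex) eigenvector fields of $R(\xi_1,\xi_2)$ and, if $n$ is odd, $Y_n$ is an eigenvector field for the eigenvalue $0$. Given these data, write $\nabla Y_j=\sum_i Y_i\otimes\omega^i_j$ on $U$, let $r(U)$ be the equivalence relation on $\{1,\dots,n\}$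 generated by the pairs $(i,j)$ with $\omega^i_j(u)\ne0$ for some $u\in U$, let $P_1(U),\dots,P_{\beta(U)}(U)$ be its classes, and let $\bar Q_i(U)$ be the subbundle of $TU$ spanned by the $Y_j$ with $j\in P_i(U)$. On the set of pairs $(i,U)$ with $U\in\mathcal U$, $1\le i\le\beta(U)$, let $\sim$ be the equivalence relation generated by $(i,U)\sim(j,V)$ whenever $\bar Q_i(U)_m\cap\bar Q_j(V)_m\neq0$ for some $m\in U\cap V$. Then adapted covers exist, and for every adapted cover the following holds. The relation $\sim$ has finitely many classes $I_1,\dots,I_A$. There are well-defined nonzero distributions $Q_1,\dots,Q_A$ on $M$ with $Q_a|_U=\bigoplus_{\{i:(i,U)\in I_a\}}\bar Q_i(U)$ for every $U\in\mathcal U$, and $TM=Q_1\oplus\cdots\oplus Q_A$. Let $T^*M=Q_1^*\oplus\cdots\oplus Q_A^*$ be the dual decomposition, and let $h_a$ be the contravariant tensor field that equals $h$ on $Q_a^*\times Q_a^*$ and vanishes on $Q_b^*\times Q_c^*$ unless $b=c=a$. Then $h_1,\dots,h_A$ are linearly independent over $\mathbb R$, and the set of all $\nabla$-parallel metrics on $M$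 is the open positive cone $$\Big\{\sum_{a=1}^A c_ah_a \;:\; c_1,\dots,c_A>0\Big\}.$$ With the topology of pointwise convergence this set is a smooth manifold of dimension $A$, and $(c_1,\dots,c_A)\mapsto\sum_a c_ah_a$ is a diffeomorphism onto it from the open orthant $(0,\infty)^A$. -/

import Mathlib

open Bundle Manifold TopologicalSpace
open scoped ContDiff TensorProduct

noncomputable section

namespace ParallelMetrics

/-- The cotangent space at `x`. -/
abbrev Cotangent (n : ℕ) {M : Type*} [TopologicalSpace M]
    [ChartedSpace (EuclideanSpace ℝ (Fin n)) M] (x : M) : Type :=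
  TangentSpace (𝓡 n) x →L[ℝ] ℝ

/-- Bilinear forms on the cotangent space at `x`, i.e. elements of `T_x M ⊗ T_x M`. -/
abbrev CoTensorAt (n : ℕ) {M : Type*} [TopologicalSpace M]
    [ChartedSpace (EuclideanSpace ℝ (Fin n)) M] (x : M) : Type :=
  Cotangent n x →L[ℝ] Cotangent n x →L[ℝ] ℝ

/-- Contravariant 2-tensor fields, i.e. sections of `TM ⊗ TM`, regarded as bilinear forms on the
cotangent spaces, with the topology of pointwise convergence. -/
abbrev CoTensor (n : ℕ) (M : Type*) [TopologicalSpace M]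
    [ChartedSpace (EuclideanSpace ℝ (Fin n)) M] : Type _ :=
  ∀ x : M, CoTensorAt n x

section Shortcuts

/-! Shortcuts to the standard instances. -/

variable {n : ℕ} {M : Type*} [TopologicalSpace M] [ChartedSpace (EuclideanSpace ℝ (Fin n)) M]

instance (x : M) : TopologicalSpace (Cotangent n x) := ContinuousLinearMap.topologicalSpace
instance (x : M) : AddCommGroup (Cotangent n x) := ContinuousLinearMap.addCommGroup
instance (x : M) : Module ℝ (Cotangent n x) := ContinuousLinearMap.module
instance (x : M) : IsTopologicalAddGroup (Cotangent n x) :=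
  ContinuousLinearMap.topologicalAddGroup
instance (x : M) : ContinuousSMul ℝ (Cotangent n x) := ContinuousLinearMap.continuousSMul
instance (x : M) : TopologicalSpace (Cotangent n x →L[ℝ] ℝ) :=
  ContinuousLinearMap.topologicalSpace
instance (x : M) : AddCommGroup (Cotangent n x →L[ℝ] ℝ) := ContinuousLinearMap.addCommGroup
instance (x : M) : Module ℝ (Cotangent n x →L[ℝ] ℝ) := ContinuousLinearMap.module
instance (x : M) : IsTopologicalAddGroup (Cotangent n x →L[ℝ] ℝ) :=
  ContinuousLinearMap.topologicalAddGroup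
instance (x : M) : ContinuousSMul ℝ (Cotangent n x →L[ℝ] ℝ) := ContinuousLinearMap.continuousSMul
instance (x : M) : TopologicalSpace (CoTensorAt n x) := ContinuousLinearMap.topologicalSpace
instance (x : M) : AddCommGroup (CoTensorAt n x) := ContinuousLinearMap.addCommGroup
instance (x : M) : Module ℝ (CoTensorAt n x) := ContinuousLinearMap.module
instance : TopologicalSpace (CoTensor n M) := Pi.topologicalSpace
instance : AddCommGroup (CoTensor n M) := Pi.addCommGroup
instance : Module ℝ (CoTensor n M) := Pi.module _ _ _

end Shortcuts

/-- Connections on (the tangent bundle of) `M`. -/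
abbrev Connection (n : ℕ) (M : Type*) [TopologicalSpace M]
    [ChartedSpace (EuclideanSpace ℝ (Fin n)) M] [IsManifold (𝓡 n) ∞ M] : Type _ :=
  CovariantDerivative (𝓡 n) (EuclideanSpace ℝ (Fin n)) (TangentSpace (𝓡 n) : M → Type)

/-- Smooth Riemannian metrics on `M`. -/
abbrev Metric (n : ℕ) (M : Type*) [TopologicalSpace M]
    [ChartedSpace (EuclideanSpace ℝ (Fin n)) M] [IsManifold (𝓡 n) ∞ M] : Type _ :=
  ContMDiffRiemannianMetric (𝓡 n) ∞ (EuclideanSpace ℝ (Fin n)) (TangentSpace (𝓡 n) : M → Type)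

section

variable {n : ℕ} {M : Type*} [TopologicalSpace M] [ChartedSpace (EuclideanSpace ℝ (Fin n)) M]
  [IsManifold (𝓡 n) ∞ M]

/-- The vector field `X` is differentiable at `x`. -/
abbrev DiffAt (X : ∀ y : M, TangentSpace (𝓡 n) y) (x : M) : Prop :=
  MDifferentiableAt (𝓡 n) ((𝓡 n).prod 𝓘(ℝ, EuclideanSpace ℝ (Fin n)))
    (fun y ↦ TotalSpace.mk' (EuclideanSpace ℝ (Fin n)) y (X y)) x

/-- The vector field `X` is smooth on the set `s`. -/
abbrev SmoothOn (X : ∀ y : M, TangentSpace (𝓡 n) y) (s : Set M) : Prop :=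
  ContMDiffOn (𝓡 n) ((𝓡 n).prod 𝓘(ℝ, EuclideanSpace ℝ (Fin n))) ∞
    (fun y ↦ TotalSpace.mk' (EuclideanSpace ℝ (Fin n)) y (X y)) s

/-- The metric `g` is parallel for `∇`: `v (g (σ, τ)) = g (∇_v σ, τ) + g (σ, ∇_v τ)`. -/
def IsParallel (cov : Connection n M) (g : Metric n M) : Prop :=
  ∀ (x : M) (σ τ : ∀ y : M, TangentSpace (𝓡 n) y), DiffAt σ x → DiffAt τ x →
    ∀ v : TangentSpace (𝓡 n) x,
      mvfderiv (𝓡 n) (fun y ↦ g.inner y (σ y) (τ y)) x v =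
        g.inner x (cov σ x v) (τ x) + g.inner x (σ x) (cov τ x v)

/-- `(∇_X ∇_Y Z - ∇_Y ∇_X Z - ∇_{[X,Y]} Z) (x)`. -/
def curvatureField (cov : Connection n M) (X Y Z : ∀ y : M, TangentSpace (𝓡 n) y) (x : M) :
    TangentSpace (𝓡 n) x :=
  cov (fun y ↦ cov Z y (Y y)) x (X x) - cov (fun y ↦ cov Z y (X y)) x (Y x)
    - cov Z x (VectorField.mlieBracket (𝓡 n) X Y x)

/-! ### The curvature operator `R(u, v)` -/

/-- An extension of a tangent vector to a vector field that is smooth near the base point: it is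
constant in a local trivialization of the tangent bundle. -/
def ext {x : M} (v : TangentSpace (𝓡 n) x) : ∀ y : M, TangentSpace (𝓡 n) y := fun y ↦
  letI t := trivializationAt (EuclideanSpace ℝ (Fin n)) (TangentSpace (𝓡 n) : M → Type) x
  t.symmL ℝ y (t.continuousLinearMapAt ℝ x v)

lemma ext_add {x : M} (v w : TangentSpace (𝓡 n) x) : ext (v + w) = ext v + ext w := by
  funext y
  simp only [ext, Pi.add_apply, map_add]

lemma ext_smul {x : M} (c : ℝ) (v : TangentSpace (𝓡 n) x) : ext (c • v) = c • ext v := by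
  funext y
  simp only [ext, Pi.smul_apply, map_smul]

lemma ext_self {x : M} (v : TangentSpace (𝓡 n) x) : ext v x = v :=
  Trivialization.symmL_continuousLinearMapAt _ (FiberBundle.mem_baseSet_trivializationAt' x) v

lemma smoothOn_ext {x : M} (v : TangentSpace (𝓡 n) x) :
    ∃ s : Set M, IsOpen s ∧ x ∈ s ∧ SmoothOn (ext v) s := by
  set t := trivializationAt (EuclideanSpace ℝ (Fin n)) (TangentSpace (𝓡 n) : M → Type) x with ht
  have hx : x ∈ t.baseSet := FiberBundle.mem_baseSet_trivializationAt' x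
  refine ⟨t.baseSet, t.open_baseSet, hx, fun y hy ↦ ?_⟩
  rw [t.contMDiffWithinAt_section _ hy]
  refine (contMDiffWithinAt_const (c := t.continuousLinearMapAt ℝ x v)).congr_of_mem
    (fun z hz ↦ ?_) hy
  have := t.continuousLinearMapAt_symmL (R := ℝ) hz (t.continuousLinearMapAt ℝ x v)
  rw [t.continuousLinearMapAt_apply_of_mem ℝ hz] at this
  exact this

lemma mdiffAt_cov [T2Space M] (cov : Connection n M)
    [CovariantDerivative.ContMDiffCovariantDerivative cov ∞] {s : Set M} {x : M}
    {Z Y : ∀ y : M, TangentSpace (𝓡 n) y} (hs : IsOpen s) (hx : x ∈ s)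
    (hZ : SmoothOn Z s) (hY : DiffAt Y x) :
    DiffAt (fun y ↦ cov Z y (Y y)) x := by
  obtain ⟨f, hf, -⟩ := (SmoothBumpFunction.nhds_basis_support (I := 𝓡 n)
    (hs.mem_nhds hx)).mem_iff.1 (hs.mem_nhds hx)
  have hZ' : ContMDiff (𝓡 n) ((𝓡 n).prod 𝓘(ℝ, EuclideanSpace ℝ (Fin n))) ∞
      (fun y ↦ TotalSpace.mk' (EuclideanSpace ℝ (Fin n)) y (((f : M → ℝ) • Z) y)) :=
    ContMDiffOn.smul_section_of_tsupport f.contMDiff.contMDiffOn hs hf hZ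
  have h1 := (CovariantDerivative.ContMDiffCovariantDerivative.contMDiff (cov := cov)
    (k := ∞)).contMDiff (σ := (f : M → ℝ) • Z) (by simpa using hZ'.contMDiffOn)
  have h2 := ((h1.contMDiffAt Filter.univ_mem).mdifferentiableAt (by simp)).clm_bundle_apply hY
  refine h2.congr_of_eventuallyEq ?_
  filter_upwards [f.eventuallyEq_one.eventually_nhds, hs.mem_nhds hx] with y hy hys
  have h3 : cov Z y = cov ((f : M → ℝ) • Z) y := by
    refine cov.isCovariantDerivativeOnUniv.congr_of_eventuallyEq
      ((hZ.contMDiffAt (hs.mem_nhds hys)).mdifferentiableAt (by simp))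
      ((hZ' y).mdifferentiableAt (by simp)) Filter.univ_mem ?_
    filter_upwards [hy] with z hz
    simp [hz]
  simp only [h3]

lemma ext_nhds {x : M} (v w : TangentSpace (𝓡 n) x) :
    ∃ s : Set M, IsOpen s ∧ x ∈ s ∧ SmoothOn (ext v) s ∧ SmoothOn (ext w) s := by
  obtain ⟨s, hs, hxs, h⟩ := smoothOn_ext v
  obtain ⟨t, ht, hxt, h'⟩ := smoothOn_ext w
  exact ⟨s ∩ t, hs.inter ht, ⟨hxs, hxt⟩, h.mono Set.inter_subset_left,
    h'.mono Set.inter_subset_right⟩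

lemma SmoothOn.diffAt {s : Set M} {x : M} {Z : ∀ y : M, TangentSpace (𝓡 n) y} (hs : IsOpen s)
    (hx : x ∈ s) (hZ : SmoothOn Z s) : DiffAt Z x :=
  (hZ.contMDiffAt (hs.mem_nhds hx)).mdifferentiableAt (by simp)

lemma cov_cov_add [T2Space M] (cov : Connection n M)
    [CovariantDerivative.ContMDiffCovariantDerivative cov ∞] {s : Set M} {x : M}
    {Z W Y : ∀ y : M, TangentSpace (𝓡 n) y} (hs : IsOpen s) (hx : x ∈ s)
    (hZ : SmoothOn Z s) (hW : SmoothOn W s) (hY : DiffAt Y x) :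
    cov (fun y ↦ cov (Z + W) y (Y y)) x =
      cov (fun y ↦ cov Z y (Y y)) x + cov (fun y ↦ cov W y (Y y)) x := by
  have h1 := mdiffAt_cov cov hs hx hZ hY
  have h2 := mdiffAt_cov cov hs hx hW hY
  rw [← cov.isCovariantDerivativeOnUniv.add h1 h2]
  have key : ∀ᶠ y in nhds x, cov (Z + W) y (Y y) =
      ((fun y ↦ cov Z y (Y y)) + fun y ↦ cov W y (Y y)) y := by
    filter_upwards [hs.mem_nhds hx] with y hy
    rw [cov.isCovariantDerivativeOnUniv.add (hZ.diffAt hs hy) (hW.diffAt hs hy)]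
    rfl
  have h3 : DiffAt ((fun y ↦ cov Z y (Y y)) + fun y ↦ cov W y (Y y)) x :=
    mdifferentiableAt_add_section h1 h2
  refine cov.isCovariantDerivativeOnUniv.congr_of_eventuallyEq
    (h3.congr_of_eventuallyEq ?_) h3 Filter.univ_mem key
  filter_upwards [key] with y hy
  rw [hy]

lemma cov_cov_smul [T2Space M] (cov : Connection n M)
    [CovariantDerivative.ContMDiffCovariantDerivative cov ∞] {s : Set M} {x : M}
    {Z Y : ∀ y : M, TangentSpace (𝓡 n) y} (c : ℝ) (hs : IsOpen s) (hx : x ∈ s)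
    (hZ : SmoothOn Z s) (hY : DiffAt Y x) :
    cov (fun y ↦ cov (c • Z) y (Y y)) x = c • cov (fun y ↦ cov Z y (Y y)) x := by
  have h1 := mdiffAt_cov cov hs hx hZ hY
  rw [← cov.isCovariantDerivativeOnUniv.smul_const c h1]
  have key : ∀ᶠ y in nhds x, cov (c • Z) y (Y y) = (c • fun y ↦ cov Z y (Y y)) y := by
    filter_upwards [hs.mem_nhds hx] with y hy
    rw [cov.isCovariantDerivativeOnUniv.smul_const c (hZ.diffAt hs hy)]
    rfl
  have h3 : DiffAt (c • fun y ↦ cov Z y (Y y)) x :=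
    mdifferentiableAt_const.smul_section h1
  refine cov.isCovariantDerivativeOnUniv.congr_of_eventuallyEq
    (h3.congr_of_eventuallyEq ?_) h3 Filter.univ_mem key
  filter_upwards [key] with y hy
  rw [hy]

/-- The linear transformation `R(u, v) : T_x M → T_x M`, where `R` is the Riemann curvature tensor
of `∇`. It is evaluated on local smooth extensions of the tangent vectors. -/
def curvature [T2Space M] (cov : Connection n M)
    [CovariantDerivative.ContMDiffCovariantDerivative cov ∞] {x : M}
    (u v : TangentSpace (𝓡 n) x) : TangentSpace (𝓡 n) x →ₗ[ℝ] TangentSpace (𝓡 n) x where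
  toFun w := curvatureField cov (ext u) (ext v) (ext w) x
  map_add' w w' := by
    obtain ⟨s, hs, hx, h, h'⟩ := ext_nhds w w'
    obtain ⟨t, ht, hxt, hu, hv⟩ := ext_nhds u v
    simp only [curvatureField, ext_add]
    rw [cov_cov_add cov hs hx h h' (hu.diffAt ht hxt), cov_cov_add cov hs hx h h' (hv.diffAt ht hxt),
      cov.isCovariantDerivativeOnUniv.add (h.diffAt hs hx) (h'.diffAt hs hx)]
    simp only [add_apply]
    abel
  map_smul' c w := by
    obtain ⟨s, hs, hx, h⟩ := smoothOn_ext w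
    obtain ⟨t, ht, hxt, hu, hv⟩ := ext_nhds u v
    simp only [curvatureField, ext_smul, RingHom.id_apply]
    rw [cov_cov_smul cov c hs hx h (hu.diffAt ht hxt), cov_cov_smul cov c hs hx h (hv.diffAt ht hxt),
      cov.isCovariantDerivativeOnUniv.smul_const c (h.diffAt hs hx)]
    simp only [smul_apply, smul_sub]

/-- `R(u, v)`, extended complex linearly to the complexified tangent space. -/
abbrev curvatureC [T2Space M] (cov : Connection n M)
    [CovariantDerivative.ContMDiffCovariantDerivative cov ∞] {x : M}
    (u v : TangentSpace (𝓡 n) x) : Module.End ℂ (ℂ ⊗[ℝ] TangentSpace (𝓡 n) x) :=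
  (curvature cov u v).baseChange ℂ

/-- `R(u, v)` has `n` distinct complex eigenvalues. -/
def HasDistinctEigenvalues [T2Space M] (cov : Connection n M)
    [CovariantDerivative.ContMDiffCovariantDerivative cov ∞] {x : M}
    (u v : TangentSpace (𝓡 n) x) : Prop :=
  {μ : ℂ | (curvatureC cov u v).HasEigenvalue μ}.ncard = n

/-- `∇` is generic: at every point some `R(u, v)` has `n` distinct complex eigenvalues. -/
def IsGeneric [T2Space M] (cov : Connection n M)
    [CovariantDerivative.ContMDiffCovariantDerivative cov ∞] : Prop :=
  ∀ x : M, ∃ u v : TangentSpace (𝓡 n) x, HasDistinctEigenvalues cov u v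

/-! ### Metrics as contravariant tensor fields -/

instance (x : M) : FiniteDimensional ℝ (TangentSpace (𝓡 n) x) :=
  inferInstanceAs (FiniteDimensional ℝ (EuclideanSpace ℝ (Fin n)))

instance (x : M) : FiniteDimensional ℝ (Cotangent n x) :=
  inferInstanceAs (FiniteDimensional ℝ (EuclideanSpace ℝ (Fin n) →L[ℝ] ℝ))

lemma flat_injective (g : Metric n M) (x : M) : Function.Injective (g.inner x) := by
  refine (injective_iff_map_eq_zero _).2 fun v hv ↦ ?_
  by_contra h
  simpa [hv] using g.pos x v h

/-- The isomorphism `T_x M → T_x^* M`, `v ↦ g (v, ·)`, given by the metric. -/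
def flat (g : Metric n M) (x : M) : TangentSpace (𝓡 n) x ≃ₗ[ℝ] Cotangent n x :=
  LinearEquiv.ofInjectiveOfFinrankEq (g.inner x : TangentSpace (𝓡 n) x →ₗ[ℝ] Cotangent n x)
    (flat_injective g x)
    ((Subspace.dual_finrank_eq (K := ℝ) (V := EuclideanSpace ℝ (Fin n))).symm.trans
      (LinearMap.toContinuousLinearMap
        (𝕜 := ℝ) (E := EuclideanSpace ℝ (Fin n)) (F' := ℝ)).finrank_eq)

/-- The metric as a contravariant tensor field `∑ g^{ij} X_i ⊗ X_j`, where `(g^{ij})` is the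
inverse of the matrix `(g (X_i, X_j))`. -/
def contravariant (g : Metric n M) : CoTensor n M := fun x ↦
  LinearMap.toContinuousBilinearMap
    (LinearMap.mk₂ ℝ (fun α β : Cotangent n x ↦ α ((flat g x).symm β))
      (by intros; simp) (by intros; simp) (by intros; simp) (by intros; simp))

/-- The set of metrics on `M` parallel for `∇`, metrics being written contravariantly. -/
def parallelMetrics (cov : Connection n M) : Set (CoTensor n M) :=
  {t | ∃ g : Metric n M, IsParallel cov g ∧ contravariant g = t}

/-! ### The local decompositions -/

variable [T2Space M]

/-- The choices made on a member `U` of the cover: vector fields `ξ₁, ξ₂` on `U` for which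
`R(ξ₁, ξ₂)` has `n` distinct eigenvalues at each point of `U`, and an `h`-orthonormal frame
`Y_0, …, Y_{n-1}` on `U` such that `Y_0 ± i Y_1, Y_2 ± i Y_3, …` are complex eigenvector fields of
`R(ξ₁, ξ₂)` and, if `n` is odd, the last `Y` is an eigenvector field for the eigenvalue zero. -/
structure AdaptedFrame (cov : Connection n M)
    [CovariantDerivative.ContMDiffCovariantDerivative cov ∞] (h : Metric n M) (U : Opens M) where
  ξ₁ : ∀ x : M, TangentSpace (𝓡 n) x
  ξ₂ : ∀ x : M, TangentSpace (𝓡 n) x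
  smooth_ξ₁ : SmoothOn ξ₁ (U : Set M)
  smooth_ξ₂ : SmoothOn ξ₂ (U : Set M)
  distinct : ∀ x ∈ U, HasDistinctEigenvalues cov (ξ₁ x) (ξ₂ x)
  Y : Fin n → ∀ x : M, TangentSpace (𝓡 n) x
  smooth_Y : ∀ i, SmoothOn (Y i) (U : Set M)
  orthonormal : ∀ x ∈ U, ∀ i j, h.inner x (Y i x) (Y j x) = if i = j then 1 else 0
  eigen_pair : ∀ i j : Fin n, Even (i : ℕ) → (j : ℕ) = i + 1 → ∀ x ∈ U,
    (∃ μ : ℂ, (curvatureC cov (ξ₁ x) (ξ₂ x)).HasEigenvector μ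
      (1 ⊗ₜ[ℝ] Y i x + Complex.I ⊗ₜ[ℝ] Y j x)) ∧
    (∃ μ : ℂ, (curvatureC cov (ξ₁ x) (ξ₂ x)).HasEigenvector μ
      (1 ⊗ₜ[ℝ] Y i x - Complex.I ⊗ₜ[ℝ] Y j x))
  eigen_last : ∀ i : Fin n, Even (i : ℕ) → (i : ℕ) + 1 = n → ∀ x ∈ U,
    Module.End.HasEigenvector (curvature cov (ξ₁ x) (ξ₂ x)) 0 (Y i x)

variable {cov : Connection n M} [CovariantDerivative.ContMDiffCovariantDerivative cov ∞]
  {h : Metric n M}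

namespace AdaptedFrame

variable {U : Opens M} (F : AdaptedFrame cov h U)

/-- The connection form: `∇_v Y_j = ∑ i, ω^i_j (v) Y_i`, so `ω^i_j (v) = h (∇_v Y_j, Y_i)`. -/
def connectionForm (i j : Fin n) (x : M) (v : TangentSpace (𝓡 n) x) : ℝ :=
  h.inner x (cov (F.Y j) x v) (F.Y i x)

/-- The equivalence relation `r(U)` on indices, generated by `ω^i_j (u) ≠ 0` for some `u ∈ U`. -/
def indexSetoid : Setoid (Fin n) :=
  Relation.EqvGen.setoid fun i j ↦ ∃ x ∈ U, ∃ v, F.connectionForm i j x v ≠ 0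

/-- The classes `P_1(U), …, P_{β(U)}(U)` of `r(U)`. -/
abbrev IndexClass : Type := Quotient F.indexSetoid

/-- The fibre at `x ∈ U` of the subbundle spanned by the `Y_j` with `j` in the class `p`. -/
def localBundle (p : F.IndexClass) (x : M) : Submodule ℝ (TangentSpace (𝓡 n) x) :=
  Submodule.span ℝ {y | ∃ j : Fin n, (Quotient.mk _ j : F.IndexClass) = p ∧ F.Y j x = y}

end AdaptedFrame

/-! ### The global decomposition -/

variable (cov h) in
/-- A cover `𝒰` of `M` by connected open sets, with an adapted frame on each of them. -/
structure AdaptedCover where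
  cover : Set (Opens M)
  connected : ∀ U ∈ cover, IsConnected (U : Set M)
  covers : ∀ x : M, ∃ U ∈ cover, x ∈ U
  frame : ∀ U : cover, AdaptedFrame cov h (U : Opens M)

namespace AdaptedCover

variable (D : AdaptedCover cov h)

/-- The set of pairs `(i, U)` with `U ∈ 𝒰` and `i` a class of `r(U)`. -/
abbrev LocalIndex : Type _ := Σ U : D.cover, (D.frame U).IndexClass

/-- The equivalence relation on pairs generated by `(i, U) ∼ (j, V)` if the distributions
belonging to `(i, U)` and `(j, V)` do not intersect in zero over `U ∩ V`. -/
def blockSetoid : Setoid D.LocalIndex :=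
  Relation.EqvGen.setoid fun a b ↦ ∃ x : M, x ∈ (a.1 : Opens M) ∧ x ∈ (b.1 : Opens M) ∧
    (D.frame a.1).localBundle a.2 x ⊓ (D.frame b.1).localBundle b.2 x ≠ ⊥

/-- The blocks `I_1, …, I_A`. -/
abbrev Block : Type _ := Quotient D.blockSetoid

/-- The number `A` of blocks. -/
def numBlocks : ℕ := Nat.card D.Block

/-- The fibre at `x ∈ U` of the direct sum of the local distributions on `U` in the block `a`. -/
def bundleOn (a : D.Block) (U : D.cover) (x : M) : Submodule ℝ (TangentSpace (𝓡 n) x) :=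
  ⨆ (p : (D.frame U).IndexClass) (_ : (Quotient.mk _ ⟨U, p⟩ : D.Block) = a),
    (D.frame U).localBundle p x

/-- The fibre `Q_a(x)`, where `Q_a` is the distribution on `M` that restricts to `bundleOn a U` on
each `U ∈ 𝒰`. -/
def bundle (a : D.Block) (x : M) : Submodule ℝ (TangentSpace (𝓡 n) x) :=
  ⨆ (U : D.cover) (_ : x ∈ (U : Opens M)), D.bundleOn a U x

/-- The fibre at `x` of the dual subbundle `Q_a^*`: the covectors vanishing on all other `Q_b`. -/
def dualBundle (a : D.Block) (x : M) : Set (Cotangent n x) :=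
  {α | ∀ b, b ≠ a → ∀ v ∈ D.bundle b x, α v = 0}

open Classical in
/-- `t` is the tensor field `h_a`: on `Q_b^* × Q_c^*` it is `h` if `b = c = a`, and zero
otherwise. -/
def IsBlockTensor (a : D.Block) (t : CoTensor n M) : Prop :=
  ∀ (x : M) (b c : D.Block), ∀ α ∈ D.dualBundle b x, ∀ β ∈ D.dualBundle c x,
    t x α β = if a = b ∧ a = c then contravariant h x α β else 0

end AdaptedCover

end

/-- The open positive orthant of `ℝ^A`. -/
def orthant (A : ℕ) : Opens (EuclideanSpace ℝ (Fin A)) where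
  carrier := {c | ∀ a, 0 < c a}
  is_open' := by
    simp only [Set.ofPred_forall]
    exact isOpen_iInter_of_finite fun a ↦ isOpen_lt continuous_const (by fun_prop)

end ParallelMetrics

end

noncomputable section

namespace ParallelMetrics

open VectorField

/-! The curvature operators `R(u, v)` depend only on the connection, and they are skew for every
parallel metric `g`, because second derivatives of `g(Z, W)` antisymmetrize to zero. A generic
operator `A = R(ξ₁, ξ₂)` satisfies `A² Y_i = -b_i² Y_i` in an adapted frame, with the real numbers
`b_i` distinct and opposite at partners. Since `A²` is self-adjoint for `g` and `A` is skew, `g`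
must be diagonal in the `h`-orthonormal frame `Y` (`IsNormalForm.form_eq_zero`).

Write `g_jj = g(Y_j, Y_j)`. As the connection form is antisymmetric, `g_jj` is constant on the
connected set `U`, and differentiating `g(Y_i, Y_j) = 0` gives `ω^i_j (g_ii - g_jj) = 0`. So `g` is
a constant multiple of `h` on each local bundle. A nonzero vector common to two local bundles forces
the two multiples to agree, so `g` is governed by one positive number per block
(`exists_inner_self_eq`). Conversely, block coefficients take equal values at `i` and `j` whenever
`ω^i_j ≠ 0`, and then the frame terms in the derivative of the block form cancel in pairs
(`sum_antisymm_eq_zero`). The coefficients of the contravariant tensor are the inverses of those of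
the metric.

The global splitting rests on `exists_mem_localBundle`. Curvature operators preserve the local
bundles on `U`, so `h` composed with the projection to one of them is a symmetric form for which the
operator of another frame `Y'` is skew. This form is diagonal in `Y'`, hence the projection maps
each `Y'_i` to a multiple of itself, and each `Y'_i` lies in a single local bundle. Overlapping
members of the cover therefore carry the same blocks. By connectedness every member carries all of
them, so there are at most `n`.

Adapted frames exist because a simple eigenvalue has a smoothly varying eigenvector, by the inverse
function theorem (`exists_eigenvector_family`). Choosing one complex eigenvector field for each
conjugate pair and a real null field for an unpaired index, then normalizing, gives the frame. -/

lemma minSmoothness_le_infty (k : ℕ) : minSmoothness ℝ k ≤ (∞ : ℕ∞ω) := by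
  rw [minSmoothness_of_isRCLikeNormedField]
  exact mod_cast le_top

local instance {n : ℕ} {M : Type*} [TopologicalSpace M]
    [ChartedSpace (EuclideanSpace ℝ (Fin n)) M] [IsManifold (𝓡 n) ∞ M] :
    IsManifold (𝓡 n) (∞ + 1) M := inferInstanceAs (IsManifold (𝓡 n) ∞ M)

local instance {n : ℕ} {M : Type*} [TopologicalSpace M]
    [ChartedSpace (EuclideanSpace ℝ (Fin n)) M] [IsManifold (𝓡 n) ∞ M] :
    IsManifold (𝓡 n) (minSmoothness ℝ 2) M := .of_le (minSmoothness_le_infty 2)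

local instance {n : ℕ} {M : Type*} [TopologicalSpace M]
    [ChartedSpace (EuclideanSpace ℝ (Fin n)) M] [IsManifold (𝓡 n) ∞ M] :
    IsManifold (𝓡 n) (minSmoothness ℝ 3) M := .of_le (minSmoothness_le_infty 3)

local instance {n : ℕ} {M : Type*} [TopologicalSpace M]
    [ChartedSpace (EuclideanSpace ℝ (Fin n)) M] (x : M) : T2Space (TangentSpace (𝓡 n) x) :=
  inferInstanceAs (T2Space (EuclideanSpace ℝ (Fin n)))

/-! ### Lie brackets as commutators, and curvature identities. -/

section Geometry

variable {n : ℕ} {M : Type*} [TopologicalSpace M] [ChartedSpace (EuclideanSpace ℝ (Fin n)) M]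
  [IsManifold (𝓡 n) ∞ M]

lemma SmoothOn.mlieBracket {X Y : ∀ y : M, TangentSpace (𝓡 n) y} {s : Set M} (hs : IsOpen s)
    (hX : SmoothOn X s) (hY : SmoothOn Y s) : SmoothOn (mlieBracket (𝓡 n) X Y) s := fun x hx ↦
  (ContMDiffAt.mlieBracket_vectorField (m := ⊤) (n := ⊤) (hX.contMDiffAt (hs.mem_nhds hx))
    (hY.contMDiffAt (hs.mem_nhds hx)) (by simp)).contMDiffWithinAt

/-- The derivative of a function along a vector field. -/
abbrev fieldDeriv (X : ∀ y : M, TangentSpace (𝓡 n) y) (f : M → ℝ) : M → ℝ :=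
  fun y ↦ mvfderiv (𝓡 n) f y (X y)

lemma mlieBracket_mlieBracket_smul {X Y W : ∀ y : M, TangentSpace (𝓡 n) y} {f : M → ℝ} {s : Set M}
    {x : M} (hs : IsOpen s) (hx : x ∈ s) (hY : SmoothOn Y s)
    (hW : SmoothOn W s) (hf : ContMDiffOn (𝓡 n) 𝓘(ℝ) ∞ f s)
    (hYf : MDifferentiableAt (𝓡 n) 𝓘(ℝ) (fieldDeriv Y f) x) :
    mlieBracket (𝓡 n) X (mlieBracket (𝓡 n) Y (f • W)) x =
      fieldDeriv X (fieldDeriv Y f) x • W x + fieldDeriv Y f x • mlieBracket (𝓡 n) X W x +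
      (fieldDeriv X f x • mlieBracket (𝓡 n) Y W x +
        f x • mlieBracket (𝓡 n) X (mlieBracket (𝓡 n) Y W) x) := by
  have hfd : ∀ y ∈ s, MDifferentiableAt (𝓡 n) 𝓘(ℝ) f y := fun y hy ↦
    (hf.contMDiffAt (hs.mem_nhds hy)).mdifferentiableAt (by simp)
  have key : mlieBracket (𝓡 n) Y (f • W) =ᶠ[nhds x]
      (fieldDeriv Y f • W + f • mlieBracket (𝓡 n) Y W) := by
    filter_upwards [hs.mem_nhds hx] with y hy
    exact mlieBracket_smul_right (hfd y hy) (hW.diffAt hs hy)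
  have hYW := SmoothOn.mlieBracket hs hY hW
  rw [(Filter.EventuallyEq.refl _ X).mlieBracket_vectorField_eq key,
    mlieBracket_add_right (hYf.smul_section (hW.diffAt hs hx))
      ((hfd x hx).smul_section (hYW.diffAt hs hx)),
    mlieBracket_smul_right hYf (hW.diffAt hs hx),
    mlieBracket_smul_right (hfd x hx) (hYW.diffAt hs hx)]

/-- Vector fields act on functions as derivations whose commutator is the Lie bracket. -/
lemma fieldDeriv_commutator {X Y : ∀ y : M, TangentSpace (𝓡 n) y} {f : M → ℝ} {s : Set M}
    {x : M} (hs : IsOpen s) (hx : x ∈ s) (hX : SmoothOn X s) (hY : SmoothOn Y s)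
    (hf : ContMDiffOn (𝓡 n) 𝓘(ℝ) ∞ f s)
    (hXf : MDifferentiableAt (𝓡 n) 𝓘(ℝ) (fieldDeriv X f) x)
    (hYf : MDifferentiableAt (𝓡 n) 𝓘(ℝ) (fieldDeriv Y f) x) :
    fieldDeriv X (fieldDeriv Y f) x - fieldDeriv Y (fieldDeriv X f) x =
      fieldDeriv (mlieBracket (𝓡 n) X Y) f x := by
  -- The identity is read off from the Jacobi identity for `X`, `Y` and `f • W`: after subtracting
  -- `f` times the one for `X`, `Y`, `W`, what remains is the desired difference times `W x`. This
  -- needs `W x ≠ 0`; if the tangent space is zero, both sides vanish.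
  by_cases hw : ∃ w : TangentSpace (𝓡 n) x, w ≠ 0
  · obtain ⟨w, hw⟩ := hw
    obtain ⟨t, ht, hxt, hW⟩ := smoothOn_ext w
    have hst := hs.inter ht
    have hxst : x ∈ s ∩ t := ⟨hx, hxt⟩
    replace hX := hX.mono (Set.inter_subset_left (t := t))
    replace hY := hY.mono (Set.inter_subset_left (t := t))
    replace hf := hf.mono (Set.inter_subset_left (t := t))
    replace hW := hW.mono (Set.inter_subset_right (s := s))
    have hfW : SmoothOn (f • ext w) (s ∩ t) := hf.smul_section hW
    have sm : ∀ {Z : ∀ y : M, TangentSpace (𝓡 n) y}, SmoothOn Z (s ∩ t) →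
        ContMDiffAt (𝓡 n) ((𝓡 n).prod 𝓘(ℝ, EuclideanSpace ℝ (Fin n))) (minSmoothness ℝ 2)
          (fun y ↦ TotalSpace.mk' (EuclideanSpace ℝ (Fin n)) y (Z y)) x := fun hZ ↦
      (hZ.contMDiffAt (hst.mem_nhds hxst)).of_le (minSmoothness_le_infty 2)
    have h1 := leibniz_identity_mlieBracket_apply (sm hX) (sm hY) (sm hfW)
    have h2 := leibniz_identity_mlieBracket_apply (sm hX) (sm hY) (sm hW)
    rw [mlieBracket_mlieBracket_smul hst hxst hY hW hf hYf,
      mlieBracket_mlieBracket_smul hst hxst hX hW hf hXf,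
      mlieBracket_smul_right ((hf.contMDiffAt (hst.mem_nhds hxst)).mdifferentiableAt (by simp))
        (SmoothOn.diffAt hst hxst hW), h2] at h1
    have h3 : (fieldDeriv X (fieldDeriv Y f) x - fieldDeriv Y (fieldDeriv X f) x -
      fieldDeriv (mlieBracket (𝓡 n) X Y) f x) • w = 0 := by
      rw [ext_self] at h1
      rw [sub_smul, sub_smul, sub_eq_zero, sub_eq_iff_eq_add, ← sub_eq_zero]
      rw [← sub_eq_zero] at h1
      rw [← h1]
      module
    exact sub_eq_zero.1 ((smul_eq_zero.1 h3).resolve_right hw)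
  · push Not at hw
    simp [fieldDeriv, hw (X x), hw (Y x), hw (mlieBracket (𝓡 n) X Y x)]

/-! ### Smoothness of inner products and of covariant derivatives -/

lemma ContMDiffOn.inner (g : Metric n M) {X Y : ∀ y : M, TangentSpace (𝓡 n) y} {s : Set M}
    (hX : SmoothOn X s) (hY : SmoothOn Y s) :
    ContMDiffOn (𝓡 n) 𝓘(ℝ) ∞ (fun y ↦ g.inner y (X y) (Y y)) s := by
  intro x hx
  have : ContMDiffWithinAt (𝓡 n) ((𝓡 n).prod 𝓘(ℝ)) ∞
      (fun y ↦ TotalSpace.mk' ℝ (E := Bundle.Trivial M ℝ) y (g.inner y (X y) (Y y))) s x :=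
    ContMDiffWithinAt.clm_bundle_apply₂ (F₁ := EuclideanSpace ℝ (Fin n))
      (F₂ := EuclideanSpace ℝ (Fin n)) (g.contMDiff x).contMDiffWithinAt (hX x hx) (hY x hx)
  simp only [contMDiffWithinAt_totalSpace] at this
  exact this.2

lemma DiffAt.inner (g : Metric n M) {X Y : ∀ y : M, TangentSpace (𝓡 n) y} {x : M}
    (hX : DiffAt X x) (hY : DiffAt Y x) :
    MDifferentiableAt (𝓡 n) 𝓘(ℝ) (fun y ↦ g.inner y (X y) (Y y)) x := by
  have : MDifferentiableAt (𝓡 n) ((𝓡 n).prod 𝓘(ℝ))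
      (fun y ↦ TotalSpace.mk' ℝ (E := Bundle.Trivial M ℝ) y (g.inner y (X y) (Y y))) x :=
    MDifferentiableAt.clm_bundle_apply₂ (F₁ := EuclideanSpace ℝ (Fin n))
      (F₂ := EuclideanSpace ℝ (Fin n)) (g.contMDiff.mdifferentiableAt (by simp)) hX hY
  simp only [mdifferentiableAt_totalSpace] at this
  exact this.2

lemma diffAt_ext {x : M} (v : TangentSpace (𝓡 n) x) : DiffAt (ext v) x := by
  obtain ⟨s, hs, hx, h⟩ := smoothOn_ext v
  exact h.diffAt hs hx

lemma curvatureField_swap (cov : Connection n M) (X Y Z : ∀ y : M, TangentSpace (𝓡 n) y) (x : M) :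
    curvatureField cov Y X Z x = -curvatureField cov X Y Z x := by
  simp only [curvatureField, VectorField.mlieBracket_swap_apply (V := Y), map_neg]
  abel

variable [T2Space M] (cov : Connection n M)
  [CovariantDerivative.ContMDiffCovariantDerivative cov ∞]

/-- Smoothness of the connection is applied to globally smooth sections, so `Z` is first multiplied
by a bump function supported in `s`. The function is one near `x`, and the covariant derivative at
`y` sees only the germ at `y`. -/
lemma SmoothOn.covDeriv {s : Set M} {Z Y : ∀ y : M, TangentSpace (𝓡 n) y} (hs : IsOpen s)
    (hZ : SmoothOn Z s) (hY : SmoothOn Y s) : SmoothOn (fun y ↦ cov Z y (Y y)) s := by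
  intro x hx
  obtain ⟨f, hf, -⟩ := (SmoothBumpFunction.nhds_basis_support (I := 𝓡 n)
    (hs.mem_nhds hx)).mem_iff.1 (hs.mem_nhds hx)
  have hZ' : ContMDiff (𝓡 n) ((𝓡 n).prod 𝓘(ℝ, EuclideanSpace ℝ (Fin n))) ∞
      (fun y ↦ TotalSpace.mk' (EuclideanSpace ℝ (Fin n)) y (((f : M → ℝ) • Z) y)) :=
    ContMDiffOn.smul_section_of_tsupport f.contMDiff.contMDiffOn hs hf hZ
  have h1 := (CovariantDerivative.ContMDiffCovariantDerivative.contMDiff (cov := cov)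
    (k := ∞)).contMDiff (σ := (f : M → ℝ) • Z) (by simpa using hZ'.contMDiffOn)
  have h2 := (h1.contMDiffAt Filter.univ_mem).clm_bundle_apply (hY.contMDiffAt (hs.mem_nhds hx))
  refine (h2.congr_of_eventuallyEq ?_).contMDiffWithinAt
  filter_upwards [f.eventuallyEq_one.eventually_nhds, hs.mem_nhds hx] with y hy hys
  have h3 : cov Z y = cov ((f : M → ℝ) • Z) y := by
    refine cov.isCovariantDerivativeOnUniv.congr_of_eventuallyEq
      ((hZ.contMDiffAt (hs.mem_nhds hys)).mdifferentiableAt (by simp))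
      ((hZ' y).mdifferentiableAt (by simp)) Filter.univ_mem ?_
    filter_upwards [hy] with z hz
    simp [hz]
  simp only [h3]

lemma SmoothOn.curvField {s : Set M} {X Y Z : ∀ y : M, TangentSpace (𝓡 n) y} (hs : IsOpen s)
    (hX : SmoothOn X s) (hY : SmoothOn Y s) (hZ : SmoothOn Z s) :
    SmoothOn (curvatureField cov X Y Z) s :=
  ((((hZ.covDeriv cov hs hY).covDeriv cov hs hX).sub_section
    ((hZ.covDeriv cov hs hX).covDeriv cov hs hY)).sub_section (hZ.covDeriv cov hs (SmoothOn.mlieBracket hs hX hY)))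

/-! ### Curvature is a tensor, and skew for each parallel metric -/

variable {cov}

/-- Differentiating `g(Z, W)` along `Y` and then `X` and antisymmetrizing cancels the mixed terms
`g(∇Z, ∇W)`. The left side becomes the derivative along `[X, Y]`, which supplies the bracket terms
of the curvature. -/
lemma IsParallel.curvatureField_skew {g : Metric n M} (hg : IsParallel cov g) {s : Set M} {x : M}
    {X Y Z W : ∀ y : M, TangentSpace (𝓡 n) y} (hs : IsOpen s) (hx : x ∈ s)
    (hX : SmoothOn X s) (hY : SmoothOn Y s) (hZ : SmoothOn Z s) (hW : SmoothOn W s) :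
    g.inner x (curvatureField cov X Y Z x) (W x) =
      -g.inner x (Z x) (curvatureField cov X Y W x) := by
  have first : ∀ {V : ∀ y : M, TangentSpace (𝓡 n) y}, SmoothOn V s → ∀ y ∈ s,
      fieldDeriv V (fun y ↦ g.inner y (Z y) (W y)) y =
        g.inner y (cov Z y (V y)) (W y) + g.inner y (Z y) (cov W y (V y)) := fun _ y hy ↦
    hg y Z W (hZ.diffAt hs hy) (hW.diffAt hs hy) _
  have diff : ∀ {V : ∀ y : M, TangentSpace (𝓡 n) y}, SmoothOn V s →
      MDifferentiableAt (𝓡 n) 𝓘(ℝ) (fun y ↦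
        g.inner y (cov Z y (V y)) (W y) + g.inner y (Z y) (cov W y (V y))) x := fun hV ↦
    (((hZ.covDeriv cov hs hV).diffAt hs hx).inner g (hW.diffAt hs hx)).add
      ((hZ.diffAt hs hx).inner g ((hW.covDeriv cov hs hV).diffAt hs hx))
  have evEq : ∀ {V : ∀ y : M, TangentSpace (𝓡 n) y}, SmoothOn V s →
      fieldDeriv V (fun y ↦ g.inner y (Z y) (W y)) =ᶠ[nhds x] fun y ↦
        g.inner y (cov Z y (V y)) (W y) + g.inner y (Z y) (cov W y (V y)) := fun hV ↦ by
    filter_upwards [hs.mem_nhds hx] with y hy using first hV y hy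
  have second : ∀ {U V : ∀ y : M, TangentSpace (𝓡 n) y}, SmoothOn V s →
      fieldDeriv U (fieldDeriv V (fun y ↦ g.inner y (Z y) (W y))) x =
        g.inner x (cov (fun y ↦ cov Z y (V y)) x (U x)) (W x) +
          g.inner x (cov Z x (V x)) (cov W x (U x)) +
        (g.inner x (cov Z x (U x)) (cov W x (V x)) +
          g.inner x (Z x) (cov (fun y ↦ cov W y (V y)) x (U x))) := by
    intro U V hV
    have hZV := (hZ.covDeriv cov hs hV).diffAt hs hx
    have hWV := (hW.covDeriv cov hs hV).diffAt hs hx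
    rw [← hg x _ _ hZV (hW.diffAt hs hx), ← hg x _ _ (hZ.diffAt hs hx) hWV]
    simp only [fieldDeriv, mvfderiv]
    rw [(evEq hV).mfderiv_eq]
    have := mvfderiv_fun_add (hZV.inner g (hW.diffAt hs hx)) ((hZ.diffAt hs hx).inner g hWV)
    exact congr($this (U x))
  have comm := fieldDeriv_commutator hs hx hX hY (ContMDiffOn.inner g hZ hW)
    ((diff hX).congr_of_eventuallyEq (evEq hX)) ((diff hY).congr_of_eventuallyEq (evEq hY))
  rw [second hY, second hX, first (SmoothOn.mlieBracket hs hX hY) x hx] at comm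
  simp only [curvatureField, map_sub, sub_apply]
  linarith

lemma tensorialAt_curvatureField {s : Set M} {x : M} {Y Z : ∀ y : M, TangentSpace (𝓡 n) y}
    (hs : IsOpen s) (hx : x ∈ s) (hZ : SmoothOn Z s) :
    TensorialAt (𝓡 n) (EuclideanSpace ℝ (Fin n)) (fun X ↦ curvatureField cov X Y Z x) x where
  smul {f X} hf hX := by
    have : (fun y ↦ cov Z y ((f • X) y)) = f • fun y ↦ cov Z y (X y) := by
      ext1 y; simp
    simp only [curvatureField, this]
    rw [cov.isCovariantDerivativeOnUniv.leibniz (mdiffAt_cov cov hs hx hZ hX) hf,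
      VectorField.mlieBracket_smul_left hf hX]
    simp
    module
  add {X X'} hX hX' := by
    have : (fun y ↦ cov Z y ((X + X') y)) = (fun y ↦ cov Z y (X y)) + fun y ↦ cov Z y (X' y) := by
      ext1 y; simp
    simp only [curvatureField, this]
    rw [cov.isCovariantDerivativeOnUniv.add (mdiffAt_cov cov hs hx hZ hX)
      (mdiffAt_cov cov hs hx hZ hX'), VectorField.mlieBracket_add_left hX hX']
    simp
    abel

/-- The second slot is tensorial because the first one is and the curvature is antisymmetric in the
two. -/
lemma curvatureField_congr {s : Set M} {x : M} {X X' Y Y' Z : ∀ y : M, TangentSpace (𝓡 n) y}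
    (hs : IsOpen s) (hx : x ∈ s) (hX : DiffAt X x) (hX' : DiffAt X' x) (hY : DiffAt Y x)
    (hY' : DiffAt Y' x) (hZ : SmoothOn Z s) (hXX' : X x = X' x) (hYY' : Y x = Y' x) :
    curvatureField cov X Y Z x = curvatureField cov X' Y' Z x := by
  rw [(tensorialAt_curvatureField hs hx hZ).pointwise hX hX' hXX', ← neg_inj,
    ← curvatureField_swap cov X' Y, ← curvatureField_swap cov X' Y']
  exact (tensorialAt_curvatureField hs hx hZ).pointwise hY hY' hYY'

lemma IsParallel.curvature_skew {g : Metric n M} (hg : IsParallel cov g) {x : M}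
    (u v w w' : TangentSpace (𝓡 n) x) :
    g.inner x (curvature cov u v w) w' = -g.inner x w (curvature cov u v w') := by
  obtain ⟨s, hs, hx, h, h'⟩ := ext_nhds w w'
  obtain ⟨t, ht, hxt, hu, hv⟩ := ext_nhds u v
  have := hg.curvatureField_skew (hs.inter ht) ⟨hx, hxt⟩ (hu.mono Set.inter_subset_right)
    (hv.mono Set.inter_subset_right) (h.mono Set.inter_subset_left) (h'.mono Set.inter_subset_left)
  rwa [ext_self, ext_self] at this

/-- If there is a parallel metric, the curvature may be computed from any smooth fields. -/
lemma IsParallel.curvature_apply {g : Metric n M} (hg : IsParallel cov g) {s : Set M} {x : M}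
    {X Y Z : ∀ y : M, TangentSpace (𝓡 n) y} (hs : IsOpen s) (hx : x ∈ s)
    (hX : SmoothOn X s) (hY : SmoothOn Y s) (hZ : SmoothOn Z s) :
    curvature cov (X x) (Y x) (Z x) = curvatureField cov X Y Z x := by
  obtain ⟨t, ht, hxt, hZ'⟩ := smoothOn_ext (Z x)
  have hst := hs.inter ht
  have h1 : curvature cov (X x) (Y x) (Z x) = curvatureField cov X Y (ext (Z x)) x :=
    curvatureField_congr ht hxt (diffAt_ext _) (hX.diffAt hs hx) (diffAt_ext _) (hY.diffAt hs hx)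
      hZ' (ext_self _) (ext_self _)
  rw [h1]
  -- Independence of the extension in the third slot comes from skewness: paired with any `w`, both
  -- sides equal `-g(Z x, R(X, Y) W)`, which involves only the value of `Z` at `x`.
  refine flat_injective g x ?_
  ext w
  obtain ⟨r, hr, hxr, hW⟩ := smoothOn_ext w
  have skew := fun {V : ∀ y : M, TangentSpace (𝓡 n) y} (hV : SmoothOn V (s ∩ t ∩ r)) ↦
    hg.curvatureField_skew (hst.inter hr) ⟨⟨hx, hxt⟩, hxr⟩
      (hX.mono (Set.inter_subset_left.trans Set.inter_subset_left))
      (hY.mono (Set.inter_subset_left.trans Set.inter_subset_left)) hV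
      (hW.mono Set.inter_subset_right)
  have h2 := skew (hZ'.mono (Set.inter_subset_left.trans Set.inter_subset_right))
  have h3 := skew (hZ.mono (Set.inter_subset_left.trans Set.inter_subset_left))
  rw [ext_self] at h2 h3
  rw [ext_self] at h2
  exact h2.trans h3.symm

end Geometry

/-! ### Functions with vanishing derivative. -/

section LocallyConstant

variable {n : ℕ} {M : Type*} [TopologicalSpace M] [ChartedSpace (EuclideanSpace ℝ (Fin n)) M]
  [IsManifold (𝓡 n) ∞ M]

-- Read in the chart at `x`, the function has zero derivative on an open set, so its level sets
-- there are open.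
open Filter Topology in
lemma eventually_eq_of_mvfderiv_eq_zero {f : M → ℝ} {U : Set M} (hU : IsOpen U)
    (hf : ∀ x ∈ U, MDifferentiableAt (𝓡 n) 𝓘(ℝ) f x) (hf' : ∀ x ∈ U, mvfderiv (𝓡 n) f x = 0)
    {x : M} (hx : x ∈ U) : ∀ᶠ y in 𝓝 x, f y = f x := by
  set φ := extChartAt (𝓡 n) x
  have hO : IsOpen (φ.target ∩ φ.symm ⁻¹' U) :=
    (continuousOn_extChartAt_symm x).isOpen_inter_preimage (isOpen_extChartAt_target x) hU
  have hd : ∀ z ∈ φ.target ∩ φ.symm ⁻¹' U, HasFDerivAt (𝕜 := ℝ) (f ∘ φ.symm) 0 z := by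
    rintro z ⟨hz, hzU⟩
    have h1 : MDifferentiableAt 𝓘(ℝ, EuclideanSpace ℝ (Fin n)) (𝓡 n) φ.symm z :=
      ((contMDiffOn_extChartAt_symm (n := ∞) x).contMDiffAt
        ((isOpen_extChartAt_target x).mem_nhds hz)).mdifferentiableAt (by simp)
    have h2 := ((hf _ hzU).comp z h1).hasMFDerivAt
    have h3 := mvfderiv_comp z (hf _ hzU) h1
    rw [hf' _ hzU, ContinuousLinearMap.zero_comp] at h3
    have h4 := h2.hasFDerivAt
    have h5 : mfderiv 𝓘(ℝ, EuclideanSpace ℝ (Fin n)) 𝓘(ℝ) (f ∘ φ.symm) z = 0 := h3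
    rwa [h5] at h4
  have := hO.isOpen_inter_preimage_of_fderiv_eq_zero (𝕜 := ℝ)
    (fun z hz ↦ (hd z hz).differentiableAt.differentiableWithinAt) (fun z hz ↦ (hd z hz).fderiv)
    {f x}
  have hφx : φ.symm (φ x) = x := extChartAt_to_inv x
  have hmem := (continuousAt_extChartAt (I := 𝓡 n) x).preimage_mem_nhds
    (this.mem_nhds ⟨⟨mem_extChartAt_target x, by
      rw [Set.mem_preimage, hφx]; exact hx⟩, by simp [φ]⟩)
  filter_upwards [hmem, extChartAt_source_mem_nhds (I := 𝓡 n) x] with y hy hys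
  have h := hy.2
  rwa [Set.mem_preimage, Set.mem_singleton_iff, Function.comp_apply, φ.left_inv hys] at h

lemma eq_of_mvfderiv_eq_zero {f : M → ℝ} {U : Set M} (hU : IsOpen U) (hc : IsPreconnected U)
    (hf : ∀ x ∈ U, MDifferentiableAt (𝓡 n) 𝓘(ℝ) f x) (hf' : ∀ x ∈ U, mvfderiv (𝓡 n) f x = 0)
    {x y : M} (hx : x ∈ U) (hy : y ∈ U) : f x = f y := by
  have := Subtype.preconnectedSpace hc
  have : IsLocallyConstant fun z : U ↦ f z := (IsLocallyConstant.iff_eventually_eq _).2 fun z ↦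
    continuousAt_subtype_val.eventually (eventually_eq_of_mvfderiv_eq_zero hU hf hf' z.2)
  exact this.apply_eq_of_preconnectedSpace ⟨x, hx⟩ ⟨y, hy⟩

end LocallyConstant

/-! ### Normal forms of skew endomorphisms -/

section LinearAlgebra

/-- The involution `2 k ↔ 2 k + 1` of `Fin n`, fixing the last index if `n` is odd. -/
def partner {n : ℕ} (i : Fin n) : Fin n :=
  if h : Even (i : ℕ) then (if h' : (i : ℕ) + 1 < n then ⟨i + 1, h'⟩ else i)
  else ⟨i - 1, by omega⟩

lemma partner_val {n : ℕ} (i : Fin n) : (partner i : ℕ) =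
    if (i : ℕ) % 2 = 0 then (if (i : ℕ) + 1 < n then (i : ℕ) + 1 else i) else i - 1 := by
  unfold partner
  simp only [Nat.even_iff]
  split_ifs <;> rfl

lemma partner_partner {n : ℕ} (i : Fin n) : partner (partner i) = i := by
  ext
  have := i.2
  rw [partner_val, partner_val]
  split_ifs <;> omega

variable {n : ℕ} {V : Type*} [AddCommGroup V] [Module ℝ V]

open Module in
lemma complex_tensor_exists (z : ℂ ⊗[ℝ] V) :
    ∃ p q : V, z = 1 ⊗ₜ[ℝ] p + Complex.I ⊗ₜ[ℝ] q := by
  induction z with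
  | zero => exact ⟨0, 0, by simp⟩
  | tmul c v =>
    refine ⟨c.re • v, c.im • v, ?_⟩
    rw [← TensorProduct.smul_tmul, ← TensorProduct.smul_tmul, ← TensorProduct.add_tmul]
    congr 1
    simpa [mul_comm] using (Complex.re_add_im c).symm
  | add x y hx hy =>
    obtain ⟨p, q, rfl⟩ := hx
    obtain ⟨p', q', rfl⟩ := hy
    exact ⟨p + p', q + q', by simp only [TensorProduct.tmul_add]; abel⟩

lemma complex_tensor_inj {p q p' q' : V}
    (h : (1 : ℂ) ⊗ₜ[ℝ] p + Complex.I ⊗ₜ[ℝ] q = 1 ⊗ₜ[ℝ] p' + Complex.I ⊗ₜ[ℝ] q') :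
    p = p' ∧ q = q' := by
  have hre := congr(TensorProduct.lid ℝ V (LinearMap.rTensor V Complex.reLm $h))
  have him := congr(TensorProduct.lid ℝ V (LinearMap.rTensor V Complex.imLm $h))
  simp at hre him
  exact ⟨hre, him⟩

/-- The real form of the eigenvector equation `A (p + i q) = (a + i b) (p + i q)`. -/
lemma baseChange_eigenvector_iff (A : Module.End ℝ V) (μ : ℂ) (p q : V) :
    Module.End.HasEigenvector (A.baseChange ℂ : Module.End ℂ (ℂ ⊗[ℝ] V)) μ
      (1 ⊗ₜ[ℝ] p + Complex.I ⊗ₜ[ℝ] q) ↔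
    (A p = μ.re • p - μ.im • q ∧ A q = μ.re • q + μ.im • p) ∧ (p ≠ 0 ∨ q ≠ 0) := by
  rw [Module.End.hasEigenvector_iff, Module.End.mem_eigenspace_iff]
  have h1 : (A.baseChange ℂ : Module.End ℂ (ℂ ⊗[ℝ] V)) (1 ⊗ₜ[ℝ] p + Complex.I ⊗ₜ[ℝ] q) =
      1 ⊗ₜ[ℝ] A p + Complex.I ⊗ₜ[ℝ] A q := by simp
  have h2 : μ • ((1 : ℂ) ⊗ₜ[ℝ] p + Complex.I ⊗ₜ[ℝ] q) =
      1 ⊗ₜ[ℝ] (μ.re • p - μ.im • q) + Complex.I ⊗ₜ[ℝ] (μ.re • q + μ.im • p) := by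
    simp only [TensorProduct.tmul_sub, TensorProduct.tmul_add, ← TensorProduct.smul_tmul, smul_add,
      TensorProduct.smul_tmul']
    have : ∀ (c : ℂ) (r : V), c ⊗ₜ[ℝ] r = (c.re • (1 : ℂ)) ⊗ₜ[ℝ] r + (c.im • Complex.I) ⊗ₜ[ℝ] r := by
      intro c r
      rw [← TensorProduct.add_tmul]
      congr 1
      simp [Complex.re_add_im]
    rw [this (μ • 1) p, this (μ • Complex.I) q]
    simp only [smul_eq_mul, Complex.mul_re, Complex.mul_im, Complex.one_re, Complex.one_im,
      Complex.I_re, Complex.I_im, ← TensorProduct.smul_tmul']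
    simp only [mul_one, mul_zero, sub_zero, zero_add, add_zero, zero_sub, neg_smul]
    abel
  rw [h1, h2]
  refine and_congr ⟨fun h ↦ complex_tensor_inj h, fun h ↦ by rw [h.1, h.2]⟩ ?_
  rw [← not_iff_not, not_or, not_not, not_not, not_not]
  refine ⟨fun h ↦ complex_tensor_inj (by simpa using h), fun h ↦ by simp [h.1, h.2]⟩

lemma baseChange_hasEigenvalue_iff (A : Module.End ℝ V) (μ : ℂ) :
    Module.End.HasEigenvalue (A.baseChange ℂ : Module.End ℂ (ℂ ⊗[ℝ] V)) μ ↔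
    ∃ p q : V, (A p = μ.re • p - μ.im • q ∧ A q = μ.re • q + μ.im • p) ∧ (p ≠ 0 ∨ q ≠ 0) := by
  constructor
  · intro h
    obtain ⟨z, hz⟩ := h.exists_hasEigenvector
    obtain ⟨p, q, rfl⟩ := complex_tensor_exists z
    exact ⟨p, q, (baseChange_eigenvector_iff A μ p q).1 hz⟩
  · rintro ⟨p, q, h⟩
    exact Module.End.hasEigenvalue_of_hasEigenvector ((baseChange_eigenvector_iff A μ p q).2 h)

/-- `A` rotates `Y i` towards `Y (partner i)` with speed `- b i`. -/
structure IsNormalForm (A : Module.End ℝ V) (Y : Fin n → V) (b : Fin n → ℝ) : Prop where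
  apply : ∀ i, A (Y i) = -b i • Y (partner i)
  partner : ∀ i, b (partner i) = -b i

namespace IsNormalForm

variable {A : Module.End ℝ V} {Y : Fin n → V} {b : Fin n → ℝ}

lemma apply_partner (h : IsNormalForm A Y b) (i : Fin n) :
    A (Y (ParallelMetrics.partner i)) = b i • Y i := by
  rw [h.apply, h.partner, partner_partner, neg_neg]

lemma apply_apply (h : IsNormalForm A Y b) (i : Fin n) : A (A (Y i)) = -(b i ^ 2) • Y i := by
  rw [h.apply, map_smul, h.apply_partner, smul_smul]
  ring_nf

/-- Symmetric bilinear forms for which `A` is skew are diagonal in `Y`. -/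
lemma form_eq_zero (h : IsNormalForm A Y b) (hb : Function.Injective b)
    {G : V →ₗ[ℝ] V →ₗ[ℝ] ℝ} (hsymm : ∀ v w, G v w = G w v) (hskew : ∀ v w, G (A v) w = -G v (A w))
    {i j : Fin n} (hij : i ≠ j) : G (Y i) (Y j) = 0 := by
  -- `A²` is self-adjoint for `G` with eigenvalues `-b_i²`, so only the case `b_i = ± b_j` is left.
  have h1 : G (A (A (Y i))) (Y j) = G (Y i) (A (A (Y j))) := by rw [hskew, hskew, neg_neg]
  rw [h.apply_apply, h.apply_apply] at h1
  simp only [map_smul, LinearMap.smul_apply, smul_eq_mul] at h1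
  have h2 : (b i - b j) * (b i + b j) * G (Y i) (Y j) = 0 := by linarith
  rcases mul_eq_zero.1 h2 with h3 | h3
  · rcases mul_eq_zero.1 h3 with h4 | h4
    · exact absurd (hb (sub_eq_zero.1 h4)) hij
    -- In the plane of a conjugate pair, orthogonality comes from `G(A Y_j, Y_j) = 0`, since `A Y_j`
    -- is a nonzero multiple of the partner of `Y_j`.
    · have h5 : i = ParallelMetrics.partner j := hb (by rw [h.partner]; linarith)
      have h6 : G (A (Y j)) (Y j) = 0 := by
        have := hskew (Y j) (Y j)
        rw [hsymm (Y j)] at this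
        linarith
      have hbj : b j ≠ 0 := by
        intro h0
        exact hij (hb (by linarith))
      rw [h.apply, ← h5] at h6
      simpa [hbj] using h6
  · exact h3

variable {B : V →ₗ[ℝ] V →ₗ[ℝ] ℝ}

/-- The complex eigenvalues are the numbers `i b`. -/
lemma eigenvalues_eq (h : IsNormalForm A Y b) (hskew : ∀ v w, B (A v) w = -B v (A w))
    (hY0 : ∀ i, Y i ≠ 0) (hB : ∀ v, (∀ i, B v (Y i) = 0) → v = 0) :
    {μ : ℂ | Module.End.HasEigenvalue (A.baseChange ℂ : Module.End ℂ (ℂ ⊗[ℝ] V)) μ} =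
      Set.range fun i ↦ Complex.I * b i := by
  ext μ
  simp only [Set.mem_ofPred_eq, Set.mem_range, baseChange_hasEigenvalue_iff]
  constructor
  · rintro ⟨p, q, ⟨hp, hq⟩, hpq⟩
    -- The numbers `s i` are the pairings of the eigenvector `p + i q` with the `Y i`, not all zero.
    -- Moving `A` across by skewness gives `μ s_i = b_i s_(partner i)`; applied twice, `μ² = -b_i²`.
    set s : Fin n → ℂ := fun i ↦ B p (Y i) + Complex.I * B q (Y i) with hs
    have hs0 : ∃ i, s i ≠ 0 := by
      by_contra! hcon
      have : ∀ i, B p (Y i) = 0 ∧ B q (Y i) = 0 := fun i ↦ by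
        have := hcon i
        rw [Complex.ext_iff] at this
        simpa [hs] using this
      rcases hpq with hp0 | hq0
      · exact hp0 (hB p fun i ↦ (this i).1)
      · exact hq0 (hB q fun i ↦ (this i).2)
    have hrec : ∀ i, μ * s i = b i * s (ParallelMetrics.partner i) := by
      intro i
      have e1 := hskew p (Y i)
      have e2 := hskew q (Y i)
      rw [hp, h.apply] at e1
      rw [hq, h.apply] at e2
      simp only [map_sub, map_add, map_smul, LinearMap.sub_apply, LinearMap.add_apply,
        LinearMap.smul_apply, smul_eq_mul] at e1 e2
      apply Complex.ext <;> simp [hs] <;> linarith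
    obtain ⟨i, hi⟩ := hs0
    have h1 : (μ - Complex.I * b i) * (μ + Complex.I * b i) = 0 := by
      have e1 := hrec i
      have e2 := hrec (ParallelMetrics.partner i)
      rw [partner_partner, h.partner] at e2
      push_cast at e2
      refine (mul_eq_zero.1 (?_ : _ * s i = 0)).resolve_right hi
      linear_combination μ * e1 + b i * e2 - b i ^ 2 * s i * Complex.I_sq
    rcases mul_eq_zero.1 h1 with h2 | h2
    · exact ⟨i, (sub_eq_zero.1 h2).symm⟩
    · refine ⟨ParallelMetrics.partner i, ?_⟩
      rw [h.partner]
      push_cast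
      linear_combination -h2
  · rintro ⟨i, rfl⟩
    refine ⟨Y i, Y (ParallelMetrics.partner i), ⟨?_, ?_⟩, Or.inl (hY0 i)⟩
    · simp [h.apply]
    · simp [h.apply_partner]

/-- Both directions are used: genericity makes the speeds of an adapted frame distinct, and distinct
speeds show that a constructed frame is generic throughout its domain. -/
lemma ncard_eigenvalues_iff (h : IsNormalForm A Y b) (hskew : ∀ v w, B (A v) w = -B v (A w))
    (hY0 : ∀ i, Y i ≠ 0) (hB : ∀ v, (∀ i, B v (Y i) = 0) → v = 0) :
    {μ : ℂ | Module.End.HasEigenvalue (A.baseChange ℂ : Module.End ℂ (ℂ ⊗[ℝ] V)) μ}.ncard = n ↔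
      Function.Injective b := by
  classical
  have hinj : Function.Injective (fun i ↦ Complex.I * (b i : ℂ)) ↔ Function.Injective b := by
    refine ⟨fun hi i j hij ↦ hi (by simp [hij]), fun hi i j hij ↦ hi ?_⟩
    simpa using hij
  rw [h.eigenvalues_eq hskew hY0 hB, ← hinj]
  have : (Set.range fun i ↦ Complex.I * (b i : ℂ)) =
      ((Finset.univ.image fun i ↦ Complex.I * (b i : ℂ) : Finset ℂ) : Set ℂ) := by simp
  rw [this, Set.ncard_coe_finset]
  conv_lhs => rhs; rw [← Fintype.card_fin n, ← Finset.card_univ]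
  rw [Finset.card_image_iff, Finset.coe_univ, Set.injOn_univ]

end IsNormalForm

end LinearAlgebra

/-! ### Forms that are diagonal in an orthonormal frame. -/

section Orthonormal

variable {n : ℕ} {V : Type*} [AddCommGroup V] [Module ℝ V] {B : V →ₗ[ℝ] V →ₗ[ℝ] ℝ} {Y : Fin n → V}

lemma linearIndependent_of_orthonormal (hY : ∀ i j, B (Y i) (Y j) = if i = j then 1 else 0) :
    LinearIndependent ℝ Y := by
  refine Fintype.linearIndependent_iff.2 fun c hc i ↦ ?_
  have := congr(B $hc (Y i))
  simpa [hY] using this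

lemma eq_sum_of_orthonormal [Module.Finite ℝ V]
    (hY : ∀ i j, B (Y i) (Y j) = if i = j then 1 else 0)
    (hn : Module.finrank ℝ V = n) (v : V) : v = ∑ i, B v (Y i) • Y i := by
  -- The construction of a basis by counting requires a nonempty index type, so dimension zero is
  -- separate.
  rcases isEmpty_or_nonempty (Fin n) with hempty | hnonempty
  · have : n = 0 := by
      by_contra h0
      exact hempty.elim ⟨0, by omega⟩
    subst this
    have := Module.finrank_zero_iff.1 hn
    exact Subsingleton.elim _ _
  set b := basisOfLinearIndependentOfCardEqFinrank (linearIndependent_of_orthonormal hY)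
    (by simp [hn]) with hb
  have hbY : ⇑b = Y := by simp [hb]
  have hv : v = ∑ i, b.repr v i • Y i := by
    conv_lhs => rw [← b.sum_repr v]
    rw [hbY]
  have : ∀ i, B v (Y i) = b.repr v i := fun i ↦ by
    conv_lhs => rw [hv]
    simp [hY]
  simp_rw [this]
  exact hv

lemma eq_zero_of_orthonormal [Module.Finite ℝ V]
    (hY : ∀ i j, B (Y i) (Y j) = if i = j then 1 else 0)
    (hn : Module.finrank ℝ V = n) (v : V) (hv : ∀ i, B v (Y i) = 0) : v = 0 := by
  rw [eq_sum_of_orthonormal hY hn v]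
  simp [hv]

/-- Exchanging the indices in the second double sum leaves the terms `(c_j - c_i) a_ij s_i t_j`, all
zero. With `a` the matrix of a skew operator this gives skewness for a diagonal form; with `a` the
connection form it gives parallelism. -/
lemma sum_antisymm_eq_zero {c s t : Fin n → ℝ} {a : Fin n → Fin n → ℝ}
    (ha : ∀ i j, a i j = -a j i) (hc : ∀ i j, a i j ≠ 0 → c i = c j) :
    ∑ j, c j * ((∑ i, a i j * s i) * t j + s j * ∑ i, a i j * t i) = 0 := by
  simp only [mul_add, Finset.sum_add_distrib, Finset.sum_mul, Finset.mul_sum]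
  rw [Finset.sum_comm (f := fun j i ↦ c j * (s j * (a i j * t i))), ← Finset.sum_add_distrib]
  refine Finset.sum_eq_zero fun j _ ↦ ?_
  rw [← Finset.sum_add_distrib]
  refine Finset.sum_eq_zero fun i _ ↦ ?_
  rw [ha j i]
  by_cases h : a i j = 0
  · simp [h]
  · rw [hc i j h]; ring

variable (B Y) in
/-- The bilinear form that is diagonal with entries `c` in the `B`-orthonormal basis `Y`. -/
def diagForm (c : Fin n → ℝ) : V →ₗ[ℝ] V →ₗ[ℝ] ℝ :=
  LinearMap.mk₂ ℝ (fun v w ↦ ∑ i, c i * (B v (Y i) * B w (Y i)))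
    (by intros; simp [add_mul, mul_add, Finset.sum_add_distrib])
    (by intros; simp only [map_smul, LinearMap.smul_apply, smul_eq_mul, Finset.mul_sum]
        exact Finset.sum_congr rfl fun _ _ ↦ by ring)
    (by intros; simp [mul_add, Finset.sum_add_distrib])
    (by intros; simp only [map_smul, LinearMap.smul_apply, smul_eq_mul, Finset.mul_sum]
        exact Finset.sum_congr rfl fun _ _ ↦ by ring)

lemma diagForm_apply (c : Fin n → ℝ) (v w : V) :
    diagForm B Y c v w = ∑ i, c i * (B v (Y i) * B w (Y i)) := rfl

lemma diagForm_comm (c : Fin n → ℝ) (v w : V) : diagForm B Y c v w = diagForm B Y c w v := by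
  simp only [diagForm_apply, mul_comm (B v _)]

/-- An endomorphism skew for `B` that preserves the eigenspaces of the diagonal form is skew for
the diagonal form. -/
lemma diagForm_skew [Module.Finite ℝ V]
    (hY : ∀ i j, B (Y i) (Y j) = if i = j then 1 else 0)
    (hn : Module.finrank ℝ V = n) (hsymm : ∀ v w, B v w = B w v) {A : Module.End ℝ V}
    (hA : ∀ v w, B (A v) w = -B v (A w)) {c : Fin n → ℝ}
    (hc : ∀ i j, B (A (Y j)) (Y i) ≠ 0 → c i = c j) (v w : V) :
    diagForm B Y c (A v) w = -diagForm B Y c v (A w) := by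
  have key := sum_antisymm_eq_zero (c := c) (s := fun i ↦ B v (Y i)) (t := fun i ↦ B w (Y i))
    (a := fun i j ↦ B (A (Y j)) (Y i)) (fun i j ↦ by rw [hA, hsymm]) hc
  have hsum : ∀ v j, B (A v) (Y j) = -∑ i, B (A (Y j)) (Y i) * B v (Y i) := fun v j ↦ by
    rw [hA]
    conv_lhs => rw [eq_sum_of_orthonormal hY hn (A (Y j))]
    simp
  rw [← add_eq_zero_iff_eq_neg, diagForm_apply, diagForm_apply, ← Finset.sum_add_distrib,
    ← neg_eq_zero, ← Finset.sum_neg_distrib, ← key]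
  refine Finset.sum_congr rfl fun j _ ↦ ?_
  rw [hsum, hsum]
  ring

end Orthonormal

/-! ### Adapted frames and their comparison on overlaps. -/

section Frames

variable {n : ℕ} {M : Type*} [TopologicalSpace M] [ChartedSpace (EuclideanSpace ℝ (Fin n)) M]

lemma finrank_tangentSpace (x : M) : Module.finrank ℝ (TangentSpace (𝓡 n) x) = n :=
  finrank_euclideanSpace_fin (𝕜 := ℝ) (n := n)

lemma mvfderiv_eq_zero_of_eventuallyEq {f : M → ℝ} {x : M} {c : ℝ} (hf : f =ᶠ[nhds x] fun _ ↦ c) :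
    mvfderiv (𝓡 n) f x = 0 := by
  have : mfderiv (𝓡 n) 𝓘(ℝ) f x = 0 := by rw [hf.mfderiv_eq, mfderiv_const]; rfl
  ext v
  exact congr($this v)

variable [IsManifold (𝓡 n) ∞ M]

/-- The metric at a point as a bilinear form. -/
def form (g : Metric n M) (x : M) :
    TangentSpace (𝓡 n) x →ₗ[ℝ] TangentSpace (𝓡 n) x →ₗ[ℝ] ℝ :=
  LinearMap.mk₂ ℝ (fun v w ↦ g.inner x v w) (by simp) (by simp) (by simp) (by simp)

lemma form_apply (g : Metric n M) (x : M) (v w : TangentSpace (𝓡 n) x) :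
    form g x v w = g.inner x v w := rfl

variable [T2Space M] {cov : Connection n M}
  [CovariantDerivative.ContMDiffCovariantDerivative cov ∞] {h : Metric n M}

namespace AdaptedFrame

variable {U V : Opens M} (F : AdaptedFrame cov h U)

lemma eq_sum {x : M} (hx : x ∈ U) (v : TangentSpace (𝓡 n) x) :
    v = ∑ i, h.inner x v (F.Y i x) • F.Y i x :=
  eq_sum_of_orthonormal (B := form h x) (F.orthonormal x hx) (finrank_tangentSpace x) v

lemma diffAt_Y (i : Fin n) {x : M} (hx : x ∈ U) : DiffAt (F.Y i) x :=
  (F.smooth_Y i).diffAt U.isOpen hx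

lemma Y_ne_zero (i : Fin n) {x : M} (hx : x ∈ U) : F.Y i x ≠ 0 := by
  intro h0
  simpa [h0] using F.orthonormal x hx i i

/-- The curvature operator of an adapted frame is in normal form with distinct speeds. -/
lemma exists_normalForm (hh : IsParallel cov h) {x : M} (hx : x ∈ U) :
    ∃ b : Fin n → ℝ, IsNormalForm (curvature cov (F.ξ₁ x) (F.ξ₂ x)) (fun i ↦ F.Y i x) b ∧
      Function.Injective b := by
  set A := curvature cov (F.ξ₁ x) (F.ξ₂ x) with hA
  have skew : ∀ v w, form h x (A v) w = -form h x v (A w) :=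
    hh.curvature_skew (F.ξ₁ x) (F.ξ₂ x)
  have symm : ∀ v w, form h x v w = form h x w v := h.symm x
  have orth : ∀ i j, form h x (F.Y i x) (F.Y j x) = if i = j then 1 else 0 := F.orthonormal x hx
  have self : ∀ v, form h x (A v) v = 0 := fun v ↦ by
    have := skew v v
    rw [symm v] at this
    linarith
  -- The eigenvalue of `Y_i + i Y_j` is purely imaginary because `h(A Y_i, Y_i) = 0`, so `A` rotates
  -- the plane of the pair.
  have rot : ∀ i j : Fin n, Even (i : ℕ) → (j : ℕ) = i + 1 → ∃ r : ℝ,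
      A (F.Y i x) = r • F.Y j x ∧ A (F.Y j x) = -r • F.Y i x := by
    intro i j hi hij
    obtain ⟨⟨μ, hμ⟩, -⟩ := F.eigen_pair i j hi hij x hx
    obtain ⟨⟨h1, h2⟩, -⟩ := (baseChange_eigenvector_iff A μ _ _).1 hμ
    have hne : j ≠ i := by
      rintro rfl; omega
    have hre : μ.re = 0 := by
      have := self (F.Y i x)
      rw [h1] at this
      simpa [orth, hne] using this
    refine ⟨-μ.im, by rw [h1, hre]; module, by rw [h2, hre]; module⟩
  have main : ∀ i, A (F.Y i x) = form h x (A (F.Y i x)) (F.Y (partner i) x) • F.Y (partner i) x := by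
    intro i
    suffices ∃ r : ℝ, A (F.Y i x) = r • F.Y (partner i) x by
      obtain ⟨r, hr⟩ := this
      conv_rhs => rw [hr]
      simp [hr, orth]
    have hv := partner_val i
    by_cases hi : (i : ℕ) % 2 = 0
    · by_cases hi' : (i : ℕ) + 1 < n
      · obtain ⟨r, hr, -⟩ := rot i (partner i) (Nat.even_iff.2 hi) (by simp [hv, hi, hi'])
        exact ⟨r, hr⟩
      · have := (F.eigen_last i (Nat.even_iff.2 hi) (by omega) x hx).apply_eq_smul
        exact ⟨0, by rw [hA, this]; simp⟩
    · have hv' : (partner i : ℕ) = i - 1 := by simp [hv, hi]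
      obtain ⟨r, -, hr⟩ := rot (partner i) i (Nat.even_iff.2 (by omega)) (by omega)
      exact ⟨-r, hr⟩
  -- The sign change of the speed at the partner is skewness of `A`; at an unpaired last index the
  -- speed is zero.
  have nf : IsNormalForm A (fun i ↦ F.Y i x)
      (fun i ↦ -form h x (A (F.Y i x)) (F.Y (partner i) x)) := by
    refine ⟨fun i ↦ by rw [neg_neg]; exact main i, fun i ↦ ?_⟩
    rw [partner_partner, skew, symm]
  refine ⟨_, nf, (nf.ncard_eigenvalues_iff skew (fun i ↦ F.Y_ne_zero i hx)
    (eq_zero_of_orthonormal orth (finrank_tangentSpace x))).1 (F.distinct x hx)⟩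

/-- This is the derivative of the constant function `h(Y_j, Y_i)`. -/
lemma connectionForm_antisymm (hh : IsParallel cov h) (i j : Fin n) {x : M} (hx : x ∈ U)
    (v : TangentSpace (𝓡 n) x) : F.connectionForm i j x v = -F.connectionForm j i x v := by
  have h1 := hh x (F.Y j) (F.Y i) (F.diffAt_Y j hx) (F.diffAt_Y i hx) v
  have h2 : (fun y ↦ h.inner y (F.Y j y) (F.Y i y)) =ᶠ[nhds x] fun _ ↦ if j = i then 1 else 0 := by
    filter_upwards [U.isOpen.mem_nhds hx] with y hy using F.orthonormal y hy j i
  rw [mvfderiv_eq_zero_of_eventuallyEq h2, h.symm x (F.Y j x), zero_apply] at h1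
  simp only [connectionForm]
  linarith

lemma cov_Y_eq_sum (j : Fin n) {x : M} (hx : x ∈ U) (v : TangentSpace (𝓡 n) x) :
    cov (F.Y j) x v = ∑ i, F.connectionForm i j x v • F.Y i x :=
  F.eq_sum hx _

/-- The class of an index. -/
abbrev cls (i : Fin n) : F.IndexClass := Quotient.mk _ i

lemma cls_eq_of_connectionForm_ne {i j : Fin n} {x : M} (hx : x ∈ U) {v : TangentSpace (𝓡 n) x}
    (hv : F.connectionForm i j x v ≠ 0) : F.cls i = F.cls j :=
  Quotient.sound (Relation.EqvGen.rel _ _ ⟨x, hx, v, hv⟩)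

/-- The subbundles belonging to the classes are invariant under all curvature operators. -/
lemma curvature_block (hh : IsParallel cov h) {i j : Fin n} (hij : F.cls i ≠ F.cls j) {x : M}
    (hx : x ∈ U) (u v : TangentSpace (𝓡 n) x) :
    h.inner x (curvature cov u v (F.Y j x)) (F.Y i x) = 0 := by
  have zero : ∀ y ∈ U, ∀ w, F.connectionForm i j y w = 0 := fun y hy w ↦ by
    by_contra h0
    exact hij (F.cls_eq_of_connectionForm_ne hy h0)
  obtain ⟨t, ht, hxt, hu, hv⟩ := ext_nhds u v
  have hst := U.isOpen.inter ht
  have hxst : x ∈ (U : Set M) ∩ t := ⟨hx, hxt⟩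
  have hYj := (F.smooth_Y j).mono (Set.inter_subset_left (t := t))
  -- By parallelism `h(∇_u ∇_v Y_j, Y_i) = u(ω^i_j(v)) - h(∇_v Y_j, ∇_u Y_i)`. The first term is the
  -- derivative of zero. The second is a sum over `k` of `ω^k_j(v) ω^k_i(u)`, and a nonzero summand
  -- would put `i` and `j` in the same class through `k`.
  have second : ∀ u v : TangentSpace (𝓡 n) x, SmoothOn (ext v) t →
      h.inner x (cov (fun y ↦ cov (F.Y j) y (ext v y)) x u) (F.Y i x) = 0 := by
    intro u v hv
    have h1 := hh x (fun y ↦ cov (F.Y j) y (ext v y)) (F.Y i)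
      (mdiffAt_cov cov U.isOpen hx (F.smooth_Y j) (hv.diffAt ht hxt)) (F.diffAt_Y i hx) u
    have h2 : (fun y ↦ h.inner y (cov (F.Y j) y (ext v y)) (F.Y i y)) =ᶠ[nhds x] fun _ ↦ 0 := by
      filter_upwards [U.isOpen.mem_nhds hx] with y hy using zero y hy _
    have h3 : h.inner x (cov (F.Y j) x (ext v x)) (cov (F.Y i) x u) = 0 := by
      rw [F.cov_Y_eq_sum i hx, map_sum]
      refine Finset.sum_eq_zero fun k _ ↦ ?_
      rw [map_smul, smul_eq_mul, mul_eq_zero]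
      by_contra! hne
      exact hij ((F.cls_eq_of_connectionForm_ne hx hne.1).symm.trans
        (F.cls_eq_of_connectionForm_ne hx (v := ext v x) hne.2))
    rw [mvfderiv_eq_zero_of_eventuallyEq h2, h3] at h1
    simpa using h1.symm
  have h1 := hh.curvature_apply hst hxst (hu.mono Set.inter_subset_right)
    (hv.mono Set.inter_subset_right) hYj
  rw [ext_self, ext_self] at h1
  rw [h1, curvatureField, map_sub, map_sub, sub_apply, sub_apply, second _ v hv, second _ u hu]
  have := zero x hx (VectorField.mlieBracket (𝓡 n) (ext u) (ext v) x)
  simp only [connectionForm] at this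
  simp [this]

/-- Over `U ∩ V`, each vector of an adapted frame on `V` lies in one of the subbundles on `U`. -/
lemma exists_mem_localBundle (hh : IsParallel cov h) (F' : AdaptedFrame cov h V) {x : M}
    (hx : x ∈ U) (hx' : x ∈ V) (i : Fin n) : ∃ p, F'.Y i x ∈ F.localBundle p x := by
  classical
  obtain ⟨b, nf, hb⟩ := F'.exists_normalForm hh hx'
  obtain ⟨j, hj⟩ : ∃ j, h.inner x (F'.Y i x) (F.Y j x) ≠ 0 := by
    by_contra! hcon
    exact F'.Y_ne_zero i hx' (by rw [F.eq_sum hx (F'.Y i x)]; simp [hcon])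
  refine ⟨F.cls j, ?_⟩
  -- With `c` the indicator of the class of `j`, the form `G` is `h(π ·, ·)` for the orthogonal
  -- projection `π` onto that local bundle. Since curvature operators preserve the bundle, `G` is
  -- diagonal in the frame `F'`.
  set c : Fin n → ℝ := fun k ↦ if F.cls k = F.cls j then 1 else 0 with hc
  set G := diagForm (form h x) (fun i ↦ F.Y i x) c with hG
  have hdiag : ∀ k, k ≠ i → G (F'.Y i x) (F'.Y k x) = 0 := fun k hk ↦
    nf.form_eq_zero hb (diagForm_comm c) (diagForm_skew (F.orthonormal x hx)
      (finrank_tangentSpace x) (h.symm x) (hh.curvature_skew _ _) (fun k l hkl ↦ by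
        have : F.cls k = F.cls l := by
          by_contra hne
          exact hkl (F.curvature_block hh hne hx _ _)
        simp [hc, this])) hk.symm
  -- `w` is the projection `π` of the vector of `F'`; diagonality of `G` will make it a multiple of
  -- that vector.
  set w := ∑ k, c k • h.inner x (F'.Y i x) (F.Y k x) • F.Y k x with hw
  have hwG : ∀ v, h.inner x w v = G (F'.Y i x) v := fun v ↦ by
    simp [hw, hG, diagForm_apply, form_apply, h.symm x v]
  have hwmem : w ∈ F.localBundle (F.cls j) x := by
    refine Submodule.sum_mem _ fun k _ ↦ ?_
    by_cases hk : F.cls k = F.cls j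
    · exact Submodule.smul_mem _ _ (Submodule.smul_mem _ _ (Submodule.subset_span ⟨k, hk, rfl⟩))
    · simp [hc, hk]
  have hwi : w = G (F'.Y i x) (F'.Y i x) • F'.Y i x := by
    conv_lhs => rw [F'.eq_sum hx' w]
    rw [Finset.sum_eq_single i (fun k _ hk ↦ by rw [hwG, hdiag k hk, zero_smul]) (by simp), hwG]
  -- The projection keeps the `j`-th coordinate, which was chosen nonzero.
  have hne : G (F'.Y i x) (F'.Y i x) ≠ 0 := by
    intro h0
    have h1 : h.inner x w (F.Y j x) = h.inner x (F'.Y i x) (F.Y j x) := by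
      rw [hw, map_sum, sum_apply, Finset.sum_eq_single j]
      · simp [hc, F.orthonormal x hx]
      · intro k _ hk
        simp [F.orthonormal x hx, hk]
      · simp
    rw [hwi, h0] at h1
    simp at h1
    exact hj h1.symm
  rw [hwi] at hwmem
  exact (Submodule.smul_mem_iff _ hne).1 hwmem

end AdaptedFrame

end Frames

/-! ### Blocks and the global splitting of the tangent bundle. -/

section Decomposition

variable {n : ℕ} {M : Type*} [TopologicalSpace M] [ChartedSpace (EuclideanSpace ℝ (Fin n)) M]

/-- The tensor `∑ c_j Y_j ⊗ Y_j` at a point. -/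
def diagTensor {x : M} (Y : Fin n → TangentSpace (𝓡 n) x) (c : Fin n → ℝ) : CoTensorAt n x :=
  LinearMap.toContinuousBilinearMap
    (LinearMap.mk₂ ℝ (fun α β : Cotangent n x ↦ ∑ j, c j * (α (Y j) * β (Y j)))
      (by intros; simp [add_mul, mul_add, Finset.sum_add_distrib])
      (by intros; simp only [smul_apply, smul_eq_mul, Finset.mul_sum]
          exact Finset.sum_congr rfl fun _ _ ↦ by ring)
      (by intros; simp [mul_add, Finset.sum_add_distrib])
      (by intros; simp only [smul_apply, smul_eq_mul, Finset.mul_sum]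
          exact Finset.sum_congr rfl fun _ _ ↦ by ring))

lemma diagTensor_apply {x : M} (Y : Fin n → TangentSpace (𝓡 n) x) (c : Fin n → ℝ)
    (α β : Cotangent n x) : diagTensor Y c α β = ∑ j, c j * (α (Y j) * β (Y j)) := rfl

variable [IsManifold (𝓡 n) ∞ M]

lemma contravariant_apply (g : Metric n M) (x : M) (α β : Cotangent n x) :
    contravariant g x α β = α ((flat g x).symm β) := rfl

lemma flat_apply (g : Metric n M) (x : M) (v w : TangentSpace (𝓡 n) x) :
    flat g x v w = g.inner x v w := rfl

variable [T2Space M] {cov : Connection n M}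
  [CovariantDerivative.ContMDiffCovariantDerivative cov ∞] {h : Metric n M}

namespace AdaptedFrame

variable {U : Opens M} (F : AdaptedFrame cov h U)

lemma cotangent_apply {x : M} (hx : x ∈ U) (α : Cotangent n x) (v : TangentSpace (𝓡 n) x) :
    α v = ∑ i, h.inner x v (F.Y i x) * α (F.Y i x) := by
  conv_lhs => rw [F.eq_sum hx v]
  simp

lemma cotangent_ext {x : M} (hx : x ∈ U) {α β : Cotangent n x}
    (hαβ : ∀ i, α (F.Y i x) = β (F.Y i x)) : α = β := by
  ext v
  rw [F.cotangent_apply hx α, F.cotangent_apply hx β]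
  simp [hαβ]

lemma cotangent_eq_sum {x : M} (hx : x ∈ U) (α : Cotangent n x) :
    α = ∑ i, α (F.Y i x) • h.inner x (F.Y i x) := by
  classical
  refine F.cotangent_ext hx fun j ↦ ?_
  rw [sum_apply, Finset.sum_eq_single j]
  · simp [F.orthonormal x hx]
  · intro i _ hi
    simp [F.orthonormal x hx, hi]
  · simp

/-- A metric that is diagonal in the frame has the inverse diagonal form contravariantly. -/
lemma contravariant_eq {x : M} (hx : x ∈ U) (g : Metric n M)
    (hg : ∀ i j, i ≠ j → g.inner x (F.Y i x) (F.Y j x) = 0) :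
    contravariant g x =
      diagTensor (fun i ↦ F.Y i x) fun i ↦ (g.inner x (F.Y i x) (F.Y i x))⁻¹ := by
  ext α β
  have hflat : (flat g x).symm β =
      ∑ i, ((g.inner x (F.Y i x) (F.Y i x))⁻¹ * β (F.Y i x)) • F.Y i x := by
    rw [LinearEquiv.symm_apply_eq]
    refine F.cotangent_ext hx fun j ↦ ?_
    have hpos : g.inner x (F.Y j x) (F.Y j x) ≠ 0 := (g.pos x _ (F.Y_ne_zero j hx)).ne'
    rw [flat_apply, map_sum, sum_apply, Finset.sum_eq_single j]
    · simp only [map_smul, smul_apply, smul_eq_mul]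
      field_simp
    · intro i _ hi
      simp [hg i j hi]
    · simp
  rw [contravariant_apply, hflat, diagTensor_apply, map_sum]
  refine Finset.sum_congr rfl fun i _ ↦ ?_
  simp only [map_smul, smul_eq_mul]
  ring

lemma contravariant_self {x : M} (hx : x ∈ U) :
    contravariant h x = diagTensor (fun i ↦ F.Y i x) fun _ ↦ 1 := by
  rw [F.contravariant_eq hx h fun i j hij ↦ by simp [F.orthonormal x hx, hij]]
  simp [F.orthonormal x hx]

end AdaptedFrame

namespace AdaptedCover

variable (D : AdaptedCover cov h)

/-- The block of an index on a member of the cover. -/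
def blk (U : D.cover) (j : Fin n) : D.Block := Quotient.mk _ ⟨U, (D.frame U).cls j⟩

lemma exists_cls_eq {U : D.cover} (p : (D.frame U).IndexClass) : ∃ j, (D.frame U).cls j = p :=
  Quotient.exists_rep p

lemma bundleOn_eq_span (a : D.Block) (U : D.cover) (x : M) :
    D.bundleOn a U x = Submodule.span ℝ ((fun j ↦ (D.frame U).Y j x) '' {j | D.blk U j = a}) := by
  apply le_antisymm
  · refine iSup₂_le fun p hp ↦ Submodule.span_mono ?_
    rintro _ ⟨j, rfl, rfl⟩
    exact ⟨j, hp, rfl⟩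
  · rw [Submodule.span_le]
    rintro _ ⟨j, hj, rfl⟩
    exact (le_iSup₂_of_le (f := fun (p : (D.frame U).IndexClass)
      (_ : (Quotient.mk _ ⟨U, p⟩ : D.Block) = a) ↦ (D.frame U).localBundle p x)
      ((D.frame U).cls j) hj le_rfl) (Submodule.subset_span ⟨j, rfl, rfl⟩)

variable {D}

lemma blk_eq_of_mem {U V : D.cover} {x : M} (hx : x ∈ (U : Opens M)) (hx' : x ∈ (V : Opens M))
    {i : Fin n} {p : (D.frame U).IndexClass}
    (hi : (D.frame V).Y i x ∈ (D.frame U).localBundle p x) :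
    D.blk V i = Quotient.mk _ ⟨U, p⟩ := by
  refine Quotient.sound (Relation.EqvGen.rel _ _ ⟨x, hx', hx, ?_⟩)
  rw [Submodule.ne_bot_iff]
  exact ⟨_, ⟨Submodule.subset_span ⟨i, rfl, rfl⟩, hi⟩, (D.frame V).Y_ne_zero i hx'⟩

/-- A frame vector on `V` is nonzero and lies in a local bundle on `U` as well as in its own, which
is exactly what identifies the two in a block. -/
lemma exists_blk_eq (hh : IsParallel cov h) {U V : D.cover} {x : M} (hx : x ∈ (U : Opens M))
    (hx' : x ∈ (V : Opens M)) (i : Fin n) : ∃ j, D.blk U j = D.blk V i ∧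
      (D.frame V).Y i x ∈ (D.frame U).localBundle ((D.frame U).cls j) x := by
  obtain ⟨p, hp⟩ := (D.frame U).exists_mem_localBundle hh (D.frame V) hx hx' i
  obtain ⟨j, rfl⟩ := D.exists_cls_eq p
  exact ⟨j, (blk_eq_of_mem hx hx' hp).symm, hp⟩

lemma bundleOn_le (hh : IsParallel cov h) (a : D.Block) {U V : D.cover} {x : M}
    (hx : x ∈ (U : Opens M)) (hx' : x ∈ (V : Opens M)) : D.bundleOn a V x ≤ D.bundleOn a U x := by
  rw [D.bundleOn_eq_span a V, Submodule.span_le]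
  rintro _ ⟨i, rfl, rfl⟩
  obtain ⟨j, hj, hmem⟩ := exists_blk_eq hh hx hx' i
  exact (le_iSup₂_of_le (f := fun (p : (D.frame U).IndexClass)
      (_ : (Quotient.mk _ ⟨U, p⟩ : D.Block) = D.blk V i) ↦ (D.frame U).localBundle p x)
      ((D.frame U).cls j) hj le_rfl) hmem

lemma bundle_eq_bundleOn (hh : IsParallel cov h) (a : D.Block) {U : D.cover} {x : M}
    (hx : x ∈ (U : Opens M)) : D.bundle a x = D.bundleOn a U x :=
  le_antisymm (iSup₂_le fun _ hV ↦ bundleOn_le hh a hx hV)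
    (le_iSup₂_of_le (f := fun (U : D.cover) (_ : x ∈ (U : Opens M)) ↦ D.bundleOn a U x) U hx le_rfl)

lemma bundle_eq_span (hh : IsParallel cov h) (a : D.Block) {U : D.cover} {x : M}
    (hx : x ∈ (U : Opens M)) :
    D.bundle a x = Submodule.span ℝ ((fun j ↦ (D.frame U).Y j x) '' {j | D.blk U j = a}) := by
  rw [bundle_eq_bundleOn hh a hx, bundleOn_eq_span]

/-- Each block is represented on each member of the cover. -/
lemma blk_surjective [ConnectedSpace M] (hh : IsParallel cov h) (U : D.cover) :
    Function.Surjective (D.blk U) := by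
  intro a
  set S : Set M := ⋃ (V : D.cover) (_ : ∃ j, D.blk V j = a), ((V : Opens M) : Set M) with hS
  set S' : Set M := ⋃ (V : D.cover) (_ : ¬∃ j, D.blk V j = a), ((V : Opens M) : Set M) with hS'
  -- Overlapping members of the cover carry the same blocks, so the members carrying `a` and the
  -- others have disjoint unions. Both unions are open, and the first is nonempty, hence it is all
  -- of `M`.
  have hcompl : S = S'ᶜ := by
    ext x
    simp only [hS, hS', Set.mem_iUnion, Set.mem_compl_iff, SetLike.mem_coe, exists_prop]
    constructor
    · rintro ⟨V, ⟨j, hj⟩, hx⟩ ⟨W, hW, hx'⟩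
      obtain ⟨k, hk, -⟩ := exists_blk_eq hh hx' hx j
      exact hW ⟨k, hk.trans hj⟩
    · intro hx
      push Not at hx
      obtain ⟨V, hV, hxV⟩ := D.covers x
      by_contra! hcon
      exact hx ⟨V, hV⟩ (by simpa using fun hne ↦ hcon ⟨V, hV⟩ hne hxV) hxV
  have hopen : IsOpen S := isOpen_iUnion fun V ↦ isOpen_iUnion fun _ ↦ V.1.isOpen
  have hopen' : IsOpen S' := isOpen_iUnion fun V ↦ isOpen_iUnion fun _ ↦ V.1.isOpen
  have huniv : S = Set.univ := by
    refine IsClopen.eq_univ ⟨?_, hopen⟩ ?_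
    · rw [hcompl]; exact hopen'.isClosed_compl
    · obtain ⟨⟨V, p⟩, rfl⟩ := Quotient.exists_rep a
      obtain ⟨x, hx⟩ := (D.connected V V.2).nonempty
      obtain ⟨j, rfl⟩ := D.exists_cls_eq p
      exact ⟨x, Set.mem_iUnion₂.2 ⟨V, ⟨j, rfl⟩, hx⟩⟩
  obtain ⟨x, hx⟩ := (D.connected U U.2).nonempty
  obtain ⟨V, ⟨j, hj⟩, hxV⟩ := Set.mem_iUnion₂.1 (huniv ▸ Set.mem_univ x : x ∈ S)
  obtain ⟨k, hk, -⟩ := exists_blk_eq hh hx hxV j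
  exact ⟨k, hk.trans hj⟩

lemma bundle_ne_bot [ConnectedSpace M] (hh : IsParallel cov h) (a : D.Block) (x : M) :
    D.bundle a x ≠ ⊥ := by
  obtain ⟨U, hU, hx⟩ := D.covers x
  obtain ⟨j, hj⟩ := blk_surjective hh ⟨U, hU⟩ a
  rw [bundle_eq_span hh a (U := ⟨U, hU⟩) hx, Submodule.ne_bot_iff]
  exact ⟨_, Submodule.subset_span ⟨j, hj, rfl⟩, (D.frame ⟨U, hU⟩).Y_ne_zero j hx⟩

/-- One member of the cover carries all blocks, and it has only `n` indices. -/
lemma finite_block [ConnectedSpace M] (hh : IsParallel cov h) : Finite D.Block := by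
  obtain ⟨U, hU, -⟩ := D.covers (Classical.arbitrary M)
  exact Finite.of_surjective _ (blk_surjective hh ⟨U, hU⟩)

lemma iSupIndep_bundle (hh : IsParallel cov h) (x : M) : iSupIndep fun a ↦ D.bundle a x := by
  obtain ⟨U, hU, hx⟩ := D.covers x
  intro a
  have hli := linearIndependent_of_orthonormal (B := form h x) ((D.frame ⟨U, hU⟩).orthonormal x hx)
  refine (hli.disjoint_span_image (s := {j | D.blk ⟨U, hU⟩ j = a})
    (t := {j | D.blk ⟨U, hU⟩ j ≠ a}) ?_).mono ?_ ?_
  · exact Set.disjoint_left.2 fun j hj hj' ↦ hj' hj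
  · exact (bundle_eq_span hh a (U := ⟨U, hU⟩) hx).le
  · refine iSup₂_le fun b hb ↦ ?_
    refine (bundle_eq_span hh b (U := ⟨U, hU⟩) hx).le.trans (Submodule.span_mono (Set.image_mono ?_))
    rintro j rfl
    exact hb

lemma iSup_bundle (hh : IsParallel cov h) (x : M) : ⨆ a, D.bundle a x = ⊤ := by
  obtain ⟨U, hU, hx⟩ := D.covers x
  rw [eq_top_iff]
  intro v _
  rw [(D.frame ⟨U, hU⟩).eq_sum hx v]
  refine Submodule.sum_mem _ fun i _ ↦ Submodule.smul_mem _ _ ?_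
  refine (le_iSup (fun a ↦ D.bundle a x) (D.blk ⟨U, hU⟩ i)) ?_
  rw [bundle_eq_span hh _ (U := ⟨U, hU⟩) hx]
  exact Submodule.subset_span ⟨i, rfl, rfl⟩

/-- The transition matrix between two adapted frames is block diagonal: `Y_j` of `V` lies in one
local bundle on `U`, orthogonal to the frame vectors of the other classes. -/
lemma blk_eq_of_inner_ne_zero (hh : IsParallel cov h) {U V : D.cover} {x : M}
    (hx : x ∈ (U : Opens M)) (hx' : x ∈ (V : Opens M)) {i j : Fin n}
    (hij : h.inner x ((D.frame U).Y i x) ((D.frame V).Y j x) ≠ 0) : D.blk U i = D.blk V j := by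
  obtain ⟨k, hk, hmem⟩ := exists_blk_eq hh hx hx' j
  rw [← hk]
  by_contra hne
  refine hij ?_
  have hle : (D.frame U).localBundle ((D.frame U).cls k) x ≤
      LinearMap.ker (form h x ((D.frame U).Y i x)) := by
    refine Submodule.span_le.2 ?_
    rintro _ ⟨l, hl, rfl⟩
    have hil : i ≠ l := by
      rintro rfl
      exact hne (by simp only [blk, ← hl])
    rw [SetLike.mem_coe, LinearMap.mem_ker, form_apply, (D.frame U).orthonormal x hx, if_neg hil]
  exact hle hmem

/-- Tensors that are diagonal with eigenvalues depending only on the block do not depend on the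
frame. -/
lemma diagTensor_blk_eq (hh : IsParallel cov h) (c : D.Block → ℝ) {U V : D.cover} {x : M}
    (hx : x ∈ (U : Opens M)) (hx' : x ∈ (V : Opens M)) :
    diagTensor (fun j ↦ (D.frame U).Y j x) (fun j ↦ c (D.blk U j)) =
      diagTensor (fun j ↦ (D.frame V).Y j x) fun j ↦ c (D.blk V j) := by
  ext α β
  simp only [diagTensor_apply]
  -- Nonzero transition coefficients join only indices of the same block, so `c` can be carried from
  -- the frame on `U` to the one on `V` under the sum.
  have h1 : ∀ j, c (D.blk U j) * (α ((D.frame U).Y j x) * β ((D.frame U).Y j x)) =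
      ∑ i, c (D.blk V i) * (h.inner x ((D.frame U).Y j x) ((D.frame V).Y i x) *
        α ((D.frame V).Y i x) * β ((D.frame U).Y j x)) := fun j ↦ by
    rw [(D.frame V).cotangent_apply hx' α ((D.frame U).Y j x), Finset.sum_mul, Finset.mul_sum]
    refine Finset.sum_congr rfl fun i _ ↦ ?_
    by_cases h0 : h.inner x ((D.frame U).Y j x) ((D.frame V).Y i x) = 0
    · simp [h0]
    · rw [blk_eq_of_inner_ne_zero hh hx hx' h0]
  rw [Finset.sum_congr rfl fun j _ ↦ h1 j, Finset.sum_comm]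
  refine Finset.sum_congr rfl fun i _ ↦ ?_
  rw [(D.frame U).cotangent_apply hx β ((D.frame V).Y i x), Finset.mul_sum, Finset.mul_sum]
  refine Finset.sum_congr rfl fun j _ ↦ ?_
  rw [h.symm x ((D.frame V).Y i x)]
  ring

variable (D) in
/-- The tensor field `∑ c_a h_a`. -/
def blockTensor (c : D.Block → ℝ) : CoTensor n M := fun x ↦
  letI U : D.cover := ⟨(D.covers x).choose, (D.covers x).choose_spec.1⟩
  diagTensor (fun j ↦ (D.frame U).Y j x) fun j ↦ c (D.blk U j)

lemma blockTensor_eq (hh : IsParallel cov h) (c : D.Block → ℝ) {U : D.cover} {x : M}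
    (hx : x ∈ (U : Opens M)) : D.blockTensor c x =
      diagTensor (fun j ↦ (D.frame U).Y j x) fun j ↦ c (D.blk U j) :=
  diagTensor_blk_eq hh c (D.covers x).choose_spec.2 hx

lemma blockTensor_apply (hh : IsParallel cov h) (c : D.Block → ℝ) {U : D.cover} {x : M}
    (hx : x ∈ (U : Opens M)) (α β : Cotangent n x) : D.blockTensor c x α β =
      ∑ j, c (D.blk U j) * (α ((D.frame U).Y j x) * β ((D.frame U).Y j x)) := by
  rw [blockTensor_eq hh c hx, diagTensor_apply]

lemma apply_eq_zero_of_mem_dualBundle (hh : IsParallel cov h) {U : D.cover} {x : M}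
    (hx : x ∈ (U : Opens M)) {a : D.Block} {α : Cotangent n x} (hα : α ∈ D.dualBundle a x)
    {j : Fin n} (hj : D.blk U j ≠ a) : α ((D.frame U).Y j x) = 0 := by
  refine hα _ hj _ ?_
  rw [bundle_eq_span hh _ hx]
  exact Submodule.subset_span ⟨j, rfl, rfl⟩

/-- The metric duals of the frame vectors form a basis of the cotangent space adapted to the dual
splitting; tensors are tested on it. -/
lemma inner_mem_dualBundle (hh : IsParallel cov h) {U : D.cover} {x : M}
    (hx : x ∈ (U : Opens M)) (j : Fin n) :
    h.inner x ((D.frame U).Y j x) ∈ D.dualBundle (D.blk U j) x := by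
  intro b hb v hv
  rw [bundle_eq_span hh _ hx] at hv
  have hle : Submodule.span ℝ ((fun j ↦ (D.frame U).Y j x) '' {j | D.blk U j = b}) ≤
      LinearMap.ker (form h x ((D.frame U).Y j x)) := by
    refine Submodule.span_le.2 ?_
    rintro _ ⟨l, rfl, rfl⟩
    have hil : j ≠ l := by
      rintro rfl
      exact hb rfl
    rw [SetLike.mem_coe, LinearMap.mem_ker, form_apply, (D.frame U).orthonormal x hx, if_neg hil]
  exact hle hv

-- The adapted basis of metric duals makes the prescribed values determine the tensor, and the
-- indicator coefficients of `a` realize them.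
open Classical in
lemma isBlockTensor_iff (hh : IsParallel cov h) (a : D.Block) (t : CoTensor n M) :
    D.IsBlockTensor a t ↔ t = D.blockTensor (Pi.single a 1) := by
  have self : D.IsBlockTensor a (D.blockTensor (Pi.single a 1)) := by
    intro x b c α hα β hβ
    obtain ⟨U, hU, hx⟩ := D.covers x
    rw [blockTensor_apply hh _ (U := ⟨U, hU⟩) hx]
    split_ifs with habc
    · obtain ⟨rfl, rfl⟩ := habc
      rw [(D.frame ⟨U, hU⟩).contravariant_self hx, diagTensor_apply]
      refine Finset.sum_congr rfl fun j _ ↦ ?_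
      by_cases hj : D.blk ⟨U, hU⟩ j = a
      · simp [hj]
      · rw [apply_eq_zero_of_mem_dualBundle hh (U := ⟨U, hU⟩) hx hα hj]
        simp
    · refine Finset.sum_eq_zero fun j _ ↦ ?_
      by_cases hj : D.blk ⟨U, hU⟩ j = a
      · rw [not_and_or] at habc
        rcases habc with hb | hc
        · rw [apply_eq_zero_of_mem_dualBundle hh (U := ⟨U, hU⟩) hx hα (by rwa [hj])]
          simp
        · rw [apply_eq_zero_of_mem_dualBundle hh (U := ⟨U, hU⟩) hx hβ (by rwa [hj])]
          simp
      · simp [hj]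
  refine ⟨fun ht ↦ ?_, fun ht ↦ ht ▸ self⟩
  funext x
  obtain ⟨U, hU, hx⟩ := D.covers x
  have key : ∀ i j, t x (h.inner x ((D.frame ⟨U, hU⟩).Y i x)) (h.inner x ((D.frame ⟨U, hU⟩).Y j x)) =
      D.blockTensor (Pi.single a 1) x (h.inner x ((D.frame ⟨U, hU⟩).Y i x))
        (h.inner x ((D.frame ⟨U, hU⟩).Y j x)) := fun i j ↦
    (ht x _ _ _ (inner_mem_dualBundle hh (U := ⟨U, hU⟩) hx i) _
      (inner_mem_dualBundle hh (U := ⟨U, hU⟩) hx j)).trans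
    (self x _ _ _ (inner_mem_dualBundle hh (U := ⟨U, hU⟩) hx i) _
      (inner_mem_dualBundle hh (U := ⟨U, hU⟩) hx j)).symm
  ext α β
  rw [(D.frame ⟨U, hU⟩).cotangent_eq_sum hx α, (D.frame ⟨U, hU⟩).cotangent_eq_sum hx β]
  simp only [map_sum, map_smul, sum_apply, smul_apply, key]

lemma sum_smul_blockTensor [Fintype D.Block] [DecidableEq D.Block] (c : D.Block → ℝ) :
    ∑ a, c a • D.blockTensor (Pi.single a 1) = D.blockTensor c := by
  funext x
  ext α β
  simp only [Finset.sum_apply, Pi.smul_apply, sum_apply, smul_apply, blockTensor, diagTensor_apply,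
    smul_eq_mul, Finset.mul_sum]
  rw [Finset.sum_comm]
  refine Finset.sum_congr rfl fun j _ ↦ ?_
  rw [Finset.sum_eq_single_of_mem (D.blk ⟨_, (D.covers x).choose_spec.1⟩ j) (Finset.mem_univ _)]
  · simp
  · intro b _ hb
    simp [hb.symm]

/-- Evaluation at a single point recovers each coefficient. These evaluations serve as continuous
coordinates on the cone and prove linear independence. -/
lemma blockTensor_apply_inner (hh : IsParallel cov h) (c : D.Block → ℝ) {U : D.cover} {x : M}
    (hx : x ∈ (U : Opens M)) (j : Fin n) : D.blockTensor c x (h.inner x ((D.frame U).Y j x))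
      (h.inner x ((D.frame U).Y j x)) = c (D.blk U j) := by
  classical
  rw [blockTensor_apply hh c hx, Finset.sum_eq_single j]
  · simp [(D.frame U).orthonormal x hx]
  · intro i _ hi
    simp [(D.frame U).orthonormal x hx, hi.symm]
  · simp

end AdaptedCover

end Decomposition

/-! ### Smoothness of squares of one-forms. -/

section Forms

lemma contDiff_smulRight_self {E : Type*} [NormedAddCommGroup E] [NormedSpace ℝ E] :
    ContDiff ℝ ∞ fun L : E →L[ℝ] ℝ ↦ L.smulRight L :=
  contDiff_id.smulRight contDiff_id

variable {n : ℕ} {M : Type*} [TopologicalSpace M] [ChartedSpace (EuclideanSpace ℝ (Fin n)) M]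

lemma mvfderiv_sum {ι : Type*} (s : Finset ι) {f : ι → M → ℝ} {x : M}
    (hf : ∀ i, MDifferentiableAt (𝓡 n) 𝓘(ℝ) (f i) x) :
    MDifferentiableAt (𝓡 n) 𝓘(ℝ) (fun y ↦ ∑ i ∈ s, f i y) x ∧
      mvfderiv (𝓡 n) (fun y ↦ ∑ i ∈ s, f i y) x = ∑ i ∈ s, mvfderiv (𝓡 n) (f i) x := by
  classical
  induction s using Finset.induction_on with
  | empty => simpa using ⟨mdifferentiableAt_const, mvfderiv_const (0 : ℝ)⟩
  | insert i s hi ih =>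
    simp only [Finset.sum_insert hi]
    exact ⟨(hf i).add ih.1, by rw [mvfderiv_fun_add (hf i) ih.1, ih.2]⟩

variable [IsManifold (𝓡 n) ∞ M]

/-- The tensor product of a smooth one-form with itself is smooth. -/
lemma contMDiffAt_smulRight {θ : ∀ y : M, Cotangent n y} {x : M}
    (hθ : ContMDiffAt (𝓡 n) ((𝓡 n).prod 𝓘(ℝ, EuclideanSpace ℝ (Fin n) →L[ℝ] ℝ)) ∞
      (fun y ↦ TotalSpace.mk' (EuclideanSpace ℝ (Fin n) →L[ℝ] ℝ)
        (E := fun y : M ↦ Cotangent n y) y (θ y)) x) :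
    ContMDiffAt (𝓡 n)
      ((𝓡 n).prod 𝓘(ℝ, EuclideanSpace ℝ (Fin n) →L[ℝ] EuclideanSpace ℝ (Fin n) →L[ℝ] ℝ)) ∞
      (fun y ↦ TotalSpace.mk' (EuclideanSpace ℝ (Fin n) →L[ℝ] EuclideanSpace ℝ (Fin n) →L[ℝ] ℝ)
        (E := fun y : M ↦ TangentSpace (𝓡 n) y →L[ℝ] Cotangent n y) y
        ((θ y).smulRight (θ y))) x := by
  -- In the trivialization at `x`, the coordinates of `θ ⊗ θ` are the image of those of `θ` under
  -- the smooth map `L ↦ L ⊗ L`.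
  have h1 := ((contMDiffAt_hom_bundle _).1 hθ).2
  refine (contMDiffAt_hom_bundle _).2 ⟨contMDiffAt_id, ?_⟩
  have h2 := (contDiff_smulRight_self (E := EuclideanSpace ℝ (Fin n))).contMDiff.contMDiffAt.comp
    x h1
  refine h2.congr_of_eventuallyEq ?_
  filter_upwards [(trivializationAt (EuclideanSpace ℝ (Fin n)) (TangentSpace (𝓡 n) : M → Type)
    x).open_baseSet.mem_nhds (FiberBundle.mem_baseSet_trivializationAt' x)] with y hy
  ext v w
  refine (inCoordinates_apply_eq₂ (F₁ := EuclideanSpace ℝ (Fin n))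
    (F₂ := EuclideanSpace ℝ (Fin n)) (F₃ := ℝ) hy hy (by simp)).trans ?_
  have hsymm := fun u ↦ (trivializationAt (EuclideanSpace ℝ (Fin n))
    (TangentSpace (𝓡 n) : M → Type) x).symmL_apply (R := ℝ) hy u
  simp [ContinuousLinearMap.inCoordinates, hsymm]

lemma ContMDiffAt.inner_left (h : Metric n M) {Y : ∀ y : M, TangentSpace (𝓡 n) y} {s : Set M}
    {x : M} (hs : IsOpen s) (hx : x ∈ s) (hY : SmoothOn Y s) :
    ContMDiffAt (𝓡 n) ((𝓡 n).prod 𝓘(ℝ, EuclideanSpace ℝ (Fin n) →L[ℝ] ℝ)) ∞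
      (fun y ↦ TotalSpace.mk' (EuclideanSpace ℝ (Fin n) →L[ℝ] ℝ)
        (E := fun y : M ↦ Cotangent n y) y (h.inner y (Y y))) x :=
  ContMDiffAt.clm_bundle_apply (F₁ := EuclideanSpace ℝ (Fin n)) (h.contMDiff x)
    (hY.contMDiffAt (hs.mem_nhds hx))

end Forms

/-! ### Parallel metrics in terms of the blocks. -/

section ParallelMetric

variable {n : ℕ} {M : Type*} [TopologicalSpace M] [ChartedSpace (EuclideanSpace ℝ (Fin n)) M]
  [IsManifold (𝓡 n) ∞ M] [T2Space M] {cov : Connection n M}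
  [CovariantDerivative.ContMDiffCovariantDerivative cov ∞] {h : Metric n M}

namespace AdaptedFrame

variable {U : Opens M} (F : AdaptedFrame cov h U)

/-- The same curvature operator is skew for `g`, so its normal form diagonalizes `g` too. -/
lemma inner_eq_zero (hh : IsParallel cov h) {g : Metric n M} (hg : IsParallel cov g) {x : M}
    (hx : x ∈ U) {i j : Fin n} (hij : i ≠ j) : g.inner x (F.Y i x) (F.Y j x) = 0 := by
  obtain ⟨b, nf, hb⟩ := F.exists_normalForm hh hx
  exact nf.form_eq_zero (G := form g x) hb (g.symm x) (hg.curvature_skew _ _) hij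

lemma inner_eq (hh : IsParallel cov h) {g : Metric n M} (hg : IsParallel cov g) {x : M}
    (hx : x ∈ U) (j : Fin n) (w : TangentSpace (𝓡 n) x) :
    g.inner x w (F.Y j x) = g.inner x (F.Y j x) (F.Y j x) * h.inner x w (F.Y j x) := by
  conv_lhs => rw [F.eq_sum hx w]
  rw [map_sum, sum_apply, Finset.sum_eq_single j]
  · simp [mul_comm]
  · intro i _ hi
    simp [F.inner_eq_zero hh hg hx hi]
  · simp

/-- As `g` is diagonal, the derivative of `g(Y_j, Y_j)` is `2 g(Y_j, Y_j) ω^j_j`, and `ω^j_j = 0` by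
antisymmetry. -/
lemma inner_self_eq_of_mem (hU : IsPreconnected (U : Set M)) (hh : IsParallel cov h)
    {g : Metric n M} (hg : IsParallel cov g) {x y : M} (hx : x ∈ U) (hy : y ∈ U) (j : Fin n) :
    g.inner x (F.Y j x) (F.Y j x) = g.inner y (F.Y j y) (F.Y j y) := by
  refine eq_of_mvfderiv_eq_zero (f := fun z ↦ g.inner z (F.Y j z) (F.Y j z)) U.isOpen hU
    (fun z hz ↦ (F.diffAt_Y j hz).inner g (F.diffAt_Y j hz)) (fun z hz ↦ ?_) hx hy
  ext v
  rw [hg z _ _ (F.diffAt_Y j hz) (F.diffAt_Y j hz), g.symm z (F.Y j z), F.inner_eq hh hg hz]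
  have h1 := F.connectionForm_antisymm hh j j hz v
  simp only [connectionForm] at h1
  rw [show h.inner z (cov (F.Y j) z v) (F.Y j z) = 0 by linarith]
  simp

/-- Differentiating `g(Y_i, Y_j) = 0` gives `ω^i_j (g_ii - g_jj) = 0`. This is used at a point where
`ω^i_j ≠ 0`; constancy on `U` carries the equality to every other point. -/
lemma inner_self_eq_of_cls_eq (hU : IsPreconnected (U : Set M)) (hh : IsParallel cov h)
    {g : Metric n M} (hg : IsParallel cov g) {x : M} (hx : x ∈ U) {i j : Fin n}
    (hij : F.cls i = F.cls j) :
    g.inner x (F.Y i x) (F.Y i x) = g.inner x (F.Y j x) (F.Y j x) := by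
  have hrel : Relation.EqvGen (fun i j ↦ ∃ y ∈ U, ∃ v, F.connectionForm i j y v ≠ 0) i j :=
    Quotient.exact hij
  induction hrel with
  | rel i j hr =>
    obtain ⟨y, hy, v, hv⟩ := hr
    rw [F.inner_self_eq_of_mem hU hh hg hx hy i, F.inner_self_eq_of_mem hU hh hg hx hy j]
    by_cases hne : i = j
    · rw [hne]
    have h1 := hg y _ _ (F.diffAt_Y i hy) (F.diffAt_Y j hy) v
    have h2 : (fun z ↦ g.inner z (F.Y i z) (F.Y j z)) =ᶠ[nhds y] fun _ ↦ 0 := by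
      filter_upwards [U.isOpen.mem_nhds hy] with z hz using F.inner_eq_zero hh hg hz hne
    rw [mvfderiv_eq_zero_of_eventuallyEq h2, g.symm y (F.Y i y), F.inner_eq hh hg hy j,
      F.inner_eq hh hg hy i] at h1
    have h3 := F.connectionForm_antisymm hh j i hy v
    simp only [connectionForm] at h3 hv
    rw [h3, zero_apply] at h1
    have h4 : h.inner y (cov (F.Y j) y v) (F.Y i y) *
      (g.inner y (F.Y i y) (F.Y i y) - g.inner y (F.Y j y) (F.Y j y)) = 0 := by linarith
    exact sub_eq_zero.1 ((mul_eq_zero.1 h4).resolve_left hv)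
  | refl => rfl
  | symm _ _ h' ih => exact (ih (Quotient.sound h')).symm
  | trans _ _ _ h1 h2 ih1 ih2 => exact (ih1 (Quotient.sound h1)).trans (ih2 (Quotient.sound h2))

/-- On the subbundle of a class, a parallel metric is a multiple of `h`. -/
lemma inner_eq_of_mem_localBundle (hU : IsPreconnected (U : Set M)) (hh : IsParallel cov h)
    {g : Metric n M} (hg : IsParallel cov g) {x : M} (hx : x ∈ U) {j : Fin n}
    {v : TangentSpace (𝓡 n) x} (hv : v ∈ F.localBundle (F.cls j) x) (w : TangentSpace (𝓡 n) x) :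
    g.inner x w v = g.inner x (F.Y j x) (F.Y j x) * h.inner x w v := by
  induction hv using Submodule.span_induction with
  | mem v hv =>
    obtain ⟨k, hk, rfl⟩ := hv
    rw [F.inner_eq hh hg hx, F.inner_self_eq_of_cls_eq hU hh hg hx hk]
  | zero => simp
  | add v v' _ _ h1 h2 => rw [map_add, map_add, h1, h2, mul_add]
  | smul r v _ h1 => rw [map_smul, map_smul, h1, smul_eq_mul, smul_eq_mul]; ring

end AdaptedFrame

namespace AdaptedCover

variable {D : AdaptedCover cov h}

/-- A parallel metric is a constant multiple of `h` on each block. -/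
lemma exists_inner_self_eq (hh : IsParallel cov h) {g : Metric n M} (hg : IsParallel cov g) :
    ∃ d : D.Block → ℝ, ∀ (U : D.cover) (x : M), x ∈ (U : Opens M) → ∀ j,
      g.inner x ((D.frame U).Y j x) ((D.frame U).Y j x) = d (D.blk U j) := by
  have pre : ∀ U : D.cover, IsPreconnected ((U : Opens M) : Set M) := fun U ↦
    (D.connected U U.2).isPreconnected
  -- The multiple attached to a local index is computed at one base point and one representative;
  -- `key` shows that the point does not matter.
  choose pt hpt using fun U : D.cover ↦ (D.connected U U.2).nonempty
  choose rep hrep using fun a : D.LocalIndex ↦ D.exists_cls_eq a.2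
  set δ : D.LocalIndex → ℝ := fun a ↦
    g.inner (pt a.1) ((D.frame a.1).Y (rep a) (pt a.1)) ((D.frame a.1).Y (rep a) (pt a.1)) with hδ
  have key : ∀ (a : D.LocalIndex) (x : M), x ∈ (a.1 : Opens M) →
      g.inner x ((D.frame a.1).Y (rep a) x) ((D.frame a.1).Y (rep a) x) = δ a := fun a x hx ↦
    (D.frame a.1).inner_self_eq_of_mem (pre a.1) hh hg hx (hpt a.1) _
  have hlift : ∀ a b : D.LocalIndex, D.blockSetoid a b → δ a = δ b := by
    intro a b hab
    induction hab with
    | rel a b hr =>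
      obtain ⟨x, hxa, hxb, hne⟩ := hr
      obtain ⟨v, ⟨hva, hvb⟩, hv⟩ := (Submodule.ne_bot_iff _).1 hne
      rw [SetLike.mem_coe, ← hrep a] at hva
      rw [SetLike.mem_coe, ← hrep b] at hvb
      have h1 := (D.frame a.1).inner_eq_of_mem_localBundle (pre a.1) hh hg hxa hva v
      have h2 := (D.frame b.1).inner_eq_of_mem_localBundle (pre b.1) hh hg hxb hvb v
      rw [← key a x hxa, ← key b x hxb]
      -- For a nonzero common vector `v`, both multiples equal `g(v, v) / h(v, v)`.
      exact mul_right_cancel₀ (h.pos x v hv).ne' (h1.symm.trans h2)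
    | refl => rfl
    | symm _ _ _ ih => exact ih.symm
    | trans _ _ _ _ _ ih1 ih2 => exact ih1.trans ih2
  refine ⟨Quotient.lift δ hlift, fun U x hx j ↦ ?_⟩
  change _ = δ ⟨U, (D.frame U).cls j⟩
  rw [← key ⟨U, (D.frame U).cls j⟩ x hx]
  exact (D.frame U).inner_self_eq_of_cls_eq (pre U) hh hg hx (hrep ⟨U, (D.frame U).cls j⟩).symm

lemma exists_blockTensor_eq [ConnectedSpace M] (hh : IsParallel cov h) {g : Metric n M}
    (hg : IsParallel cov g) :
    ∃ c : D.Block → ℝ, (∀ a, 0 < c a) ∧ contravariant g = D.blockTensor c := by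
  obtain ⟨d, hd⟩ := exists_inner_self_eq (D := D) hh hg
  -- Passing to the contravariant tensor inverts the diagonal entries.
  refine ⟨fun a ↦ (d a)⁻¹, fun a ↦ inv_pos.2 ?_, ?_⟩
  · obtain ⟨U, hU, hx⟩ := D.covers (Classical.arbitrary M)
    obtain ⟨j, rfl⟩ := blk_surjective hh ⟨U, hU⟩ a
    rw [← hd ⟨U, hU⟩ _ hx]
    exact g.pos _ _ ((D.frame ⟨U, hU⟩).Y_ne_zero j hx)
  · funext x
    obtain ⟨U, hU, hx⟩ := D.covers x
    rw [blockTensor_eq hh _ (U := ⟨U, hU⟩) hx, (D.frame ⟨U, hU⟩).contravariant_eq hx g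
      fun i j hij ↦ (D.frame ⟨U, hU⟩).inner_eq_zero hh hg hx hij]
    congr 1
    funext j
    rw [hd ⟨U, hU⟩ x hx]

/-- The metric with prescribed multiples of `h` on the blocks. -/
def blockForm (D : AdaptedCover cov h) (c : D.Block → ℝ) (x : M) :
    TangentSpace (𝓡 n) x →L[ℝ] Cotangent n x :=
  letI U : D.cover := ⟨(D.covers x).choose, (D.covers x).choose_spec.1⟩
  LinearMap.toContinuousBilinearMap
    (diagForm (form h x) (fun j ↦ (D.frame U).Y j x) fun j ↦ c (D.blk U j))

/-- The form is the block tensor evaluated on metric duals, so it inherits independence of the frame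
from `diagTensor_blk_eq`. -/
lemma blockForm_apply (hh : IsParallel cov h) (c : D.Block → ℝ) {U : D.cover} {x : M}
    (hx : x ∈ (U : Opens M)) (v w : TangentSpace (𝓡 n) x) : D.blockForm c x v w =
      ∑ j, c (D.blk U j) * (h.inner x v ((D.frame U).Y j x) * h.inner x w ((D.frame U).Y j x)) := by
  have := congr($(diagTensor_blk_eq hh c hx (D.covers x).choose_spec.2
    (V := ⟨(D.covers x).choose, (D.covers x).choose_spec.1⟩)) (h.inner x v) (h.inner x w))
  exact this.symm

lemma blockForm_eq (hh : IsParallel cov h) (c : D.Block → ℝ) {U : D.cover} {x : M}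
    (hx : x ∈ (U : Opens M)) : D.blockForm c x = ∑ j, c (D.blk U j) •
      (h.inner x ((D.frame U).Y j x)).smulRight (h.inner x ((D.frame U).Y j x)) := by
  ext v w
  rw [blockForm_apply hh c hx]
  simp [sum_apply, h.symm x ((D.frame U).Y _ x)]

lemma blockForm_Y (hh : IsParallel cov h) (c : D.Block → ℝ) {U : D.cover} {x : M}
    (hx : x ∈ (U : Opens M)) (i j : Fin n) :
    D.blockForm c x ((D.frame U).Y i x) ((D.frame U).Y j x) =
      if i = j then c (D.blk U i) else 0 := by
  rw [blockForm_apply hh c hx, Finset.sum_eq_single i]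
  · by_cases hij : i = j
    · simp [hij, (D.frame U).orthonormal x hx]
    · simp [hij, Ne.symm hij, (D.frame U).orthonormal x hx]
  · intro k _ hk
    simp [(D.frame U).orthonormal x hx, hk.symm]
  · simp

/-- The block form dominates a positive multiple of `h`, so its unit ball lies in a dilate of the
bounded unit ball of `h`. -/
lemma isVonNBounded_blockForm (hh : IsParallel cov h) {c : D.Block → ℝ} (hc : ∀ a, 0 < c a)
    (x : M) : Bornology.IsVonNBounded ℝ {v : TangentSpace (𝓡 n) x | D.blockForm c x v v < 1} := by
  obtain ⟨U, hU, hx⟩ := D.covers x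
  set F := D.frame ⟨U, hU⟩
  obtain ⟨K, hK⟩ : ∃ K : ℝ, ∀ j, 1 ≤ K * c (D.blk ⟨U, hU⟩ j) := by
    obtain ⟨K, hK⟩ := (Set.finite_range fun j ↦ (c (D.blk ⟨U, hU⟩ j))⁻¹).bddAbove
    refine ⟨K, fun j ↦ ?_⟩
    rw [← div_le_iff₀ (hc _), one_div]
    exact hK ⟨j, rfl⟩
  -- `K` bounds the inverse coefficients. The maximum with `1` keeps the factor positive even when
  -- there are no indices.
  have hle : ∀ v, h.inner x v v ≤ max K 1 * D.blockForm c x v v := by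
    intro v
    rw [blockForm_apply hh c (U := ⟨U, hU⟩) hx, F.cotangent_apply hx, Finset.mul_sum]
    refine Finset.sum_le_sum fun j _ ↦ ?_
    have h1 : 1 ≤ max K 1 * c (D.blk ⟨U, hU⟩ j) :=
      (hK j).trans (mul_le_mul_of_nonneg_right (le_max_left _ _) (hc _).le)
    nlinarith [mul_self_nonneg (h.inner x v (F.Y j x))]
  have hpos : 0 < max K 1 := lt_max_of_lt_right one_pos
  refine ((h.isVonNBounded x).image
    (Real.sqrt (max K 1) • ContinuousLinearMap.id ℝ (TangentSpace (𝓡 n) x))).subset ?_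
  intro v hv
  have hs : Real.sqrt (max K 1) ≠ 0 := (Real.sqrt_pos.2 hpos).ne'
  refine ⟨(Real.sqrt (max K 1))⁻¹ • v, ?_, by simp [smul_smul, hs]⟩
  simp only [Set.mem_ofPred_eq, map_smul, smul_apply, smul_eq_mul] at hv ⊢
  have h1 := hle v
  have h2 := Real.mul_self_sqrt hpos.le
  have h3 : (Real.sqrt (max K 1))⁻¹ * ((Real.sqrt (max K 1))⁻¹ * h.inner x v v) =
      h.inner x v v / max K 1 := by
    rw [← h2]; field_simp; simp [pow_two]
  rw [h3, div_lt_one hpos]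
  nlinarith

/-- The metric with prescribed positive multiples of `h` on the blocks. -/
def blockMetric (D : AdaptedCover cov h) (hh : IsParallel cov h) {c : D.Block → ℝ}
    (hc : ∀ a, 0 < c a) : Metric n M where
  inner := D.blockForm c
  symm x v w := diagForm_comm _ v w
  pos x v hv := by
    obtain ⟨U, hU, hx⟩ := D.covers x
    rw [blockForm_apply hh c (U := ⟨U, hU⟩) hx]
    refine Finset.sum_pos' (fun j _ ↦ mul_nonneg (hc _).le (mul_self_nonneg _)) ?_
    by_contra! hcon
    refine hv (eq_zero_of_orthonormal (B := form h x) ((D.frame ⟨U, hU⟩).orthonormal x hx)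
      (finrank_tangentSpace x) v fun j ↦ ?_)
    by_contra hne
    exact absurd (hcon j (Finset.mem_univ _)) (mul_pos (hc _) (mul_self_pos.2 hne)).not_ge
  isVonNBounded := isVonNBounded_blockForm hh hc
  contMDiff x := by
    obtain ⟨U, hU, hx⟩ := D.covers x
    have hsum := ContMDiffAt.sum_section (s := Finset.univ) (x₀ := x)
      (t := fun j y ↦ c (D.blk ⟨U, hU⟩ j) • (h.inner y ((D.frame ⟨U, hU⟩).Y j y)).smulRight
        (h.inner y ((D.frame ⟨U, hU⟩).Y j y)))
      fun j _ ↦ ContMDiffAt.const_smul_section (contMDiffAt_smulRight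
        (ContMDiffAt.inner_left h U.isOpen hx ((D.frame ⟨U, hU⟩).smooth_Y j)))
    refine hsum.congr_of_eventuallyEq ?_
    filter_upwards [U.isOpen.mem_nhds hx] with y hy
    rw [blockForm_eq hh c (U := ⟨U, hU⟩) hy]

lemma blockMetric_inner (hh : IsParallel cov h) {c : D.Block → ℝ} (hc : ∀ a, 0 < c a) (x : M) :
    (D.blockMetric hh hc).inner x = D.blockForm c x := rfl

/-- The Leibniz rule in the frame yields the required terms plus a sum of connection-form terms,
which is zero by `sum_antisymm_eq_zero` because `c` agrees on indices linked by a nonzero `ω^i_j`.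
-/
lemma isParallel_blockMetric (hh : IsParallel cov h) {c : D.Block → ℝ} (hc : ∀ a, 0 < c a) :
    IsParallel cov (D.blockMetric hh hc) := by
  intro x σ τ hσ hτ v
  obtain ⟨U, hU, hx⟩ := D.covers x
  set F := D.frame ⟨U, hU⟩ with hF
  set C : Fin n → ℝ := fun j ↦ c (D.blk ⟨U, hU⟩ j) with hC
  have hev : (fun y ↦ (D.blockMetric hh hc).inner y (σ y) (τ y)) =ᶠ[nhds x] fun y ↦
      ∑ j, C j * (h.inner y (σ y) (F.Y j y) * h.inner y (τ y) (F.Y j y)) := by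
    filter_upwards [U.isOpen.mem_nhds hx] with y hy
    exact blockForm_apply hh c (U := ⟨U, hU⟩) hy _ _
  have hderiv : ∀ ρ : ∀ y : M, TangentSpace (𝓡 n) y, DiffAt ρ x → ∀ j,
      mvfderiv (𝓡 n) (fun y ↦ h.inner y (ρ y) (F.Y j y)) x v =
        h.inner x (cov ρ x v) (F.Y j x) + ∑ i, F.connectionForm i j x v * h.inner x (ρ x) (F.Y i x) := by
    intro ρ hρ j
    rw [hh x ρ (F.Y j) hρ (F.diffAt_Y j hx) v]
    congr 1
    rw [F.cov_Y_eq_sum j hx, map_sum]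
    simp
  have hd : ∀ ρ : ∀ y : M, TangentSpace (𝓡 n) y, DiffAt ρ x → ∀ j,
      MDifferentiableAt (𝓡 n) 𝓘(ℝ) (fun y ↦ h.inner y (ρ y) (F.Y j y)) x := fun ρ hρ j ↦
    hρ.inner h (F.diffAt_Y j hx)
  have hmv : mvfderiv (𝓡 n) (fun y ↦ (D.blockMetric hh hc).inner y (σ y) (τ y)) x v =
      mvfderiv (𝓡 n) (fun y ↦
        ∑ j, C j * (h.inner y (σ y) (F.Y j y) * h.inner y (τ y) (F.Y j y))) x v := by
    have := hev.mfderiv_eq (I := 𝓡 n) (I' := 𝓘(ℝ))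
    exact congr($this v)
  have hprod : ∀ j, MDifferentiableAt (𝓡 n) 𝓘(ℝ)
      (fun y ↦ h.inner y (σ y) (F.Y j y) * h.inner y (τ y) (F.Y j y)) x :=
    fun j ↦ (hd σ hσ j).mul (hd τ hτ j)
  have hCprod : ∀ j, MDifferentiableAt (𝓡 n) 𝓘(ℝ)
      (fun y ↦ C j * (h.inner y (σ y) (F.Y j y) * h.inner y (τ y) (F.Y j y))) x :=
    fun j ↦ mdifferentiableAt_const.mul (hprod j)
  rw [hmv, (mvfderiv_sum Finset.univ hCprod).2, sum_apply]
  rw [blockMetric_inner, blockForm_apply hh c (U := ⟨U, hU⟩) hx,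
    blockForm_apply hh c (U := ⟨U, hU⟩) hx]
  have hzero := sum_antisymm_eq_zero (c := C) (s := fun i ↦ h.inner x (σ x) (F.Y i x))
    (t := fun i ↦ h.inner x (τ x) (F.Y i x)) (a := fun i j ↦ F.connectionForm i j x v)
    (fun i j ↦ F.connectionForm_antisymm hh i j hx v) (fun i j hij ↦ by
      simp only [hC, blk]
      rw [F.cls_eq_of_connectionForm_ne hx hij])
  -- The vanishing sum is added to the right side so that the identity can be checked index by
  -- index.
  rw [← add_zero (_ + _), ← hzero, ← Finset.sum_add_distrib, ← Finset.sum_add_distrib]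
  refine Finset.sum_congr rfl fun j _ ↦ ?_
  have h1 := mvfderiv_fun_mul (mdifferentiableAt_const (c := C j)) (hprod j)
  have h2 := mvfderiv_fun_mul (hd σ hσ j) (hd τ hτ j)
  have h3 := congr($h1 v)
  have h4 := congr($h2 v)
  simp only [mvfderiv_const, add_apply, smul_apply, smul_eq_mul, zero_apply, hderiv σ hσ,
    hderiv τ hτ] at h3 h4
  refine h3.trans ?_
  change C j * mvfderiv (𝓡 n) (fun y ↦ h.inner y (σ y) (F.Y j y) * h.inner y (τ y) (F.Y j y)) x v + _ = _
  rw [h4]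
  ring

lemma contravariant_blockMetric (hh : IsParallel cov h) {c : D.Block → ℝ} (hc : ∀ a, 0 < c a) :
    contravariant (D.blockMetric hh hc) = D.blockTensor fun a ↦ (c a)⁻¹ := by
  funext x
  obtain ⟨U, hU, hx⟩ := D.covers x
  rw [blockTensor_eq hh _ (U := ⟨U, hU⟩) hx, (D.frame ⟨U, hU⟩).contravariant_eq hx]
  · simp only [blockMetric_inner, blockForm_Y hh c (U := ⟨U, hU⟩) hx, if_true]
  · intro i j hij
    rw [blockMetric_inner, blockForm_Y hh c (U := ⟨U, hU⟩) hx, if_neg hij]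

lemma parallelMetrics_eq [ConnectedSpace M] (hh : IsParallel cov h) :
    parallelMetrics cov = {t | ∃ c : D.Block → ℝ, (∀ a, 0 < c a) ∧ t = D.blockTensor c} := by
  ext t
  constructor
  · rintro ⟨g, hg, rfl⟩
    exact exists_blockTensor_eq hh hg
  · rintro ⟨c, hc, rfl⟩
    have hc' : ∀ a, 0 < (c a)⁻¹ := fun a ↦ inv_pos.2 (hc a)
    refine ⟨D.blockMetric hh hc', isParallel_blockMetric hh hc', ?_⟩
    rw [contravariant_blockMetric]
    simp

end AdaptedCover

end ParallelMetric

/-- A set in a topological vector space parametrized linearly by the positive orthant, with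
continuous coordinates, is a manifold diffeomorphic to the orthant. -/
lemma exists_diffeomorph_orthant {A : ℕ} {V : Type*} [TopologicalSpace V] [AddCommGroup V]
    [Module ℝ V] [IsTopologicalAddGroup V] [ContinuousSMul ℝ V] (t : Fin A → V)
    (f : Fin A → V → ℝ) (hf : ∀ a, Continuous (f a))
    (hft : ∀ (c : Fin A → ℝ) a, f a (∑ b, c b • t b) = c a) {S : Set V}
    (hS : S = {v | ∃ c : Fin A → ℝ, (∀ a, 0 < c a) ∧ v = ∑ a, c a • t a}) :
    ∃ _ : ChartedSpace (EuclideanSpace ℝ (Fin A)) S, IsManifold (𝓡 A) ∞ S ∧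
      ∃ Φ : Diffeomorph (𝓡 A) (𝓡 A) (orthant A) S ∞,
        ∀ c : orthant A, (Φ c : V) = ∑ a, (c : EuclideanSpace ℝ (Fin A)) a • t a := by
  have hmem : ∀ c : orthant A, ∑ a, (c : EuclideanSpace ℝ (Fin A)) a • t a ∈ S := fun c ↦
    hS ▸ ⟨fun a ↦ (c : EuclideanSpace ℝ (Fin A)) a, c.2, rfl⟩
  have hinv : ∀ v ∈ S, (∀ a, 0 < f a v) ∧ ∑ a, f a v • t a = v := by
    intro v hv
    rw [hS] at hv
    obtain ⟨c, hc, rfl⟩ := hv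
    simpa only [hft, and_true] using hc
  let e : S ≃ₜ orthant A :=
    { toFun v := ⟨WithLp.toLp 2 fun a ↦ f a v, (hinv v v.2).1⟩
      invFun c := ⟨∑ a, (c : EuclideanSpace ℝ (Fin A)) a • t a, hmem c⟩
      left_inv v := Subtype.ext (hinv v v.2).2
      right_inv c := by
        ext a
        exact hft (fun b ↦ (c : EuclideanSpace ℝ (Fin A)) b) a
      continuous_toFun := by
        refine Continuous.subtype_mk ?_ _
        exact (PiLp.continuous_toLp 2 _).comp
          (continuous_pi fun a ↦ (hf a).comp continuous_subtype_val)
      continuous_invFun := by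
        refine Continuous.subtype_mk ?_ _
        refine continuous_finsetSum _ fun a _ ↦ Continuous.smul ?_ continuous_const
        fun_prop }
  -- The coordinates embed `S` as an open subset of `ℝ^A`. This single chart defines the manifold
  -- structure, and in it the parametrization is the inclusion of the orthant.
  have he : Topology.IsOpenEmbedding fun v ↦ (e v : EuclideanSpace ℝ (Fin A)) :=
    (orthant A).isOpen.isOpenEmbedding_subtypeVal.comp e.isOpenEmbedding
  have : Nonempty S := ⟨⟨_, hmem ⟨WithLp.toLp 2 fun _ ↦ 1, fun _ ↦ one_pos⟩⟩⟩
  let _ := he.singletonChartedSpace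
  refine ⟨he.singletonChartedSpace, he.isManifold_singleton,
    ⟨e.symm.toEquiv, ?_, ?_⟩, fun c ↦ rfl⟩
  · refine ContMDiff.of_comp_isOpenEmbedding he ?_
    exact contMDiff_subtype_val.congr fun c ↦ by simp
  · exact (ContMDiff.subtypeVal_comp_iff _ _).1 (contMDiff_isOpenEmbedding he)

/-! ### The cone of parallel metrics. -/

section

variable {n : ℕ} {M : Type*} [TopologicalSpace M] [ChartedSpace (EuclideanSpace ℝ (Fin n)) M]
  [IsManifold (𝓡 n) ∞ M] [T2Space M] [ConnectedSpace M] {cov : Connection n M}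
  [CovariantDerivative.ContMDiffCovariantDerivative cov ∞] {h : Metric n M}

namespace AdaptedCover

variable (D : AdaptedCover cov h)

open Classical in
lemma exists_cone (hh : IsParallel cov h) :
    ∃ (e : Fin D.numBlocks ≃ D.Block) (ht : Fin D.numBlocks → CoTensor n M),
      (∀ a t, D.IsBlockTensor (e a) t ↔ t = ht a) ∧ LinearIndependent ℝ ht ∧
      parallelMetrics cov = {t | ∃ c : Fin D.numBlocks → ℝ, (∀ a, 0 < c a) ∧ t = ∑ a, c a • ht a} ∧
      ∃ _ : ChartedSpace (EuclideanSpace ℝ (Fin D.numBlocks)) (parallelMetrics cov),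
        IsManifold (𝓡 D.numBlocks) ∞ (parallelMetrics cov) ∧
        ∃ Φ : Diffeomorph (𝓡 D.numBlocks) (𝓡 D.numBlocks) (orthant D.numBlocks)
            (parallelMetrics cov) ∞, ∀ c : orthant D.numBlocks, (Φ c : CoTensor n M) =
              ∑ a, (c : EuclideanSpace ℝ (Fin D.numBlocks)) a • ht a := by
  have := D.finite_block hh
  have := Fintype.ofFinite D.Block
  let e : Fin D.numBlocks ≃ D.Block := (Finite.equivFin _).symm
  have hsum (c : Fin D.numBlocks → ℝ) :
      ∑ a, c a • D.blockTensor (Pi.single (e a) 1) = D.blockTensor (c ∘ e.symm) := by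
    rw [← D.sum_smul_blockTensor, ← e.sum_comp]
    simp
  obtain ⟨x⟩ : Nonempty M := inferInstance
  obtain ⟨U, hU, hx⟩ := D.covers x
  choose j hj using D.blk_surjective hh ⟨U, hU⟩
  -- All coefficients are read off at one point `x`, using one frame vector from each block; this is
  -- possible because a single `U` carries every block.
  let f (a : Fin D.numBlocks) (t : CoTensor n M) : ℝ :=
    t x (h.inner x ((D.frame ⟨U, hU⟩).Y (j (e a)) x)) (h.inner x ((D.frame ⟨U, hU⟩).Y (j (e a)) x))
  have hft (c : Fin D.numBlocks → ℝ) (a) :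
      f a (∑ b, c b • D.blockTensor (Pi.single (e b) 1)) = c a := by
    rw [hsum]
    exact (D.blockTensor_apply_inner hh _ hx _).trans (by simp [hj])
  have hf (a) : Continuous (f a) := by
    have h1 : Continuous fun t : CoTensor n M ↦ t x := continuous_apply x
    exact (continuous_eval_const (F := Cotangent n x →L[ℝ] ℝ) _).comp
      ((continuous_eval_const (F := CoTensorAt n x) _).comp h1)
  have hset : parallelMetrics cov = {t | ∃ c : Fin D.numBlocks → ℝ, (∀ a, 0 < c a) ∧
      t = ∑ a, c a • D.blockTensor (Pi.single (e a) 1)} := by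
    rw [D.parallelMetrics_eq hh]
    ext t
    constructor
    · rintro ⟨c, hc, rfl⟩
      refine ⟨c ∘ e, fun a ↦ hc _, ?_⟩
      rw [hsum, Function.comp_assoc, e.self_comp_symm, Function.comp_id]
    · rintro ⟨c, hc, rfl⟩
      exact ⟨c ∘ e.symm, fun a ↦ hc _, hsum c⟩
  refine ⟨e, fun a ↦ D.blockTensor (Pi.single (e a) 1), fun a t ↦ D.isBlockTensor_iff hh _ t, ?_,
    hset, exists_diffeomorph_orthant _ f hf hft hset⟩
  rw [Fintype.linearIndependent_iff]
  intro c hc a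
  have h1 := hft c a
  rw [hc] at h1
  exact h1.symm

end AdaptedCover

end

/-! ### Smooth dependence of simple eigenvectors on the operator. -/

section Eigenvectors

/-- Eigenvalues of an endomorphism with as many eigenvalues as the dimension are simple. -/
lemma eq_smul_of_ncard_eigenvalues {K V : Type*} [Field K] [AddCommGroup V] [Module K V]
    [FiniteDimensional K V] {f : Module.End K V}
    (hf : {μ | f.HasEigenvalue μ}.ncard = Module.finrank K V) {μ₀ ν : K} {v w : V}
    (hv : f.HasEigenvector μ₀ v) (hw : f w - μ₀ • w = ν • v) : ν = 0 ∧ ∃ c : K, w = c • v := by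
  classical
  set S := {μ | f.HasEigenvalue μ} with hS
  have hμ₀ : μ₀ ∈ S := Module.End.hasEigenvalue_of_hasEigenvector hv
  have : Finite S := inferInstanceAs (Finite f.Eigenvalues)
  have := Fintype.ofFinite S
  choose x hx using fun μ : S ↦ Module.End.HasEigenvalue.exists_hasEigenvector μ.2
  -- An eigenbasis in which `v` itself is the member for `μ₀`. In its coordinates the equation for
  -- `w` reads `(μ - μ₀) w_μ = ν` at `μ = μ₀` and `(μ - μ₀) w_μ = 0` elsewhere.
  let y : S → V := Function.update x ⟨μ₀, hμ₀⟩ v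
  have hy₀ : y ⟨μ₀, hμ₀⟩ = v := Function.update_self ..
  have hy : ∀ μ : S, f.HasEigenvector μ (y μ) := fun μ ↦ by
    by_cases h : μ = ⟨μ₀, hμ₀⟩
    · rw [h, hy₀]; exact hv
    · simpa only [y, Function.update_of_ne h] using hx μ
  let b := basisOfLinearIndependentOfCardEqFinrank' y
    (f.eigenvectors_linearIndependent S y hy) (by
      rw [← hf, Set.ncard_eq_toFinset_card', Set.toFinset_card])
  have hby : ∀ μ, b μ = y μ := fun μ ↦ by simp [b]
  have key : ∀ μ : S, (μ - μ₀) * b.repr w μ = if μ = ⟨μ₀, hμ₀⟩ then ν else 0 := fun μ ↦ by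
    have h1 : f w = ∑ μ : S, ((μ : K) * b.repr w μ) • b μ := by
      conv_lhs => rw [← b.sum_repr w]
      rw [map_sum]
      refine Finset.sum_congr rfl fun μ _ ↦ ?_
      rw [map_smul, hby, (hy μ).apply_eq_smul, smul_smul, mul_comm]
    have h2 : b.repr (f w) μ = μ * b.repr w μ := by
      rw [h1, b.repr_sum_self]
    have h3 := congr(b.repr $hw μ)
    rw [← hy₀, ← hby] at h3
    simp only [map_sub, map_smul, Finsupp.sub_apply, Finsupp.smul_apply, h2, b.repr_self,
      smul_eq_mul] at h3
    rw [sub_mul, h3, Finsupp.single_apply]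
    simp [eq_comm]
  refine ⟨by simpa using (key ⟨μ₀, hμ₀⟩).symm, b.repr w ⟨μ₀, hμ₀⟩, ?_⟩
  conv_lhs => rw [← b.sum_repr w]
  rw [Finset.sum_eq_single ⟨μ₀, hμ₀⟩]
  · rw [hby, hy₀]
  · intro μ _ hμ
    have h1 := key μ
    rw [if_neg hμ] at h1
    rw [(mul_eq_zero.1 h1).resolve_left (sub_ne_zero.2 fun h ↦ hμ (Subtype.ext h)), zero_smul]
  · simp

/-- A simple eigenvalue and its eigenvector depend smoothly on the operator. -/
lemma exists_eigenvector_family {𝕜 F : Type*} [RCLike 𝕜] [NormedAddCommGroup F]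
    [NormedSpace 𝕜 F] [FiniteDimensional 𝕜 F] {A₀ : F →L[𝕜] F} {v₀ : F} {μ₀ : 𝕜}
    (h₀ : A₀ v₀ = μ₀ • v₀) (hv₀ : v₀ ≠ 0)
    (simple : ∀ (w : F) (ν : 𝕜), A₀ w - μ₀ • w = ν • v₀ → ν = 0 ∧ ∃ c : 𝕜, w = c • v₀) :
    ∃ (v : (F →L[𝕜] F) → F) (μ : (F →L[𝕜] F) → 𝕜), v A₀ = v₀ ∧ μ A₀ = μ₀ ∧
      ∀ᶠ A in nhds A₀, A (v A) = μ A • v A ∧ ContDiffAt 𝕜 ω v A ∧ ContDiffAt 𝕜 ω μ A := by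
  have : CompleteSpace F := FiniteDimensional.complete 𝕜 F
  obtain ⟨l, hl⟩ := SeparatingDual.exists_eq_one (R := 𝕜) hv₀
  -- The eigenvector equation together with the normalization `l v = 1`. Keeping `A` as a component
  -- turns the implicit function problem into an inverse function problem.
  let g : (F →L[𝕜] F) × F × 𝕜 → (F →L[𝕜] F) × F × 𝕜 := fun z ↦
    (z.1, z.1 z.2.1 - z.2.2 • z.2.1, l z.2.1)
  let z₀ : (F →L[𝕜] F) × F × 𝕜 := (A₀, v₀, μ₀)
  have hg : ContDiff 𝕜 ω g :=
    contDiff_fst.prodMk (((contDiff_fst.clm_apply (contDiff_fst.comp contDiff_snd)).sub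
      ((contDiff_snd.comp contDiff_snd).smul (contDiff_fst.comp contDiff_snd))).prodMk
      (l.contDiff.comp (contDiff_fst.comp contDiff_snd)))
  let P := ContinuousLinearMap.fst 𝕜 (F →L[𝕜] F) (F × 𝕜)
  let Q := (ContinuousLinearMap.fst 𝕜 F 𝕜).comp (ContinuousLinearMap.snd 𝕜 (F →L[𝕜] F) (F × 𝕜))
  let R := (ContinuousLinearMap.snd 𝕜 F 𝕜).comp (ContinuousLinearMap.snd 𝕜 (F →L[𝕜] F) (F × 𝕜))
  have hder : HasFDerivAt g (P.prod (((A₀.comp Q + P.flip v₀) -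
      (μ₀ • Q + R.smulRight v₀)).prod (l.comp Q))) z₀ :=
    P.hasFDerivAt.prodMk (((P.hasFDerivAt (x := z₀)).clm_apply (Q.hasFDerivAt (x := z₀))).sub
      ((R.hasFDerivAt (x := z₀)).smul (Q.hasFDerivAt (x := z₀))) |>.prodMk
      (l.hasFDerivAt.comp z₀ Q.hasFDerivAt))
  set L := P.prod (((A₀.comp Q + P.flip v₀) - (μ₀ • Q + R.smulRight v₀)).prod (l.comp Q)) with hL
  -- A kernel vector satisfies `A₀ w - μ₀ w = ν v₀` and `l w = 0`. Simplicity gives `ν = 0` and `w =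
  -- c v₀`, and the normalization gives `c = 0`.
  have hinj : Function.Injective L := by
    refine (injective_iff_map_eq_zero L).2 fun ⟨a, w, ν⟩ hz ↦ ?_
    simp only [hL, P, Q, R, ContinuousLinearMap.prod_apply, Prod.mk_eq_zero] at hz
    obtain ⟨h1, h2, h3⟩ := hz
    have ha : a = 0 := h1
    subst ha
    have h4 : A₀ w - μ₀ • w = ν • v₀ := by
      simpa [sub_add_eq_sub_sub, sub_eq_zero] using h2
    obtain ⟨rfl, c, rfl⟩ := simple w ν h4
    have h5 : c = 0 := by simpa [hl] using h3
    simp [h5]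
  let e : ((F →L[𝕜] F) × F × 𝕜) ≃L[𝕜] ((F →L[𝕜] F) × F × 𝕜) :=
    (LinearEquiv.ofInjectiveEndo L.toLinearMap hinj).toContinuousLinearEquiv
  have hder' : HasFDerivAt g (e : ((F →L[𝕜] F) × F × 𝕜) →L[𝕜] _) z₀ := by
    convert hder using 1
    exact ContinuousLinearMap.ext fun z ↦ rfl
  have hne : (ω : WithTop ℕ∞) ≠ 0 := by simp
  set G := (hg.contDiffAt (x := z₀)).localInverse hder' hne with hG
  have hgz : g z₀ = (A₀, 0, 1) := by simp [g, z₀, h₀, hl]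
  have hGz : G (A₀, 0, 1) = z₀ := hgz ▸ hg.contDiffAt.localInverse_apply_image hder' hne
  have hGd : ContDiffAt 𝕜 ω G (A₀, 0, 1) := hgz ▸ hg.contDiffAt.to_localInverse hder' hne
  have hGr : ∀ᶠ z in nhds (A₀, (0 : F), (1 : 𝕜)), g (G z) = z := hgz ▸
    (hg.contDiffAt.hasStrictFDerivAt' hder' hne).eventually_right_inverse
  have hι : ContDiff 𝕜 ω fun A : F →L[𝕜] F ↦ (A, (0 : F), (1 : 𝕜)) :=
    contDiff_id.prodMk contDiff_const
  refine ⟨fun A ↦ (G (A, 0, 1)).2.1, fun A ↦ (G (A, 0, 1)).2.2, by simp [hGz, z₀],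
    by simp [hGz, z₀], ?_⟩
  -- The regularity `ω` matters here: it passes from a point to a neighbourhood, whereas
  -- `ContDiffAt` of order `∞` at a point does not.
  filter_upwards [hι.continuous.continuousAt.eventually hGr,
    hι.continuous.continuousAt.eventually (hGd.eventually (by simp))] with A hA hA'
  have h1 : (G (A, 0, 1)).1 = A := congr_arg Prod.fst hA
  have h2 : (G (A, 0, 1)).1 (G (A, 0, 1)).2.1 - (G (A, 0, 1)).2.2 • (G (A, 0, 1)).2.1 = 0 :=
    congr_arg (fun z ↦ z.2.1) hA
  rw [h1, sub_eq_zero] at h2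
  have h3 := hA'.comp A hι.contDiffAt
  exact ⟨h2, contDiffAt_fst.comp A (contDiffAt_snd.comp A h3),
    contDiffAt_snd.comp A (contDiffAt_snd.comp A h3)⟩

/-- The operator on `𝕜^n` given by a real matrix. -/
def matrixOperator {n : ℕ} (𝕜 : Type*) [RCLike 𝕜] (a : Fin n → Fin n → ℝ) :
    (Fin n → 𝕜) →L[𝕜] (Fin n → 𝕜) :=
  ∑ i, ∑ j, a i j • (ContinuousLinearMap.proj (R := 𝕜) (φ := fun _ : Fin n ↦ 𝕜) j).smulRight
    (Pi.single (M := fun _ : Fin n ↦ 𝕜) i 1)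

lemma matrixOperator_apply {n : ℕ} {𝕜 : Type*} [RCLike 𝕜] (a : Fin n → Fin n → ℝ)
    (v : Fin n → 𝕜) (i : Fin n) : matrixOperator 𝕜 a v i = ∑ j, a i j • v j := by
  simp only [matrixOperator, sum_apply, smul_apply, Finset.sum_apply, Pi.smul_apply,
    ContinuousLinearMap.smulRight_apply, ContinuousLinearMap.proj_apply]
  rw [Finset.sum_eq_single i]
  · simp
  · intro k _ hk
    simp [hk.symm]
  · simp

lemma contDiff_matrixOperator {n : ℕ} {𝕜 : Type*} [RCLike 𝕜] :
    ContDiff ℝ ω (matrixOperator (n := n) 𝕜) := by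
  unfold matrixOperator
  exact ContDiff.sum fun i _ ↦ ContDiff.sum fun j _ ↦
    (contDiff_apply_apply ℝ ℝ i j).smul contDiff_const

/-- A simple eigenvalue and its eigenvector depend smoothly on the entries of a real matrix. -/
lemma exists_matrix_eigenvector_family {n : ℕ} {𝕜 : Type*} [RCLike 𝕜] {a₀ : Fin n → Fin n → ℝ}
    {v₀ : Fin n → 𝕜} {μ₀ : 𝕜} (h₀ : ∀ i, ∑ j, a₀ i j • v₀ j = μ₀ * v₀ i) (hv₀ : v₀ ≠ 0)
    (simple : ∀ (w : Fin n → 𝕜) (ν : 𝕜), (∀ i, ∑ j, a₀ i j • w j - μ₀ * w i = ν * v₀ i) →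
      ν = 0 ∧ ∃ c : 𝕜, w = c • v₀) :
    ∃ (v : (Fin n → Fin n → ℝ) → Fin n → 𝕜) (μ : (Fin n → Fin n → ℝ) → 𝕜),
      v a₀ = v₀ ∧ μ a₀ = μ₀ ∧ ∀ᶠ a in nhds a₀, (∀ i, ∑ j, a i j • v a j = μ a * v a i) ∧
        ContDiffAt ℝ ω v a ∧ ContDiffAt ℝ ω μ a := by
  obtain ⟨v, μ, hv, hμ, hev⟩ := exists_eigenvector_family (A₀ := matrixOperator 𝕜 a₀) (v₀ := v₀)
    (μ₀ := μ₀) (funext fun i ↦ by rw [matrixOperator_apply, h₀]; rfl) hv₀ fun w ν hw ↦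
      simple w ν fun i ↦ by rw [← matrixOperator_apply]; exact congr_fun hw i
  refine ⟨v ∘ matrixOperator 𝕜, μ ∘ matrixOperator 𝕜, hv, hμ, ?_⟩
  filter_upwards [contDiff_matrixOperator.continuous.continuousAt.eventually hev] with a ha
  refine ⟨fun i ↦ ?_, (ha.2.1.restrict_scalars ℝ).comp a contDiff_matrixOperator.contDiffAt,
    (ha.2.2.restrict_scalars ℝ).comp a contDiff_matrixOperator.contDiffAt⟩
  rw [← matrixOperator_apply]
  exact congr_fun ha.1 i

end Eigenvectors

/-! ### Enumerating eigenvalues in opposite pairs. -/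

section Enumeration

/-- A symmetric set of `n` real numbers is enumerated by a function `b` that changes the sign at
partners, and is positive at the first elements of pairs. -/
lemma exists_partner_enumeration {n : ℕ} {S : Set ℝ} (hS : S.ncard = n) (hfin : S.Finite)
    (hneg : ∀ r ∈ S, -r ∈ S) : ∃ b : Fin n → ℝ, Function.Injective b ∧ (∀ i, b i ∈ S) ∧
      (∀ i, b (partner i) = -b i) := by
  classical
  set s := hfin.toFinset with hs
  have hcard : s.card = n := by rw [← hS, Set.ncard_eq_toFinset_card S hfin]
  have hsneg : ∀ r ∈ s, -r ∈ s := by simpa [hs] using hneg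
  set P := s.filter (0 < ·) with hP
  have h1 : (s.filter (· < 0)).card = P.card := by
    refine Finset.card_bij' (fun r _ ↦ -r) (fun r _ ↦ -r) ?_ ?_ (by simp) (by simp)
    · intro r hr
      simp only [hP, Finset.mem_filter] at hr ⊢
      exact ⟨hsneg r hr.1, by linarith [hr.2]⟩
    · intro r hr
      simp only [hP, Finset.mem_filter] at hr ⊢
      exact ⟨hsneg r hr.1, by linarith [hr.2]⟩
  have h2 : (s.filter (· = 0)).card = if (0 : ℝ) ∈ s then 1 else 0 := by
    rw [Finset.filter_eq']
    split_ifs <;> simp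
  have h3 : s.card = P.card + (s.filter (· < 0)).card + (s.filter (· = 0)).card := by
    rw [← Finset.card_filter_add_card_filter_not (s := s) (0 < ·), add_assoc, hP]
    congr 1
    rw [← Finset.card_filter_add_card_filter_not (s := s.filter fun r ↦ ¬ 0 < r) (· < 0),
      Finset.filter_filter, Finset.filter_filter]
    congr 2
    · refine Finset.filter_congr fun r _ ↦ ⟨fun h ↦ h.2, fun h ↦ ⟨not_lt.2 h.le, h⟩⟩
    · refine Finset.filter_congr fun r _ ↦ ⟨fun h ↦ ?_, fun h ↦ by simp [h]⟩
      exact le_antisymm (not_lt.1 h.1) (not_lt.1 h.2)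
  -- Negation matches positive and negative elements, so `n` is twice the number of positive ones,
  -- plus one exactly if zero occurs.
  have hPn : P.card = n / 2 := by
    rw [hcard, h1, h2] at h3
    split_ifs at h3 <;> omega
  have h0 : n % 2 = 1 → (0 : ℝ) ∈ s := fun hn ↦ by
    by_contra h0
    rw [hcard, h1, h2, if_neg h0] at h3
    omega
  let γ : ℕ → ℝ := fun k ↦ if hk : k < P.card then (P.equivFin.symm ⟨k, hk⟩ : ℝ) else 0
  have hγ : ∀ k, k < n / 2 → γ k ∈ P := fun k hk ↦ by
    simp only [γ, dif_pos (hPn.symm ▸ hk)]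
    exact Subtype.property _
  have hγs : ∀ k, k < n / 2 → γ k ∈ s := fun k hk ↦ (Finset.mem_filter.1 (hγ k hk)).1
  have hγpos : ∀ k, k < n / 2 → 0 < γ k := fun k hk ↦ (Finset.mem_filter.1 (hγ k hk)).2
  have hγinj : ∀ k l, k < n / 2 → l < n / 2 → γ k = γ l → k = l := fun k l hk hl hkl ↦ by
    simp only [γ, dif_pos (hPn.symm ▸ hk), dif_pos (hPn.symm ▸ hl)] at hkl
    simpa using hkl
  -- The pair `2k, 2k + 1` receives `γ k` and `-γ k`; an unpaired last index receives zero.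
  let b : Fin n → ℝ := fun i ↦ if (i : ℕ) % 2 = 0 then
    (if (i : ℕ) + 1 < n then γ (i / 2) else 0) else -γ (i / 2)
  refine ⟨b, fun i j hij ↦ ?_, fun i ↦ ?_, fun i ↦ ?_⟩
  · ext
    have hi := i.2
    have hj := j.2
    have e1 : (i : ℕ) / 2 < n / 2 → 0 < γ (i / 2) := hγpos _
    have e2 : (j : ℕ) / 2 < n / 2 → 0 < γ (j / 2) := hγpos _
    have e3 : (i : ℕ) / 2 < n / 2 → (j : ℕ) / 2 < n / 2 → γ (i / 2) = γ (j / 2) →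
      (i : ℕ) / 2 = j / 2 := hγinj _ _
    simp only [b] at hij
    have g1 : (i : ℕ) / 2 < n / 2 ∨ ((i : ℕ) % 2 = 0 ∧ ¬ (i : ℕ) + 1 < n) := by omega
    have g2 : (j : ℕ) / 2 < n / 2 ∨ ((j : ℕ) % 2 = 0 ∧ ¬ (j : ℕ) + 1 < n) := by omega
    rcases g1 with g1 | ⟨g1, g1'⟩ <;> rcases g2 with g2 | ⟨g2, g2'⟩
    · have f1 := e1 g1
      have f2 := e2 g2
      split_ifs at hij with c1 c2 c3 c4 c5 c6 <;> first | omega | linarith | skip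
      · have := e3 g1 g2 hij; omega
      · have := e3 g1 g2 (neg_injective hij); omega
    · have f1 := e1 g1
      split_ifs at hij <;> first | omega | linarith
    · have f2 := e2 g2
      split_ifs at hij <;> first | omega | linarith
    · omega
  · have hi := i.2
    suffices b i ∈ s by simpa [hs] using this
    simp only [b]
    split_ifs with c1 c2
    · exact hγs _ (by omega)
    · exact h0 (by omega)
    · exact hsneg _ (hγs _ (by omega))
  · have hi := i.2
    simp only [b, partner_val]
    split_ifs with c1 c2 c3 <;> first | omega | simp
    · rw [show ((i : ℕ) + 1) / 2 = i / 2 by omega]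
    · rw [show ((i : ℕ) - 1) / 2 = i / 2 by omega]

end Enumeration

/-! ### Local eigenvector fields of the curvature operator. -/

section Existence

lemma finrank_complexification {n : ℕ} {M : Type*} [TopologicalSpace M]
    [ChartedSpace (EuclideanSpace ℝ (Fin n)) M] (x : M) :
    Module.finrank ℂ (ℂ ⊗[ℝ] TangentSpace (𝓡 n) x) = n := by
  rw [Module.finrank_baseChange, finrank_tangentSpace]

variable {n : ℕ} {M : Type*} [TopologicalSpace M] [ChartedSpace (EuclideanSpace ℝ (Fin n)) M]
  [IsManifold (𝓡 n) ∞ M]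

/-- The vector field `X` is smooth at `x`. -/
abbrev SmoothAt (X : ∀ y : M, TangentSpace (𝓡 n) y) (x : M) : Prop :=
  ContMDiffAt (𝓡 n) ((𝓡 n).prod 𝓘(ℝ, EuclideanSpace ℝ (Fin n))) ∞
    (fun y ↦ TotalSpace.mk' (EuclideanSpace ℝ (Fin n)) y (X y)) x

lemma SmoothAt.eventually_ne (h : Metric n M) {X : ∀ y : M, TangentSpace (𝓡 n) y} {x : M}
    (hX : SmoothAt X x) (hx : X x ≠ 0) : ∀ᶠ y in nhds x, X y ≠ 0 := by
  have hd : DiffAt X x := hX.mdifferentiableAt (by simp)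
  filter_upwards [(hd.inner h hd).continuousAt.eventually_ne (h.pos x _ hx).ne'] with y hy h0
  simp [h0] at hy

/-- The real and imaginary parts of a complex eigenvector of a skew operator. -/
lemma apply_eq_of_skew {h : Metric n M} {x : M}
    {A : TangentSpace (𝓡 n) x →ₗ[ℝ] TangentSpace (𝓡 n) x}
    (hA : ∀ v w, h.inner x (A v) w = -h.inner x v (A w)) {p q : TangentSpace (𝓡 n) x} {α β : ℝ}
    (hp : A p = α • p - β • q) (hq : A q = α • q + β • p) :
    (A p = -β • q ∧ A q = β • p) ∧ (p ≠ 0 ∨ q ≠ 0 → α = 0) := by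
  have self (v) : h.inner x (A v) v = 0 := by
    have := hA v v
    rw [h.symm x v] at this
    linarith
  have h1 := self p
  have h2 := self q
  rw [hp] at h1
  rw [hq] at h2
  simp only [map_sub, map_add, map_smul, sub_apply, add_apply, smul_apply, smul_eq_mul,
    h.symm x q p] at h1 h2
  -- The sum of `h(A p, p) = 0` and `h(A q, q) = 0`, in which the cross terms cancel.
  have h3 : α * (h.inner x p p + h.inner x q q) = 0 := by linarith
  have nonneg (v) : 0 ≤ h.inner x v v := by
    by_cases hv : v = 0
    · simp [hv]
    · exact (h.pos x v hv).le
  by_cases hα : α = 0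
  · subst hα
    exact ⟨⟨by rw [hp]; module, by rw [hq]; module⟩, fun _ ↦ rfl⟩
  · have h4 := (mul_eq_zero.1 h3).resolve_left hα
    have hp0 : p = 0 := by
      by_contra h0
      linarith [h.pos x p h0, nonneg q]
    have hq0 : q = 0 := by
      by_contra h0
      linarith [h.pos x q h0, nonneg p]
    simp [hp0, hq0]

variable [T2Space M] (cov : Connection n M)
  [CovariantDerivative.ContMDiffCovariantDerivative cov ∞]

/-- A local frame in which the curvature operator is given by a smooth matrix. -/
structure CurvatureMatrix (ξ₁ ξ₂ : ∀ y : M, TangentSpace (𝓡 n) y) (s : Set M) where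
  frame : Fin n → ∀ y : M, TangentSpace (𝓡 n) y
  coeff : M → Fin n → Fin n → ℝ
  smooth_frame : ∀ i, SmoothOn (frame i) s
  smooth_coeff : ContMDiffOn (𝓡 n) 𝓘(ℝ, Fin n → Fin n → ℝ) ∞ coeff s
  injective : ∀ y ∈ s, ∀ c d : Fin n → ℝ, ∑ i, c i • frame i y = ∑ i, d i • frame i y → c = d
  surjective : ∀ y ∈ s, ∀ v : TangentSpace (𝓡 n) y, ∃ c : Fin n → ℝ, v = ∑ i, c i • frame i y
  apply : ∀ y ∈ s, ∀ j, curvature cov (ξ₁ y) (ξ₂ y) (frame j y) = ∑ i, coeff y i j • frame i y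

variable {cov}

/-- The pointwise operator is defined through extensions that change with the point. By
`IsParallel.curvature_apply` it agrees with the curvature of the fields themselves, whose
coefficients in a local frame are smooth. -/
lemma exists_curvatureMatrix {h : Metric n M} (hh : IsParallel cov h)
    {ξ₁ ξ₂ : ∀ y : M, TangentSpace (𝓡 n) y} {s : Set M} {x : M} (hs : IsOpen s) (hx : x ∈ s)
    (hξ₁ : SmoothOn ξ₁ s) (hξ₂ : SmoothOn ξ₂ s) :
    ∃ t ⊆ s, IsOpen t ∧ x ∈ t ∧ Nonempty (CurvatureMatrix cov ξ₁ ξ₂ t) := by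
  let t := trivializationAt (EuclideanSpace ℝ (Fin n)) (TangentSpace (𝓡 n) : M → Type) x
  let b := (EuclideanSpace.basisFun (Fin n) ℝ).toBasis
  have hopen : IsOpen (s ∩ t.baseSet) := hs.inter t.open_baseSet
  have hframe (i) : SmoothOn (t.localFrame b i) (s ∩ t.baseSet) :=
    (t.contMDiffOn_localFrame_baseSet (I := 𝓡 n) ∞ b i).mono Set.inter_subset_right
  have hR (j) : SmoothOn (curvatureField cov ξ₁ ξ₂ (t.localFrame b j)) (s ∩ t.baseSet) :=
    SmoothOn.curvField cov hopen (hξ₁.mono Set.inter_subset_left)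
      (hξ₂.mono Set.inter_subset_left) (hframe j)
  refine ⟨s ∩ t.baseSet, Set.inter_subset_left, hopen,
    ⟨hx, FiberBundle.mem_baseSet_trivializationAt' x⟩, ⟨{
      frame := t.localFrame b
      coeff := fun y i j ↦
        t.localFrameCoeff (𝓡 n) b i y (curvatureField cov ξ₁ ξ₂ (t.localFrame b j) y)
      smooth_frame := hframe
      smooth_coeff := ?_
      injective := fun y hy c d hcd ↦ ?_
      surjective := fun y hy v ↦ ?_
      apply := fun y hy j ↦ ?_ }⟩⟩
  · refine contMDiffOn_pi_space.2 fun i ↦ contMDiffOn_pi_space.2 fun j ↦ ?_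
    exact contMDiffOn_localFrameCoeff (e := t) b hopen Set.inter_subset_right (hR j) i
  · have hind := (t.basisAt b hy.2).linearIndependent
    simp only [t.localFrame_apply_of_mem_baseSet b hy.2] at hcd
    exact funext fun i ↦ Fintype.linearIndependent_iffₛ.1 hind _ _ hcd i
  · refine ⟨(t.basisAt b hy.2).repr v, ?_⟩
    simp only [t.localFrame_apply_of_mem_baseSet b hy.2]
    exact ((t.basisAt b hy.2).sum_repr v).symm
  · rw [hh.curvature_apply hopen hy (hξ₁.mono Set.inter_subset_left)
      (hξ₂.mono Set.inter_subset_left) (hframe j)]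
    exact t.eq_sum_localFrameCoeff_smul hy.2

namespace CurvatureMatrix

variable {ξ₁ ξ₂ : ∀ y : M, TangentSpace (𝓡 n) y} {s : Set M} (C : CurvatureMatrix cov ξ₁ ξ₂ s)

lemma curvature_sum {y : M} (hy : y ∈ s) (c : Fin n → ℝ) :
    curvature cov (ξ₁ y) (ξ₂ y) (∑ j, c j • C.frame j y) =
      ∑ i, (∑ j, C.coeff y i j * c j) • C.frame i y := by
  simp only [map_sum, map_smul, C.apply y hy, Finset.smul_sum, Finset.sum_smul]
  rw [Finset.sum_comm]
  simp only [smul_smul, mul_comm]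

/-- The vector with complex coordinates `c` in the frame. -/
def complexVector (y : M) (c : Fin n → ℂ) : ℂ ⊗[ℝ] TangentSpace (𝓡 n) y :=
  1 ⊗ₜ[ℝ] (∑ i, (c i).re • C.frame i y) + Complex.I ⊗ₜ[ℝ] (∑ i, (c i).im • C.frame i y)

lemma complexVector_eq (y : M) (c : Fin n → ℂ) :
    C.complexVector y c = ∑ i, c i • (1 : ℂ) ⊗ₜ[ℝ] C.frame i y := by
  simp only [complexVector, TensorProduct.tmul_sum, ← Finset.sum_add_distrib]
  refine Finset.sum_congr rfl fun i _ ↦ ?_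
  rw [← TensorProduct.smul_tmul, ← TensorProduct.smul_tmul, ← TensorProduct.add_tmul,
    TensorProduct.smul_tmul', smul_eq_mul, mul_one]
  congr 1
  simpa [mul_comm] using Complex.re_add_im (c i)

lemma complexVector_injective {y : M} (hy : y ∈ s) : Function.Injective (C.complexVector y) := by
  intro c d hcd
  obtain ⟨h1, h2⟩ := complex_tensor_inj hcd
  funext i
  exact Complex.ext (congr_fun (C.injective y hy _ _ h1) i) (congr_fun (C.injective y hy _ _ h2) i)

lemma complexVector_smul (y : M) (r : ℂ) (c : Fin n → ℂ) :
    C.complexVector y (fun i ↦ r * c i) = r • C.complexVector y c := by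
  simp only [complexVector_eq, Finset.smul_sum, smul_smul]

lemma complexVector_sub (y : M) (c d : Fin n → ℂ) :
    C.complexVector y (fun i ↦ c i - d i) = C.complexVector y c - C.complexVector y d := by
  simp only [complexVector_eq, sub_smul, Finset.sum_sub_distrib]

lemma curvatureC_complexVector {y : M} (hy : y ∈ s) (c : Fin n → ℂ) :
    curvatureC cov (ξ₁ y) (ξ₂ y) (C.complexVector y c) =
      C.complexVector y fun i ↦ ∑ j, C.coeff y i j • c j := by
  simp only [complexVector, map_add, LinearMap.baseChange_tmul, C.curvature_sum hy]
  simp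

variable {x : M}

lemma exists_complexVector_eq (hx : x ∈ s) (z : ℂ ⊗[ℝ] TangentSpace (𝓡 n) x) :
    ∃ c, C.complexVector x c = z := by
  obtain ⟨p, q, rfl⟩ := complex_tensor_exists z
  obtain ⟨c, rfl⟩ := C.surjective x hx p
  obtain ⟨d, rfl⟩ := C.surjective x hx q
  exact ⟨fun i ↦ ⟨c i, d i⟩, rfl⟩

lemma smoothAt_coeff (hs : IsOpen s) (hx : x ∈ s) :
    ContMDiffAt (𝓡 n) 𝓘(ℝ, Fin n → Fin n → ℝ) ∞ C.coeff x :=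
  C.smooth_coeff.contMDiffAt (hs.mem_nhds hx)

lemma smoothAt_sum (hs : IsOpen s) (hx : x ∈ s) {c : M → Fin n → ℝ}
    (hc : ∀ i, ContMDiffAt (𝓡 n) 𝓘(ℝ) ∞ (fun y ↦ c y i) x) :
    SmoothAt (fun y ↦ ∑ i, c y i • C.frame i y) x :=
  ContMDiffAt.sum_section fun i _ ↦
    (hc i).smul_section ((C.smooth_frame i).contMDiffAt (hs.mem_nhds hx))

/-- Near `x`, an eigenvalue extends to an eigenvalue with a smooth eigenvector field. -/
lemma exists_eigenvector_fields (C : CurvatureMatrix cov ξ₁ ξ₂ s) {h : Metric n M} (hh : IsParallel cov h) (hs : IsOpen s)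
    (hx : x ∈ s) (hd : HasDistinctEigenvalues cov (ξ₁ x) (ξ₂ x)) {b : ℝ}
    (hb : (curvatureC cov (ξ₁ x) (ξ₂ x)).HasEigenvalue (Complex.I * b)) :
    ∃ (P Q : ∀ y : M, TangentSpace (𝓡 n) y) (l : M → ℝ), ContinuousAt l x ∧ l x = b ∧
      (P x ≠ 0 ∨ Q x ≠ 0) ∧ ∀ᶠ y in nhds x, SmoothAt P y ∧ SmoothAt Q y ∧
        curvature cov (ξ₁ y) (ξ₂ y) (P y) = -l y • Q y ∧
        curvature cov (ξ₁ y) (ξ₂ y) (Q y) = l y • P y := by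
  obtain ⟨z, hz⟩ := hb.exists_hasEigenvector
  obtain ⟨v₀, rfl⟩ := C.exists_complexVector_eq hx z
  have h₀ : ∀ i, ∑ j, C.coeff x i j • v₀ j = Complex.I * b * v₀ i := by
    refine congr_fun (C.complexVector_injective hx ?_)
    rw [← C.curvatureC_complexVector hx, C.complexVector_smul, hz.apply_eq_smul]
  have hv₀ : v₀ ≠ 0 := by
    rintro rfl
    exact hz.2 (by simp [complexVector])
  obtain ⟨v, μ, hv, hμ, hev⟩ := exists_matrix_eigenvector_family h₀ hv₀ fun w ν hw ↦ by
    have := eq_smul_of_ncard_eigenvalues (hd.trans (finrank_complexification x).symm) hz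
      (w := C.complexVector x w) (ν := ν) (by
        rw [C.curvatureC_complexVector hx, ← C.complexVector_smul, ← C.complexVector_sub,
          ← C.complexVector_smul]
        exact congr_arg _ (funext hw))
    obtain ⟨h1, c, hc⟩ := this
    refine ⟨h1, c, C.complexVector_injective hx ?_⟩
    rw [hc, ← C.complexVector_smul]
    rfl
  have hcont := (C.smoothAt_coeff hs hx).continuousAt
  refine ⟨fun y ↦ ∑ i, (v (C.coeff y) i).re • C.frame i y,
    fun y ↦ ∑ i, (v (C.coeff y) i).im • C.frame i y, fun y ↦ (μ (C.coeff y)).im, ?_, by simp [hμ],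
    ?_, ?_⟩
  · exact Complex.continuous_im.continuousAt.comp
      (hev.self_of_nhds.2.2.continuousAt.comp hcont)
  · have := ((baseChange_eigenvector_iff _ _ _ _).1 hz).2
    rwa [← hv] at this
  · filter_upwards [hcont.eventually hev, hs.mem_nhds hx] with y ⟨hy, hy', _⟩ hys
    have hsm : ContMDiffAt (𝓡 n) 𝓘(ℝ, Fin n → ℂ) ∞ (fun y ↦ v (C.coeff y)) y :=
      (hy'.of_le le_top).contMDiffAt.comp y (C.smoothAt_coeff hs hys)
    have hsm' := contMDiffAt_pi_space.1 hsm
    have heig : curvatureC cov (ξ₁ y) (ξ₂ y) (C.complexVector y (v (C.coeff y))) =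
        μ (C.coeff y) • C.complexVector y (v (C.coeff y)) := by
      rw [C.curvatureC_complexVector hys, ← C.complexVector_smul]
      exact congr_arg _ (funext hy)
    refine ⟨C.smoothAt_sum hs hys fun i ↦
        (Complex.reCLM.contDiff.contMDiff.contMDiffAt.comp y (hsm' i)),
      C.smoothAt_sum hs hys fun i ↦
        (Complex.imCLM.contDiff.contMDiff.contMDiffAt.comp y (hsm' i)), ?_⟩
    -- The family is not known here to be nonzero away from `x`; where it vanishes, the equations
    -- are trivial.
    by_cases h0 : C.complexVector y (v (C.coeff y)) = 0
    · have h0' : v (C.coeff y) = 0 := C.complexVector_injective hys (by rw [h0]; simp [complexVector])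
      simp [h0']
    obtain ⟨⟨h1, h2⟩, -⟩ := (baseChange_eigenvector_iff _ _ _ _).1
      (Module.End.hasEigenvector_iff.2 ⟨Module.End.mem_eigenspace_iff.2 heig, h0⟩)
    exact (apply_eq_of_skew (hh.curvature_skew _ _) h1 h2).1

/-- Near `x`, a null vector extends to a smooth field of null vectors. -/
lemma exists_null_field (C : CurvatureMatrix cov ξ₁ ξ₂ s) {h : Metric n M} (hh : IsParallel cov h) (hs : IsOpen s)
    (hx : x ∈ s) (hd : HasDistinctEigenvalues cov (ξ₁ x) (ξ₂ x))
    (h0 : (curvatureC cov (ξ₁ x) (ξ₂ x)).HasEigenvalue 0) :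
    ∃ W : ∀ y : M, TangentSpace (𝓡 n) y, W x ≠ 0 ∧ ∀ᶠ y in nhds x, SmoothAt W y ∧
      curvature cov (ξ₁ y) (ξ₂ y) (W y) = 0 := by
  obtain ⟨w₀, hw₀, hw₀'⟩ : ∃ w : TangentSpace (𝓡 n) x, w ≠ 0 ∧
      curvature cov (ξ₁ x) (ξ₂ x) w = 0 := by
    obtain ⟨p, q, ⟨hp, hq⟩, hpq⟩ := (baseChange_hasEigenvalue_iff _ _).1 h0
    rcases hpq with hp0 | hq0
    · exact ⟨p, hp0, by simpa using hp⟩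
    · exact ⟨q, hq0, by simpa using hq⟩
  have hz : (curvatureC cov (ξ₁ x) (ξ₂ x)).HasEigenvector 0
      (1 ⊗ₜ[ℝ] w₀ + Complex.I ⊗ₜ[ℝ] (0 : TangentSpace (𝓡 n) x)) :=
    (baseChange_eigenvector_iff _ _ _ _).2 ⟨by simp [hw₀'], Or.inl hw₀⟩
  obtain ⟨v₀, rfl⟩ := C.surjective x hx w₀
  have h₀ : ∀ i, ∑ j, C.coeff x i j • v₀ j = (0 : ℝ) * v₀ i := by
    refine congr_fun (C.injective x hx _ _ ?_)
    simpa [C.curvature_sum hx] using hw₀'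
  have hv₀ : v₀ ≠ 0 := by
    rintro rfl
    simp at hw₀
  -- The family is taken over `ℝ`, so the field is real; simplicity over `ℝ` is deduced from
  -- simplicity of the complexified operator.
  obtain ⟨v, μ, hv, hμ, hev⟩ := exists_matrix_eigenvector_family h₀ hv₀ fun w ν hw ↦ by
    have hw' : curvature cov (ξ₁ x) (ξ₂ x) (∑ i, w i • C.frame i x) =
        ν • ∑ i, v₀ i • C.frame i x := by
      rw [C.curvature_sum hx, Finset.smul_sum]
      refine Finset.sum_congr rfl fun i _ ↦ ?_
      rw [smul_smul, ← hw i]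
      simp
    have := eq_smul_of_ncard_eigenvalues (hd.trans (finrank_complexification x).symm) hz
      (w := 1 ⊗ₜ[ℝ] ∑ i, w i • C.frame i x) (ν := (ν : ℂ)) (by
        rw [LinearMap.baseChange_tmul, hw', zero_smul, sub_zero, TensorProduct.tmul_zero, add_zero,
          ← TensorProduct.smul_tmul, Complex.real_smul, TensorProduct.smul_tmul', smul_eq_mul])
    obtain ⟨h1, c, hc⟩ := this
    refine ⟨by simpa using h1, c.re, C.injective x hx _ _ ?_⟩
    have h2 := (complex_tensor_inj (p := ∑ i, w i • C.frame i x) (q := 0)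
      (p' := c.re • ∑ i, v₀ i • C.frame i x) (q' := c.im • ∑ i, v₀ i • C.frame i x) (by
        rw [← TensorProduct.smul_tmul, ← TensorProduct.smul_tmul, ← TensorProduct.add_tmul]
        simp only [TensorProduct.tmul_zero, add_zero] at hc ⊢
        rw [hc, TensorProduct.smul_tmul', smul_eq_mul, mul_one]
        congr 1
        simpa [mul_comm] using (Complex.re_add_im c).symm)).1
    rw [h2, Finset.smul_sum]
    simp [smul_smul]
  have hcont := (C.smoothAt_coeff hs hx).continuousAt
  refine ⟨fun y ↦ ∑ i, v (C.coeff y) i • C.frame i y, by simpa only [hv], ?_⟩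
  filter_upwards [hcont.eventually hev, hs.mem_nhds hx] with y ⟨hy, hy', _⟩ hys
  have hsm : ContMDiffAt (𝓡 n) 𝓘(ℝ, Fin n → ℝ) ∞ (fun y ↦ v (C.coeff y)) y :=
    (hy'.of_le le_top).contMDiffAt.comp y (C.smoothAt_coeff hs hys)
  refine ⟨C.smoothAt_sum hs hys (contMDiffAt_pi_space.1 hsm), ?_⟩
  -- Written with zero imaginary part, so that skewness rules out a nonzero real eigenvalue: the
  -- vectors remain null near `x`.
  have heig : curvature cov (ξ₁ y) (ξ₂ y) (∑ i, v (C.coeff y) i • C.frame i y) =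
      μ (C.coeff y) • (∑ i, v (C.coeff y) i • C.frame i y) - (0 : ℝ) • 0 := by
    rw [C.curvature_sum hys]
    simp only [smul_eq_mul] at hy
    simp only [hy, Finset.smul_sum, smul_smul, smul_zero, sub_zero]
  have := (apply_eq_of_skew (hh.curvature_skew _ _) heig (by simp)).1.1
  simpa using this

end CurvatureMatrix

end Existence

/-! ### Normalization of eigenvector fields. -/

section Normalize

variable {n : ℕ} {M : Type*} [TopologicalSpace M] [ChartedSpace (EuclideanSpace ℝ (Fin n)) M]
  [IsManifold (𝓡 n) ∞ M] {h : Metric n M}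

/-- Normalizing the vectors of a normal form gives an orthonormal frame in normal form. -/
lemma IsNormalForm.normalize {x : M} {A : Module.End ℝ (TangentSpace (𝓡 n) x)}
    {Z : Fin n → TangentSpace (𝓡 n) x} {b : Fin n → ℝ} (nf : IsNormalForm A Z b)
    (hb : Function.Injective b) (hA : ∀ v w, h.inner x (A v) w = -h.inner x v (A w))
    (hZ : ∀ i, Z i ≠ 0) :
    IsNormalForm A (fun i ↦ (√(h.inner x (Z i) (Z i)))⁻¹ • Z i) b ∧
      ∀ i j, h.inner x ((√(h.inner x (Z i) (Z i)))⁻¹ • Z i) ((√(h.inner x (Z j) (Z j)))⁻¹ • Z j) =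
        if i = j then 1 else 0 := by
  -- Skewness gives partners equal length, so normalizing does not change the speeds.
  have hnorm : ∀ i, h.inner x (Z (ParallelMetrics.partner i)) (Z (ParallelMetrics.partner i)) =
      h.inner x (Z i) (Z i) := by
    intro i
    by_cases hi : ParallelMetrics.partner i = i
    · rw [hi]
    have hbi : b i ≠ 0 := fun h0 ↦ hi (hb (by rw [nf.partner, h0, neg_zero]))
    have h1 := hA (Z i) (Z (ParallelMetrics.partner i))
    rw [nf.apply, nf.apply_partner] at h1
    simp only [map_smul, smul_apply, smul_eq_mul] at h1
    exact mul_left_cancel₀ hbi (by linarith)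
  refine ⟨⟨fun i ↦ ?_, nf.partner⟩, fun i j ↦ ?_⟩
  · rw [map_smul, nf.apply, hnorm, smul_comm]
  · simp only [map_smul, smul_apply, smul_eq_mul]
    by_cases hij : i = j
    · subst hij
      have hpos := h.pos x _ (hZ i)
      rw [if_pos rfl, ← mul_assoc, ← mul_inv, Real.mul_self_sqrt hpos.le, inv_mul_cancel₀ hpos.ne']
    · rw [if_neg hij]
      have := nf.form_eq_zero (G := form h x) hb (h.symm x) hA hij
      rw [form_apply] at this
      rw [this, mul_zero, mul_zero]

end Normalize

/-! ### Existence of adapted covers. -/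

section Cover

variable {n : ℕ} {M : Type*} [TopologicalSpace M] [ChartedSpace (EuclideanSpace ℝ (Fin n)) M]
  [IsManifold (𝓡 n) ∞ M] [T2Space M] {cov : Connection n M}
  [CovariantDerivative.ContMDiffCovariantDerivative cov ∞] {h : Metric n M}

section Eigenvalues

variable {x : M} {u v : TangentSpace (𝓡 n) x}

lemma re_eq_zero_of_hasEigenvalue (hh : IsParallel cov h) {μ : ℂ}
    (hμ : (curvatureC cov u v).HasEigenvalue μ) : μ.re = 0 := by
  obtain ⟨p, q, ⟨hp, hq⟩, hpq⟩ := (baseChange_hasEigenvalue_iff _ _).1 hμ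
  exact (apply_eq_of_skew (hh.curvature_skew u v) hp hq).2 hpq

/-- The operator is real, so the conjugate `p - i q` of an eigenvector is an eigenvector for the
conjugate eigenvalue. -/
lemma hasEigenvalue_neg {r : ℝ} (hr : (curvatureC cov u v).HasEigenvalue (Complex.I * r)) :
    (curvatureC cov u v).HasEigenvalue (Complex.I * ((-r : ℝ) : ℂ)) := by
  obtain ⟨p, q, ⟨hp, hq⟩, hpq⟩ := (baseChange_hasEigenvalue_iff _ _).1 hr
  refine (baseChange_hasEigenvalue_iff _ _).2 ⟨p, -q, ⟨?_, ?_⟩, by simpa using hpq⟩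
  · rw [hp]; simp
  · rw [map_neg, hq]; simp

/-- The eigenvalues of a generic curvature operator, ordered in conjugate pairs. -/
lemma exists_eigenvalue_enumeration (hh : IsParallel cov h) (hd : HasDistinctEigenvalues cov u v) :
    ∃ b : Fin n → ℝ, Function.Injective b ∧
      (∀ i, (curvatureC cov u v).HasEigenvalue (Complex.I * b i)) ∧
      ∀ i, b (partner i) = -b i := by
  set S : Set ℝ := {r | (curvatureC cov u v).HasEigenvalue (Complex.I * r)} with hS
  have himg : (fun r : ℝ ↦ Complex.I * r) '' S =
      {μ : ℂ | (curvatureC cov u v).HasEigenvalue μ} := by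
    ext μ
    constructor
    · rintro ⟨r, hr, rfl⟩
      exact hr
    · intro hμ
      have h1 : Complex.I * (μ.im : ℂ) = μ := by
        apply Complex.ext <;> simp [re_eq_zero_of_hasEigenvalue hh hμ]
      exact ⟨μ.im, by simpa only [hS, Set.mem_ofPred_eq, h1] using hμ, h1⟩
  have hinj : Function.Injective fun r : ℝ ↦ Complex.I * r := fun r r' hr ↦ by
    simpa using hr
  have hfin : {μ : ℂ | (curvatureC cov u v).HasEigenvalue μ}.Finite :=
    inferInstanceAs (Finite (curvatureC cov u v).Eigenvalues)
  refine exists_partner_enumeration (S := S) ?_ ?_ fun r hr ↦ hasEigenvalue_neg hr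
  · rw [← Set.ncard_image_of_injective S hinj, himg]
    exact hd
  · exact Set.Finite.of_finite_image (himg ▸ hfin) hinj.injOn

end Eigenvalues

/-- Near each point, there are smooth fields bringing the curvature operator into normal form. -/
lemma exists_normalForm_fields (hh : IsParallel cov h) {x : M}
    {ξ₁ ξ₂ : ∀ y : M, TangentSpace (𝓡 n) y} {s : Set M} (hs : IsOpen s) (hx : x ∈ s)
    (hξ₁ : SmoothOn ξ₁ s) (hξ₂ : SmoothOn ξ₂ s)
    (hd : HasDistinctEigenvalues cov (ξ₁ x) (ξ₂ x)) :
    ∃ (Z : Fin n → ∀ y : M, TangentSpace (𝓡 n) y) (b : Fin n → M → ℝ), ∀ᶠ y in nhds x,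
      (∀ i, SmoothAt (Z i) y) ∧ (∀ i, Z i y ≠ 0) ∧
        IsNormalForm (curvature cov (ξ₁ y) (ξ₂ y)) (fun i ↦ Z i y) (fun i ↦ b i y) ∧
        Function.Injective fun i ↦ b i y := by
  obtain ⟨t, -, ht, hxt, ⟨C⟩⟩ := exists_curvatureMatrix hh hs hx hξ₁ hξ₂
  obtain ⟨b₀, hb₀, heig, hpart⟩ := exists_eigenvalue_enumeration hh hd
  have main : ∀ i, ∃ (P Q : ∀ y : M, TangentSpace (𝓡 n) y) (l : M → ℝ), ContinuousAt l x ∧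
      l x = b₀ i ∧ P x ≠ 0 ∧ Q x ≠ 0 ∧ (partner i = i → P = Q ∧ l = 0) ∧
      ∀ᶠ y in nhds x, SmoothAt P y ∧ SmoothAt Q y ∧
        curvature cov (ξ₁ y) (ξ₂ y) (P y) = -l y • Q y ∧
        curvature cov (ξ₁ y) (ξ₂ y) (Q y) = l y • P y := by
    intro i
    by_cases hi : partner i = i
    · have h0 : b₀ i = 0 := by
        have := hpart i
        rw [hi] at this
        linarith
      have h1 := heig i
      rw [h0, Complex.ofReal_zero, mul_zero] at h1
      obtain ⟨W, hW, hev⟩ := C.exists_null_field hh ht hxt hd h1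
      refine ⟨W, W, 0, continuousAt_const, h0.symm, hW, hW, fun _ ↦ ⟨rfl, rfl⟩, ?_⟩
      filter_upwards [hev] with y hy
      exact ⟨hy.1, hy.1, by simp [hy.2], by simp [hy.2]⟩
    · have h0 : b₀ i ≠ 0 := fun h0 ↦ hi (hb₀ (by rw [hpart, h0, neg_zero]))
      obtain ⟨P, Q, l, hl, hlx, hPQ, hev⟩ := C.exists_eigenvector_fields hh ht hxt hd (heig i)
      obtain ⟨-, -, hP, hQ⟩ := hev.self_of_nhds
      rw [hlx] at hP hQ
      refine ⟨P, Q, l, hl, hlx, fun hP0 ↦ ?_, fun hQ0 ↦ ?_, fun h' ↦ absurd h' hi, hev⟩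
      · rw [hP0, map_zero] at hP
        have : Q x = 0 := by simpa [h0] using hP.symm
        simp [hP0, this] at hPQ
      · rw [hQ0, map_zero] at hQ
        have : P x = 0 := by simpa [h0] using hQ.symm
        simp [hQ0, this] at hPQ
  choose P Q l hl hlx hP hQ hfix hev using main
  -- Both members of a pair are taken from the family of its even index, as real and imaginary part.
  -- Thus the speeds are exactly opposite at all nearby points and not only at `x`.
  let Z (i : Fin n) : ∀ y : M, TangentSpace (𝓡 n) y :=
    if (i : ℕ) % 2 = 0 then P i else Q (partner i)
  let b (i : Fin n) : M → ℝ := if (i : ℕ) % 2 = 0 then l i else -l (partner i)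
  have hZx : ∀ i, Z i x ≠ 0 := fun i ↦ by
    simp only [Z]
    split_ifs
    exacts [hP i, hQ _]
  have hbx : ∀ i, b i x = b₀ i := fun i ↦ by
    simp only [b]
    split_ifs
    · exact hlx i
    · rw [Pi.neg_apply, hlx, hpart, neg_neg]
  have hbc : ∀ i, ContinuousAt (b i) x := fun i ↦ by
    simp only [b]
    split_ifs
    exacts [hl i, (hl _).neg]
  have hZs : ∀ᶠ y in nhds x, ∀ i, SmoothAt (Z i) y := by
    filter_upwards [Filter.eventually_all.2 hev] with y hy i
    simp only [Z]
    split_ifs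
    exacts [(hy i).1, (hy _).2.1]
  refine ⟨Z, b, ?_⟩
  filter_upwards [hZs, Filter.eventually_all.2 hev,
    Filter.eventually_all.2 fun i ↦ (hZs.self_of_nhds i).eventually_ne h (hZx i),
    Filter.eventually_all.2 fun p : {p : Fin n × Fin n // p.1 ≠ p.2} ↦
      ((hbc p.1.1).sub (hbc p.1.2)).eventually_ne (y := 0) (by
        rw [Pi.sub_apply, hbx, hbx, sub_ne_zero]
        exact hb₀.ne p.2)] with y h1 h2 h3 h4
  refine ⟨h1, h3, ⟨fun i ↦ ?_, fun i ↦ ?_⟩, fun i j hij ↦ ?_⟩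
  · have hpi := partner_val i
    by_cases hi : (i : ℕ) % 2 = 0
    · by_cases hfi : partner i = i
      · have h5 := (h2 i).2.2.1
        rw [(hfix i hfi).1] at h5
        simp only [Z, b, hfi, if_pos hi, h5, (hfix i hfi).1]
      · have hp : ¬ (partner i : ℕ) % 2 = 0 := fun h0 ↦ hfi (Fin.ext (by
          rw [if_pos hi] at hpi
          split_ifs at hpi <;> omega))
        simp only [Z, b, if_pos hi, if_neg hp, partner_partner, (h2 i).2.2.1]
    · have hp : (partner i : ℕ) % 2 = 0 := by
        rw [if_neg hi] at hpi
        omega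
      simp only [Z, b, if_pos hp, if_neg hi, (h2 (partner i)).2.2.2, Pi.neg_apply, neg_neg]
  · have hpi := partner_val i
    by_cases hi : (i : ℕ) % 2 = 0
    · by_cases hfi : partner i = i
      · simp only [b, hfi, if_pos hi, (hfix i hfi).2, Pi.zero_apply, neg_zero]
      · have hp : ¬ (partner i : ℕ) % 2 = 0 := fun h0 ↦ hfi (Fin.ext (by
          rw [if_pos hi] at hpi
          split_ifs at hpi <;> omega))
        simp only [b, if_pos hi, if_neg hp, partner_partner, Pi.neg_apply]
    · have hp : (partner i : ℕ) % 2 = 0 := by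
        rw [if_neg hi] at hpi
        omega
      simp only [b, if_pos hp, if_neg hi, Pi.neg_apply, neg_neg]
  · by_contra hne
    exact h4 ⟨(i, j), hne⟩ (sub_eq_zero.2 hij)

/-- Fields in normal form can be normalized to an adapted frame. -/
def AdaptedFrame.ofNormalForm (hh : IsParallel cov h) {U : Opens M}
    {ξ₁ ξ₂ : ∀ y : M, TangentSpace (𝓡 n) y} (hξ₁ : SmoothOn ξ₁ (U : Set M))
    (hξ₂ : SmoothOn ξ₂ (U : Set M)) (Z : Fin n → ∀ y : M, TangentSpace (𝓡 n) y)
    (b : Fin n → M → ℝ) (hZ : ∀ i, SmoothOn (Z i) (U : Set M)) (hZ0 : ∀ y ∈ U, ∀ i, Z i y ≠ 0)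
    (nf : ∀ y ∈ U, IsNormalForm (curvature cov (ξ₁ y) (ξ₂ y)) (fun i ↦ Z i y) (fun i ↦ b i y))
    (hb : ∀ y ∈ U, Function.Injective fun i ↦ b i y) : AdaptedFrame cov h U :=
  have key := fun y hy ↦ (nf y hy).normalize (h := h) (hb y hy) (hh.curvature_skew _ _) (hZ0 y hy)
  have ne := fun y hy i ↦ show (√(h.inner y (Z i y) (Z i y)))⁻¹ • Z i y ≠ 0 from fun h0 ↦ by
    have := (key y hy).2 i i
    rw [h0] at this
    simp at this
  { ξ₁ := ξ₁
    ξ₂ := ξ₂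
    smooth_ξ₁ := hξ₁
    smooth_ξ₂ := hξ₂
    distinct := fun y hy ↦ ((key y hy).1.ncard_eigenvalues_iff (B := form h y)
      (hh.curvature_skew _ _) (ne y hy)
      (eq_zero_of_orthonormal (B := form h y) (key y hy).2 (finrank_tangentSpace y))).2 (hb y hy)
    Y := fun i y ↦ (√(h.inner y (Z i y) (Z i y)))⁻¹ • Z i y
    smooth_Y := fun i y hy ↦ by
      have hpos := h.pos y _ (hZ0 y hy i)
      have h1 : ContMDiffWithinAt (𝓡 n) 𝓘(ℝ) ∞ (fun y ↦ (√(h.inner y (Z i y) (Z i y)))⁻¹) U y :=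
        ContMDiffAt.comp_contMDiffWithinAt (g := fun r : ℝ ↦ (√r)⁻¹) y
          ((Real.contDiffAt_sqrt hpos.ne').inv (Real.sqrt_ne_zero'.2 hpos)).contMDiffAt
          (ContMDiffOn.inner h (hZ i) (hZ i) y hy)
      exact h1.smul_section (hZ i y hy)
    orthonormal := fun y hy ↦ (key y hy).2
    eigen_pair := fun i j hi hij y hy ↦ by
      have hpi : partner i = j := by
        ext
        rw [partner_val, if_pos (Nat.even_iff.1 hi), if_pos (hij ▸ j.2), hij]
      have h1 := (key y hy).1.apply i
      have h2 := (key y hy).1.apply_partner i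
      rw [hpi] at h1 h2
      -- From `A Y_i = -b Y_j` and `A Y_j = b Y_i` it follows that `A (Y_i ± i Y_j) = ± i b (Y_i ± i
      -- Y_j)`.
      refine ⟨⟨Complex.I * b i y, (baseChange_eigenvector_iff _ _ _ _).2
        ⟨⟨by simpa using h1, by simpa using h2⟩, Or.inl (ne y hy i)⟩⟩,
        ⟨Complex.I * (-b i y : ℝ), ?_⟩⟩
      rw [sub_eq_add_neg, ← TensorProduct.tmul_neg]
      refine (baseChange_eigenvector_iff _ _ _ _).2 ⟨⟨?_, ?_⟩, Or.inl (ne y hy i)⟩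
      · simpa using h1
      · rw [map_neg, h2]
        simp
    eigen_last := fun i hi hin y hy ↦ by
      have hpi : partner i = i := by
        ext
        rw [partner_val, if_pos (Nat.even_iff.1 hi), if_neg (by omega)]
      have h0 := (key y hy).1.partner i
      have h1 := (key y hy).1.apply i
      rw [hpi] at h0 h1
      rw [show b i y = 0 by linarith] at h1
      exact Module.End.hasEigenvector_iff.2 ⟨Module.End.mem_eigenspace_iff.2 (by simpa using h1),
        ne y hy i⟩ }

/-- Genericity is needed only at `x`: extending the two vectors smoothly, the normal form with
distinct speeds persists nearby. The component of `x` in that neighbourhood is open because `M` is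
locally connected. -/
lemma exists_adaptedFrame (hh : IsParallel cov h) (hg : IsGeneric cov) (x : M) :
    ∃ U : Opens M, IsConnected (U : Set M) ∧ x ∈ U ∧ Nonempty (AdaptedFrame cov h U) := by
  obtain ⟨u, v, hd⟩ := hg x
  obtain ⟨s, hs, hx, hu, hv⟩ := ext_nhds u v
  rw [← ext_self u, ← ext_self v] at hd
  obtain ⟨Z, b, hev⟩ := exists_normalForm_fields hh hs hx hu hv hd
  obtain ⟨t, ht, htopen, hxt⟩ := eventually_nhds_iff.1 hev
  have : LocallyConnectedSpace M :=
    ChartedSpace.locallyConnectedSpace (EuclideanSpace ℝ (Fin n)) M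
  have hsub : connectedComponentIn (s ∩ t) x ⊆ s ∩ t := connectedComponentIn_subset _ _
  let U : Opens M := ⟨connectedComponentIn (s ∩ t) x, (hs.inter htopen).connectedComponentIn⟩
  refine ⟨U, isConnected_connectedComponentIn_iff.2 ⟨hx, hxt⟩,
    mem_connectedComponentIn ⟨hx, hxt⟩, ⟨AdaptedFrame.ofNormalForm hh
      (hu.mono fun y hy ↦ (hsub hy).1) (hv.mono fun y hy ↦ (hsub hy).1) Z b
      (fun i y hy ↦ ((ht y (hsub hy).2).1 i).contMDiffWithinAt)
      (fun y hy ↦ (ht y (hsub hy).2).2.1) (fun y hy ↦ (ht y (hsub hy).2).2.2.1)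
      (fun y hy ↦ (ht y (hsub hy).2).2.2.2)⟩⟩

lemma nonempty_adaptedCover (hh : IsParallel cov h) (hg : IsGeneric cov) :
    Nonempty (AdaptedCover cov h) := by
  refine ⟨{
    cover := {U | IsConnected (U : Set M) ∧ Nonempty (AdaptedFrame cov h U)}
    connected := fun U hU ↦ hU.1
    covers := fun x ↦ ?_
    frame := fun U ↦ U.2.2.some }⟩
  obtain ⟨U, hU, hx, hF⟩ := exists_adaptedFrame hh hg x
  exact ⟨U, ⟨hU, hF⟩, hx⟩

end Cover

end ParallelMetrics

end

theorem corollary1 {n : ℕ} {M : Type*} [TopologicalSpace M]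
    [ChartedSpace (EuclideanSpace ℝ (Fin n)) M] [IsManifold (𝓡 n) ∞ M]
    [T2Space M] [SecondCountableTopology M] [ConnectedSpace M]
    (cov : ParallelMetrics.Connection n M)
    [CovariantDerivative.ContMDiffCovariantDerivative cov ∞]
    (h_torsion : cov.torsion = 0) (h_generic : ParallelMetrics.IsGeneric cov)
    (h : ParallelMetrics.Metric n M) (h_parallel : ParallelMetrics.IsParallel cov h) :
    Nonempty (ParallelMetrics.AdaptedCover cov h) ∧
    ∀ D : ParallelMetrics.AdaptedCover cov h,
      -- the `Q_a` are well defined, nonzero, and `TM` is their direct sum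
      (∀ (a : D.Block) (U : D.cover), ∀ x ∈ (U : TopologicalSpace.Opens M),
        D.bundle a x = D.bundleOn a U x ∧ D.bundle a x ≠ ⊥) ∧
      (∀ x : M, iSupIndep (fun a ↦ D.bundle a x) ∧ ⨆ a, D.bundle a x = ⊤) ∧
      ∃ (e : Fin D.numBlocks ≃ D.Block)
        (ht : Fin D.numBlocks → ParallelMetrics.CoTensor n M),
        -- `ht a` is the tensor field `h_a`
        (∀ a t, D.IsBlockTensor (e a) t ↔ t = ht a) ∧
        LinearIndependent ℝ ht ∧
        -- the parallel metrics are the open cone spanned by the `h_a`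
        ParallelMetrics.parallelMetrics cov =
          {t | ∃ c : Fin D.numBlocks → ℝ, (∀ a, 0 < c a) ∧ t = ∑ a, c a • ht a} ∧
        -- the parallel metrics form a manifold of dimension `A`, with global coordinates `c_a`
        ∃ _ : ChartedSpace (EuclideanSpace ℝ (Fin D.numBlocks))
            (ParallelMetrics.parallelMetrics cov),
          IsManifold (𝓡 D.numBlocks) ∞ (ParallelMetrics.parallelMetrics cov) ∧
          ∃ Φ : Diffeomorph (𝓡 D.numBlocks) (𝓡 D.numBlocks)
              (ParallelMetrics.orthant D.numBlocks) (ParallelMetrics.parallelMetrics cov) ∞,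
            ∀ c : ParallelMetrics.orthant D.numBlocks,
              (Φ c : ParallelMetrics.CoTensor n M) =
                ∑ a, (c : EuclideanSpace ℝ (Fin D.numBlocks)) a • ht a := by
  refine ⟨ParallelMetrics.nonempty_adaptedCover h_parallel h_generic, fun D ↦ ⟨fun a U x hx ↦
    ⟨D.bundle_eq_bundleOn h_parallel a hx, D.bundle_ne_bot h_parallel a x⟩, fun x ↦
    ⟨D.iSupIndep_bundle h_parallel x, D.iSup_bundle h_parallel x⟩, D.exists_cone h_parallel⟩⟩
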